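/- **Setting.** Let $\mathbb F$ be $\mathbb R$ or $\mathbb C$, let $X$ be a quasi-Banach space over $\mathbb F$ (a space complete for a quasi-norm: homogeneous, definite, $\|f+g\|\le\kappa(\|f\|+\|g\|)$), and let $\mathcal B=(x_n)_{n\ge1}$ be a complete Markushevich basis of $X$: the linear span of the $x_n$ is dense, and there are bounded functionals $x_n^*$ with $x_n^*(x_k)=\delta_{k,n}$. Assume that $\mathcal B$ is $M$-bounded: $\sup_n\|x_n\|\|x_n^*\|<\infty$. $\mathcal B$ is *semi-normalized* if $0<\inf_n\|x_n\|\le\sup_n\|x_n\|<\infty$. Let $\operatorname{supp} f=\{n:x_n^*(f)\ne0\}$, $S_A(f)=\sum_{n\in A}x_n^*(f)x_n$ for finite $A$, and $\mathbf 1_{\varepsilon,A}=\sum_{n\in A}\varepsilon_nx_n$ for signs $|\varepsilon_n|=1$. A finite set $A$ is *greedy* for $f$ if $|x_k^*(f)|\le|x_n^*(f)|$ for all $n\in A$, $k\notin A$; the $m$th greedy set $A_m(f)$ is the greedy set of cardinality $m$ in which ties are broken in favour of smaller indices. $\mathcal B$ is * *quasi-greedy* if $\|S_A(f)\|\le C\|f\|$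 for every $f$ and every finite greedy set $A$ of $f$; * *almost greedy* if $\|f-S_A(f)\|\le C\|f-S_D(f)\|$ whenever $A$ is a finite greedy set of $f$ and $|D|\le|A|$; * *greedy* if $\|f-S_A(f)\|\le C\|f-z\|$ whenever $A$ is a finite greedy set of $f$ and $|\operatorname{supp} z|\le|A|$; * *unconditional* if every $f$ has a unique expansion $f=\sum a_nx_n$ with unconditional convergence; * *super-democratic* if $\|\mathbf 1_{\varepsilon,A}\|\le C\|\mathbf 1_{\delta,D}\|$ for all finite $A,D$ with $|A|\le|D|$ and all signs. The constants $C$ depend on $\mathcal B$ and $X$ only. The *restricted truncation operators are uniformly bounded* if $\|\mathcal U_m(f)\|\le C\|f\|$ for all $m,f$, where $\mathcal U_m(f)=\min_{n\in A}|x_n^*(f)|\sum_{n\in A}\operatorname{sgn}(x_n^*(f))x_n$ with $A=A_m(f)$, $\operatorname{sgn}0=1$ (and $\mathcal U_0=0$). Put $\varphi_u(m)=\sup\{\|\mathbf 1_{\varepsilon,A}\|:|A|\le m\}$ and $\varphi_l(m)=\inf\{\|\mathbf 1_{\varepsilon,A}\|:|A|\ge m\}$, with $A$ finite and $\varepsilon$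 running over all signs. A *symmetric gauge* is a map $\|\cdot\|_S:\mathbb F^{\mathbb N}\to[0,\infty]$ that is definite, homogeneous, monotone in $(|a_n|)_n$, finite on indicators of finite sets, invariant under permutations of $\mathbb N$, and has the Fatou property (if $0\le a_{n,k}\uparrow b_n<\infty$ as $k\to\infty$ for each $n$, then $\|(a_{n,k})_n\|_S\to\|(b_n)_n\|_S$). Its *symmetric space* is $S=\{f:\|f\|_S<\infty\}$, its *fundamental function* is $\varphi[S](m)=\|\sum_{n\le m}e_n\|_S$, and $S_0$ is the closure in $S$ of the finitely supported sequences. $S$ is *quasi-Banach* if $\|\cdot\|_S$ satisfies a quasi-triangle inequality and $S$ is complete. For $D=S$ or $D=S_0$, $D\hookrightarrow X$ via $\mathcal B$ means that for every $f=(a_n)\in D$ the series $\sum a_nx_n$ converges in $X$ and $\|\sum a_nx_n\|\le C\|f\|_S$; $X\hookrightarrow S$ via $\mathcal B$ means $\|(x_n^*(f))_n\|_S\le C\|f\|$ for all $f\in X$. $X$ is *sandwiched between $S_1$ and $S_2$ via $\mathcal B$* if $S_1,S_2$ are symmetric spaces with $\varphi[S_1]\approx\varphi[S_2]$ and $S_1\hookrightarrow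 X\hookrightarrow S_2$ via $\mathcal B$; it is *weakly sandwiched* if $S_1$ is replaced by $(S_1)_0$ in the first embedding. For a weight $w=(w_n)$ (all $w_n>0$) put $s_n=\sum_{j\le n}w_j$. Let $d_{1,p}(w)$, $0<p<\infty$, and $d_{1,\infty}(w)$ be the spaces of $\big(\sum_n (a_n^*)^ps_n^{p-1}w_n\big)^{1/p}$ and $\sup_n a_n^*s_n$, where $(a_n^*)$ is the non-increasing rearrangement of $(|a_n|)$. **Theorem.** Let $\mathcal B$ be an $M$-bounded basis of the quasi-Banach space $X$. 1. Suppose $\mathcal B$ is semi-normalized and $\sup_m\varphi_u(m)=\infty$ (that is, $\mathcal B$ is not equivalent to the unit vector system of $c_0$). Then (i) $\mathcal B$ is almost greedy if and only if it is quasi-greedy and $X$ can be sandwiched between symmetric spaces via $\mathcal B$; (ii) $\mathcal B$ is greedy if and only if it is unconditional and $X$ can be sandwiched between symmetric spaces via $\mathcal B$. 2. If $\mathcal B$ is semi-normalized, with $\varphi_u$ bounded or not, then (i) and (ii) hold with "weakly sandwiched" in place of "sandwiched". 3. If $\mathcal B$ is super-democratic and the restricted truncation operators are uniformly bounded, then there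 are quasi-Banach symmetric spaces $S_1,S_2$ between which $X$ is weakly sandwiched via $\mathcal B$; if moreover $\sup_m\varphi_u(m)=\infty$, then $X$ is sandwiched between these $S_1,S_2$. 4. Suppose $\mathcal B$ is semi-normalized, $X$ is $p$-convex with $0<p\le1$ (that is, $\|\sum_jf_j\|\le C(\sum_j\|f_j\|^p)^{1/p}$ for all finite families), $\mathcal B$ is super-democratic, the restricted truncation operators are uniformly bounded, and $w$ is a weight with $(s_m)\approx\varphi_u$. Then $d_{1,p}(w)$ and $d_{1,\infty}(w)$ are quasi-Banach symmetric spaces with equivalent fundamental functions, and $X$ is weakly sandwiched between them via $\mathcal B$; if moreover $\sup_m\varphi_u(m)=\infty$, then $d_{1,p}(w)\hookrightarrow X\hookrightarrow d_{1,\infty}(w)$ via $\mathcal B$. 5. Conversely, let $\mathcal B$ be semi-normalized. If $d_{1,p}(w)_0\hookrightarrow X\hookrightarrow d_{1,\infty}(w)$ via $\mathcal B$ (in particular, if $d_{1,p}(w)\hookrightarrow X\hookrightarrow d_{1,\infty}(w)$) for some $0<p<\infty$ and some weight $w$, then $\varphi_l\approx(s_m)\approx\varphi_u$. -/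

import Mathlib

open Filter Topology
open scoped ENNReal NNReal

namespace GreedyBases

/-! ### Quasi-Banach spaces -/

/-- A quasi-norm on a vector space over the real or complex field. -/
structure QuasiNorm (𝕜 X : Type*) [RCLike 𝕜] [AddCommGroup X] [Module 𝕜 X] where
  toFun : X → ℝ
  nonneg : ∀ f, 0 ≤ toFun f
  pos : ∀ f, f ≠ 0 → 0 < toFun f
  smul : ∀ (t : 𝕜) (f : X), toFun (t • f) = ‖t‖ * toFun f
  add_le : ∃ κ : ℝ, 1 ≤ κ ∧ ∀ f g, toFun (f + g) ≤ κ * (toFun f + toFun g)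

instance {𝕜 X : Type*} [RCLike 𝕜] [AddCommGroup X] [Module 𝕜 X] :
    CoeFun (QuasiNorm 𝕜 X) (fun _ => X → ℝ) := ⟨QuasiNorm.toFun⟩

variable {𝕜 X : Type*} [RCLike 𝕜] [AddCommGroup X] [Module 𝕜 X]

/-- Convergence of a sequence in the topology of the quasi-norm. -/
def QuasiNorm.ConvergesTo (q : QuasiNorm 𝕜 X) (u : ℕ → X) (f : X) : Prop :=
  Tendsto (fun k => q (u k - f)) atTop (𝓝 0)

/-- Completeness: with it, `(X, q)` is a quasi-Banach space. (The topology is metrizable and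
linear, so it is enough to consider sequences.) -/
def QuasiNorm.IsComplete (q : QuasiNorm 𝕜 X) : Prop :=
  ∀ u : ℕ → X, (∀ ε : ℝ, 0 < ε → ∃ K, ∀ i ≥ K, ∀ j ≥ K, q (u i - u j) < ε) →
    ∃ f, q.ConvergesTo u f

/-- `p`-convexity of a quasi-normed space. -/
def QuasiNorm.IsPConvex (q : QuasiNorm 𝕜 X) (p : ℝ) : Prop :=
  ∃ C : ℝ, ∀ (n : ℕ) (f : Fin n → X), q (∑ j, f j) ≤ C * (∑ j, q (f j) ^ p) ^ (1 / p)

/-! ### Bases -/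

/-- A complete Markushevich basis, with its (uniquely determined) coordinate functionals. -/
structure MarkushevichBasis (q : QuasiNorm 𝕜 X) where
  vec : ℕ → X
  coord : ℕ → X →ₗ[𝕜] 𝕜
  coord_bounded : ∀ n, ∃ C : ℝ, ∀ f, ‖coord n f‖ ≤ C * q f
  biorthogonal : ∀ n k, coord n (vec k) = if k = n then 1 else 0
  dense_span : ∀ f, ∀ ε : ℝ, 0 < ε → ∃ g ∈ Submodule.span 𝕜 (Set.range vec), q (f - g) < ε

namespace MarkushevichBasis

variable {q : QuasiNorm 𝕜 X} (B : MarkushevichBasis q)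

/-- `sup_n ‖x_n‖ ‖x_n^*‖ < ∞`. -/
def IsMBounded : Prop :=
  ∃ C : ℝ, ∀ n f, q (B.vec n) * ‖B.coord n f‖ ≤ C * q f

/-- `0 < inf_n ‖x_n‖ ≤ sup_n ‖x_n‖ < ∞`. -/
def IsSemiNormalized : Prop :=
  ∃ c C : ℝ, 0 < c ∧ ∀ n, c ≤ q (B.vec n) ∧ q (B.vec n) ≤ C

/-- The support of a vector with respect to the basis. -/
def support (f : X) : Set ℕ := {n | B.coord n f ≠ 0}

/-- The coordinate projection `S_A` onto a finite set `A`. -/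
def proj (A : Finset ℕ) (f : X) : X := ∑ n ∈ A, B.coord n f • B.vec n

/-- The vector `1_{ε,A} = ∑_{n ∈ A} ε_n x_n`. -/
def signedSum (ε : ℕ → 𝕜) (A : Finset ℕ) : X := ∑ n ∈ A, ε n • B.vec n

/-- Finite greedy sets of `f`. -/
def IsGreedySet (f : X) (A : Finset ℕ) : Prop :=
  ∀ n ∈ A, ∀ k ∉ A, ‖B.coord k f‖ ≤ ‖B.coord n f‖

/-- `A` is the `m`-th greedy set of `f`, where `m = |A|`: ties are broken in favour of the
smaller index. -/
def IsStandardGreedySet (f : X) (A : Finset ℕ) : Prop :=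
  ∀ n ∈ A, ∀ k ∉ A, ‖B.coord k f‖ < ‖B.coord n f‖ ∨ (‖B.coord n f‖ = ‖B.coord k f‖ ∧ n < k)

def IsQuasiGreedy : Prop :=
  ∃ C : ℝ, ∀ f A, B.IsGreedySet f A → q (B.proj A f) ≤ C * q f

def IsAlmostGreedy : Prop :=
  ∃ C : ℝ, 1 ≤ C ∧ ∀ (f : X) (A D : Finset ℕ), B.IsGreedySet f A → D.card ≤ A.card →
    q (f - B.proj A f) ≤ C * q (f - B.proj D f)

def IsGreedy : Prop :=
  ∃ C : ℝ, 1 ≤ C ∧ ∀ (f z : X) (A : Finset ℕ), B.IsGreedySet f A →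
    (B.support z).encard ≤ A.card → q (f - B.proj A f) ≤ C * q (f - z)

/-- Every vector has a unique expansion `f = ∑ a_n x_n` with unconditional convergence, i.e. such
that all rearrangements of the series converge to `f`. -/
def IsUnconditional : Prop :=
  ∀ f : X, ∃! a : ℕ → 𝕜, ∀ π : Equiv.Perm ℕ,
    q.ConvergesTo (fun N => ∑ n ∈ Finset.range N, a (π n) • B.vec (π n)) f

def IsSuperDemocratic : Prop :=
  ∃ C : ℝ, 1 ≤ C ∧ ∀ (A D : Finset ℕ) (ε δ : ℕ → 𝕜), A.card ≤ D.card →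
    (∀ n, ‖ε n‖ = 1) → (∀ n, ‖δ n‖ = 1) → q (B.signedSum ε A) ≤ C * q (B.signedSum δ D)

/-- The sign of a scalar, with `sgn 0 = 1`. -/
noncomputable def sgn (a : 𝕜) : 𝕜 :=
  open scoped Classical in if a = 0 then 1 else a / ((‖a‖ : ℝ) : 𝕜)

/-- `U(f, A) = min_{n ∈ A} |x_n^*(f)| ∑_{n ∈ A} sgn(x_n^*(f)) x_n`, and `U(f, ∅) = 0`. -/
noncomputable def truncation (f : X) (A : Finset ℕ) : X :=
  if h : A.Nonempty then
    ((A.inf' h (fun n => ‖B.coord n f‖) : ℝ) : 𝕜) • ∑ n ∈ A, sgn (B.coord n f) • B.vec n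
  else 0

/-- The restricted truncation operators `U_m(f) = U(f, A_m(f))`, where `A_m(f)` is the `m`-th
greedy set of `f`, are uniformly bounded. -/
def RestrictedTruncationBounded : Prop :=
  ∃ C : ℝ, ∀ f A, B.IsStandardGreedySet f A → q (B.truncation f A) ≤ C * q f

/-- The upper super-democracy function (fundamental function) of the basis. -/
noncomputable def upperFundamental (m : ℕ) : ℝ≥0∞ :=
  ⨆ (A : Finset ℕ) (_ : A.card ≤ m) (ε : ℕ → 𝕜) (_ : ∀ n, ‖ε n‖ = 1),
    ENNReal.ofReal (q (B.signedSum ε A))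

/-- The lower super-democracy function of the basis. -/
noncomputable def lowerFundamental (m : ℕ) : ℝ≥0∞ :=
  ⨅ (A : Finset ℕ) (_ : m ≤ A.card) (ε : ℕ → 𝕜) (_ : ∀ n, ‖ε n‖ = 1),
    ENNReal.ofReal (q (B.signedSum ε A))

/-- `sup_m φ_u^ε(m) = ∞`; for a semi-normalized `M`-bounded basis this fails only if the basis is
equivalent to the unit vector system of `c₀`. -/
def HasUnboundedFundamental : Prop := ⨆ m, B.upperFundamental m = ∞

end MarkushevichBasis

/-! ### Symmetric sequence spaces -/

/-- Gauges on `ℕ` which are symmetric. -/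
structure IsSymmetricGauge (S : (ℕ → 𝕜) → ℝ≥0∞) : Prop where
  pos : ∀ f, f ≠ 0 → 0 < S f
  smul : ∀ (t : 𝕜) (f : ℕ → 𝕜), S (t • f) = ENNReal.ofReal ‖t‖ * S f
  mono : ∀ f g : ℕ → 𝕜, (∀ n, ‖g n‖ ≤ ‖f n‖) → S g ≤ S f
  finite : ∀ A : Finset ℕ, S (Set.indicator (A : Set ℕ) 1) < ∞
  fatou : ∀ (a : ℕ → ℕ → ℝ) (b : ℕ → ℝ), (∀ k n, 0 ≤ a k n) →
    (∀ n, Monotone fun k => a k n) → (∀ n, Tendsto (fun k => a k n) atTop (𝓝 (b n))) →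
    Tendsto (fun k => S fun n => ((a k n : ℝ) : 𝕜)) atTop (𝓝 (S fun n => ((b n : ℝ) : 𝕜)))
  symm : ∀ (π : Equiv.Perm ℕ) (f : ℕ → 𝕜), S (f ∘ π) = S f

/-- The space `{f : ‖f‖_S < ∞}` of a gauge. -/
def gaugeSpace (S : (ℕ → 𝕜) → ℝ≥0∞) : Set (ℕ → 𝕜) := {f | S f < ∞}

/-- The closure `S₀` of the finitely supported sequences in the space of a gauge. -/
def gaugeSpaceZero (S : (ℕ → 𝕜) → ℝ≥0∞) : Set (ℕ → 𝕜) :=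
  {f | S f < ∞ ∧ ∀ ε : ℝ≥0∞, 0 < ε → ∃ g : ℕ → 𝕜, g.support.Finite ∧ S (f - g) < ε}

/-- The gauge satisfies the quasi-triangle law and its space is complete. -/
def IsQuasiBanachGauge (S : (ℕ → 𝕜) → ℝ≥0∞) : Prop :=
  (∃ κ : ℝ≥0, ∀ f g, S (f + g) ≤ κ * (S f + S g)) ∧
  ∀ u : ℕ → ℕ → 𝕜, (∀ k, u k ∈ gaugeSpace S) →
    (∀ ε : ℝ≥0∞, 0 < ε → ∃ K, ∀ i ≥ K, ∀ j ≥ K, S (u i - u j) < ε) →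
    ∃ f ∈ gaugeSpace S, Tendsto (fun k => S (u k - f)) atTop (𝓝 0)

/-- The fundamental function `m ↦ ‖e_1 + ⋯ + e_m‖_S`. -/
noncomputable def fundamentalFunction (S : (ℕ → 𝕜) → ℝ≥0∞) (m : ℕ) : ℝ≥0∞ :=
  S (Set.indicator (Finset.range m : Set ℕ) 1)

/-- Equivalence `α_m ≈ β_m` for `m = 1, 2, …`. -/
def SeqEquiv (α β : ℕ → ℝ≥0∞) : Prop :=
  ∃ C : ℝ≥0, ∀ m, 1 ≤ m → α m ≤ C * β m ∧ β m ≤ C * α m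

namespace MarkushevichBasis

variable {q : QuasiNorm 𝕜 X} (B : MarkushevichBasis q)

/-- For all `f` in the set `D` of sequences, the series `I(f) = ∑ f_n x_n` converges, and
`‖I(f)‖ ≤ C ‖f‖_S`. -/
def EmbedsOn (S : (ℕ → 𝕜) → ℝ≥0∞) (D : Set (ℕ → 𝕜)) : Prop :=
  ∃ C : ℝ, ∀ f ∈ D, ∃ y : X,
    q.ConvergesTo (fun N => ∑ n ∈ Finset.range N, f n • B.vec n) y ∧ q y ≤ C * (S f).toReal

/-- The space of the gauge `S` embeds in `X` via the basis. -/
def LowerEmbeds (S : (ℕ → 𝕜) → ℝ≥0∞) : Prop := B.EmbedsOn S (gaugeSpace S)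

/-- The closure of the finitely supported sequences in the space of the gauge `S` embeds in `X`
via the basis. -/
def LowerEmbedsZero (S : (ℕ → 𝕜) → ℝ≥0∞) : Prop := B.EmbedsOn S (gaugeSpaceZero S)

/-- `X` embeds in the space of the gauge `S` via the basis. -/
def UpperEmbeds (S : (ℕ → 𝕜) → ℝ≥0∞) : Prop :=
  ∃ C : ℝ≥0, ∀ f : X, S (fun n => B.coord n f) ≤ C * ENNReal.ofReal (q f)

/-- `X` is sandwiched, via the basis, between the symmetric spaces of `S₁` and `S₂`, whose
fundamental functions are equivalent. -/
def IsSandwichedBetween (S₁ S₂ : (ℕ → 𝕜) → ℝ≥0∞) : Prop :=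
  IsSymmetricGauge S₁ ∧ IsSymmetricGauge S₂ ∧
    SeqEquiv (fundamentalFunction S₁) (fundamentalFunction S₂) ∧
    B.LowerEmbeds S₁ ∧ B.UpperEmbeds S₂

/-- The same, with the lower space replaced by the closure in it of the finitely supported
sequences. -/
def IsSandwichedBetweenZero (S₁ S₂ : (ℕ → 𝕜) → ℝ≥0∞) : Prop :=
  IsSymmetricGauge S₁ ∧ IsSymmetricGauge S₂ ∧
    SeqEquiv (fundamentalFunction S₁) (fundamentalFunction S₂) ∧
    B.LowerEmbedsZero S₁ ∧ B.UpperEmbeds S₂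

/-- `X` can be sandwiched between symmetric spaces via the basis. -/
def IsSandwiched : Prop := ∃ S₁ S₂ : (ℕ → 𝕜) → ℝ≥0∞, B.IsSandwichedBetween S₁ S₂

/-- The variant of `IsSandwiched` with the closure of the finitely supported sequences as the lower
space. -/
def IsSandwichedZero : Prop := ∃ S₁ S₂ : (ℕ → 𝕜) → ℝ≥0∞, B.IsSandwichedBetweenZero S₁ S₂

end MarkushevichBasis

/-! ### Weighted Lorentz spaces -/

/-- The primitive weight `s_n = w_1 + ⋯ + w_n`; the entry `w_n` is `w (n - 1)` here. -/
def primitive (w : ℕ → ℝ) (n : ℕ) : ℝ := ∑ j ∈ Finset.range n, w j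

/-- The non-increasing rearrangement of `|f|`; the entry `f_n^*` is `rearrangement f (n - 1)`. -/
noncomputable def rearrangement (f : ℕ → 𝕜) (n : ℕ) : ℝ≥0∞ :=
  sInf {t : ℝ≥0∞ | {k | t < ENNReal.ofReal ‖f k‖}.encard ≤ n}

/-- The gauge of the weighted Lorentz space `d_{1,p}(w)`, `0 < p < ∞`. -/
noncomputable def lorentz (w : ℕ → ℝ) (p : ℝ) (f : ℕ → 𝕜) : ℝ≥0∞ :=
  (∑' n, rearrangement f n ^ p *
    ENNReal.ofReal (primitive w (n + 1) ^ (p - 1) * w n)) ^ (1 / p)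

/-- The gauge of the weighted Lorentz space `d_{1,∞}(w)`. -/
noncomputable def weakLorentz (w : ℕ → ℝ) (f : ℕ → 𝕜) : ℝ≥0∞ :=
  ⨆ n, rearrangement f n * ENNReal.ofReal (primitive w (n + 1))

end GreedyBases

open GreedyBases

/-! The theorem reduces to two equivalences: almost greedy means quasi-greedy and super-democratic,
and greedy means unconditional and super-democratic. A sandwich, even a weak one, bounds the norm of
a signed sum over `A` from both sides by a monotone function of `|A|` alone, so it forces
super-democracy (`IsSandwichedZero.isSuperDemocratic`). Testing on signed sums also gives the
converse statement about Lorentz spaces (`seqEquiv_fundamental_of_embeds`).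

The remaining work is to build the enclosing spaces. The upper fundamental function of a
super-democratic basis is equivalent to the primitive `s` of a positive weight `w`, and `s` is
doubling, so that `d_{1,p}(w)` and `d_{1,∞}(w)` are quasi-Banach with fundamental functions
equivalent to `s`. The embedding into `d_{1,∞}(w)` restates the truncation bound: the truncation of
`f` at its greedy set of size `m` has norm comparable to the `m`-th largest coefficient times `s_m`.
For the embedding of `d_{1,p}(w)`, a finite sum is split into dyadic blocks by the size of its
coefficients. A block at height `2^j` costs about `2^j` times `s` at the size of the block, and
interchanging the sums over heights and over indices leaves geometric sums dominated by the
rearrangement (`exists_sum_smul_le_lorentzSum`). The bound on finite sums extends by completeness to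
the closure of the finitely supported sequences. When `s` is unbounded this closure is all of
`d_{1,p}(w)`; the unboundedness of the fundamental function serves only for this.

Lack of local convexity is handled by Aoki–Rolewicz: the quasi-norm is replaced by a `p`-subadditive
functional `r`, and convex-hull arguments by a binary expansion of the coefficients
(`IsPNorm.sum_smul_le_of_subset_sums`). Truncation for quasi-greedy bases is bounded by splitting a
greedy set into geometric layers with ratio close to one and absorbing the error. Suppression
unconditionality comes from a Baire category argument in the metric of `r`. -/

namespace GreedyBases

/-! ### Quasi-norms, Aoki–Rolewicz, and equivalent `p`-norms -/

section PNorms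

variable {𝕜 X : Type*} [RCLike 𝕜] [AddCommGroup X] [Module 𝕜 X]

namespace QuasiNorm

variable (q : QuasiNorm 𝕜 X)

lemma map_zero : q 0 = 0 := by simpa using q.smul 0 0

lemma map_neg (f : X) : q (-f) = q f := by simpa using q.smul (-1) f

lemma map_sub_comm (f g : X) : q (f - g) = q (g - f) := by
  rw [← q.map_neg, neg_sub]

/-- The Aoki–Rolewicz theorem: every quasi-norm is `p`-convex for some `0 < p ≤ 1`. -/
theorem exists_isPConvex : ∃ p : ℝ, 0 < p ∧ p ≤ 1 ∧ q.IsPConvex p := by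
  obtain ⟨κ, hκ, hadd⟩ := q.add_le
  -- `K` bounds the quasi-norm of a sum of three vectors by their maximum. The exponent is chosen so
  -- that `K ^ p = 2`: the `p`-th power then satisfies the relaxed triangle law with constant two,
  -- under which the chain metric is at least half the original distance.
  set K : ℝ := κ + 2 * κ ^ 2 with hK
  have hK3 : 3 ≤ K := by nlinarith
  have hlogK : Real.log 2 ≤ Real.log K := Real.log_le_log (by norm_num) (by linarith)
  have hlog2 : 0 < Real.log 2 := Real.log_pos (by norm_num)
  set p : ℝ := Real.log 2 / Real.log K with hp
  have hp0 : 0 < p := div_pos hlog2 (by linarith)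
  have hp1 : p ≤ 1 := by rw [hp, div_le_one (by linarith)]; exact hlogK
  have hKp : K ^ p = 2 := by
    rw [Real.rpow_def_of_pos (by linarith), hp, mul_div_cancel₀ _ (by linarith),
      Real.exp_log (by norm_num)]
  refine ⟨p, hp0, hp1, ?_⟩
  set d : X → X → ℝ≥0 := fun x y => (q (x - y) ^ p).toNNReal with hd
  have hdc : ∀ x y, ((d x y : ℝ≥0) : ℝ) = q (x - y) ^ p := fun x y =>
    Real.coe_toNNReal _ (Real.rpow_nonneg (q.nonneg _) _)
  have hself : ∀ x, d x x = 0 := fun x => by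
    simp [hd, q.map_zero, Real.zero_rpow hp0.ne']
  have hcomm : ∀ x y, d x y = d y x := fun x y => by
    simp only [hd, q.map_sub_comm x y]
  have hthree : ∀ a b c : X, q (a + b + c) ^ p ≤ 2 * max (q a ^ p) (max (q b ^ p) (q c ^ p)) := by
    intro a b c
    set m := max (q a) (max (q b) (q c)) with hm
    have ha : q a ≤ m := le_max_left _ _
    have hb : q b ≤ m := (le_max_left _ _).trans (le_max_right _ _)
    have hc : q c ≤ m := (le_max_right _ _).trans (le_max_right _ _)
    have hm0 : 0 ≤ m := (q.nonneg a).trans ha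
    have h1 : q (a + b + c) ≤ K * m := by
      have h2 := hadd a (b + c)
      have h3 := hadd b c
      rw [add_assoc]
      have h4 : q (b + c) ≤ 2 * κ * m := h3.trans (by nlinarith)
      calc q (a + (b + c)) ≤ κ * (m + 2 * κ * m) := h2.trans (by gcongr)
        _ = K * m := by rw [hK]; ring
    have h5 : m ^ p ≤ max (q a ^ p) (max (q b ^ p) (q c ^ p)) := by
      rcases max_choice (q a) (max (q b) (q c)) with h | h
      · rw [hm, h]; exact le_max_left _ _
      · rcases max_choice (q b) (q c) with h' | h'
        · rw [hm, h, h']; exact (le_max_left _ _).trans (le_max_right _ _)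
        · rw [hm, h, h']; exact (le_max_right _ _).trans (le_max_right _ _)
    calc q (a + b + c) ^ p ≤ (K * m) ^ p := Real.rpow_le_rpow (q.nonneg _) h1 hp0.le
      _ = 2 * m ^ p := by rw [Real.mul_rpow (by linarith) hm0, hKp]
      _ ≤ _ := by gcongr
  have hfour : ∀ x₁ x₂ x₃ x₄, d x₁ x₄ ≤ 2 * max (d x₁ x₂) (max (d x₂ x₃) (d x₃ x₄)) := by
    intro x₁ x₂ x₃ x₄
    have h := hthree (x₁ - x₂) (x₂ - x₃) (x₃ - x₄)
    rw [show x₁ - x₂ + (x₂ - x₃) + (x₃ - x₄) = x₁ - x₄ by abel] at h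
    rw [← NNReal.coe_le_coe]
    push_cast
    simpa only [hdc] using h
  let _ := PseudoMetricSpace.ofPreNNDist d hself hcomm
  refine ⟨2 ^ (1 / p), fun n f => ?_⟩
  set g : ℕ → X := fun i => if h : i < n then f ⟨i, h⟩ else 0 with hg
  have hsum : ∑ j, f j = ∑ i ∈ Finset.range n, g i := by
    rw [Finset.sum_range]
    exact Finset.sum_congr rfl fun i _ => by simp [hg]
  have hsum' : ∑ j, q (f j) ^ p = ∑ i ∈ Finset.range n, q (g i) ^ p := by
    rw [Finset.sum_range]
    exact Finset.sum_congr rfl fun i _ => by simp [hg]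
  -- The chain of partial sums joins `0` to the total sum, and its links have length at most `q (f
  -- j) ^ p`.
  have key : q (∑ j, f j) ^ p ≤ 2 * ∑ j, q (f j) ^ p := by
    have h1 := PseudoMetricSpace.le_two_mul_dist_ofPreNNDist d hself hcomm hfour
      (∑ i ∈ Finset.range n, g i) (∑ i ∈ Finset.range 0, g i)
    have h2 := dist_le_range_sum_dist (fun k => ∑ i ∈ Finset.range k, g i) n
    have h3 : ∀ k, dist (∑ i ∈ Finset.range k, g i) (∑ i ∈ Finset.range (k + 1), g i) ≤
        q (g k) ^ p := by
      intro k
      refine (PseudoMetricSpace.dist_ofPreNNDist_le d hself hcomm _ _).trans ?_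
      rw [hdc, Finset.sum_range_succ, sub_add_cancel_left, q.map_neg]
    rw [dist_comm] at h2
    calc q (∑ j, f j) ^ p = d (∑ i ∈ Finset.range n, g i) (∑ i ∈ Finset.range 0, g i) := by
          simp [hdc, hsum]
      _ ≤ _ := h1
      _ ≤ 2 * ∑ i ∈ Finset.range n, q (g i) ^ p := by
          gcongr
          exact h2.trans (Finset.sum_le_sum fun i _ => h3 i)
      _ = _ := by rw [hsum']
  have h0 : 0 ≤ ∑ j, q (f j) ^ p := Finset.sum_nonneg fun i _ => Real.rpow_nonneg (q.nonneg _) _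
  calc q (∑ j, f j) = (q (∑ j, f j) ^ p) ^ (1 / p) := by
        rw [← Real.rpow_mul (q.nonneg _), mul_one_div_cancel hp0.ne', Real.rpow_one]
    _ ≤ (2 * ∑ j, q (f j) ^ p) ^ (1 / p) :=
        Real.rpow_le_rpow (Real.rpow_nonneg (q.nonneg _) _) key (by positivity)
    _ = _ := Real.mul_rpow (by norm_num) h0

end QuasiNorm

/-- `r` is the `p`-th power of a `p`-norm equivalent to the quasi-norm `q`. -/
structure IsPNorm (q : QuasiNorm 𝕜 X) (p : ℝ) (r : X → ℝ) : Prop where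
  p_pos : 0 < p
  add_le : ∀ f g, r (f + g) ≤ r f + r g
  smul : ∀ (t : 𝕜) f, r (t • f) = ‖t‖ ^ p * r f
  le_rpow : ∀ f, r f ≤ q f ^ p
  rpow_le : ∃ K : ℝ, 0 < K ∧ ∀ f, q f ^ p ≤ K * r f

/-- Take the infimum of `∑ q(f_i)^p` over all finite decompositions `f = ∑ f_i`. Concatenating
decompositions gives subadditivity, rescaling them gives `p`-homogeneity, and `p`-convexity prevents
the infimum from collapsing. -/
theorem QuasiNorm.IsPConvex.exists_isPNorm {q : QuasiNorm 𝕜 X} {p : ℝ} (hp : 0 < p)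
    (h : q.IsPConvex p) : ∃ r : X → ℝ, IsPNorm q p r := by
  obtain ⟨C, hC⟩ := h
  set S : X → Set ℝ := fun f => {x | ∃ l : List X, l.sum = f ∧ (l.map (q · ^ p)).sum = x} with hS
  have hq0 : ∀ f, 0 ≤ q f ^ p := fun f => Real.rpow_nonneg (q.nonneg _) _
  have hmem : ∀ f, q f ^ p ∈ S f := fun f => ⟨[f], by simp, by simp⟩
  have hpos : ∀ f, ∀ x ∈ S f, 0 ≤ x := by
    rintro f x ⟨l, -, rfl⟩
    exact List.sum_nonneg (by simpa using fun a _ => hq0 a)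
  have hbdd : ∀ f, BddBelow (S f) := fun f => ⟨0, hpos f⟩
  have hsmul_le : ∀ (t : 𝕜) f, sInf (S (t • f)) ≤ ‖t‖ ^ p * sInf (S f) := by
    intro t f
    have hle : ∀ x ∈ S f, sInf (S (t • f)) ≤ ‖t‖ ^ p * x := by
      rintro x ⟨l, hl, rfl⟩
      refine csInf_le (hbdd _) ⟨l.map (t • ·), ?_, ?_⟩
      · rw [← hl, List.smul_sum]
      · rw [List.map_map, ← List.sum_map_mul_left]
        congr 1
        refine List.map_congr_left fun a _ => ?_
        simp [q.smul, Real.mul_rpow (norm_nonneg t) (q.nonneg a)]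
    rcases eq_or_ne t 0 with rfl | ht
    · have := hle _ (hmem f)
      simpa [Real.zero_rpow hp.ne'] using this
    · have htp : 0 < ‖t‖ ^ p := Real.rpow_pos_of_pos (norm_pos_iff.2 ht) p
      rw [← div_le_iff₀' htp]
      exact le_csInf ⟨_, hmem f⟩ fun x hx => by rw [div_le_iff₀' htp]; exact hle x hx
  refine ⟨fun f => sInf (S f), hp, fun f g => ?_, fun t f => ?_,
    fun f => csInf_le (hbdd f) (hmem f), ?_⟩
  · have h1 : ∀ x ∈ S f, ∀ y ∈ S g, sInf (S (f + g)) ≤ x + y := by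
      rintro x ⟨l, hl, rfl⟩ y ⟨l', hl', rfl⟩
      exact csInf_le (hbdd _) ⟨l ++ l', by simp [hl, hl'], by simp⟩
    have h2 : ∀ x ∈ S f, sInf (S (f + g)) - x ≤ sInf (S g) := fun x hx =>
      le_csInf ⟨_, hmem g⟩ fun y hy => by linarith [h1 x hx y hy]
    have h3 : sInf (S (f + g)) - sInf (S g) ≤ sInf (S f) :=
      le_csInf ⟨_, hmem f⟩ fun x hx => by linarith [h2 x hx]
    linarith
  · refine le_antisymm (hsmul_le t f) ?_
    rcases eq_or_ne t 0 with rfl | ht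
    · simp only [norm_zero, Real.zero_rpow hp.ne', zero_mul]
      exact le_csInf ⟨_, hmem _⟩ (hpos _)
    · have h1 := hsmul_le t⁻¹ (t • f)
      rw [inv_smul_smul₀ ht, norm_inv, Real.inv_rpow (norm_nonneg _)] at h1
      have htp : 0 < ‖t‖ ^ p := Real.rpow_pos_of_pos (norm_pos_iff.2 ht) p
      rwa [inv_mul_eq_div, le_div_iff₀' htp] at h1
  · refine ⟨max C 1 ^ p, by positivity, fun f => ?_⟩
    have hCp : 0 < max C 1 ^ p := by positivity
    rw [← div_le_iff₀' hCp]
    refine le_csInf ⟨_, hmem f⟩ ?_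
    rintro x ⟨l, hl, rfl⟩
    rw [div_le_iff₀' hCp]
    have h1 := hC l.length (fun i => l.get i)
    have h2 : ∑ j : Fin l.length, l.get j = f := by rw [← hl, ← List.sum_ofFn, List.ofFn_get]
    have h3 : ∑ j : Fin l.length, q (l.get j) ^ p = (l.map (q · ^ p)).sum := by
      rw [← List.sum_ofFn, ← Fin.sum_univ_fun_getElem, List.sum_ofFn]; simp
    rw [h2, h3] at h1
    have h0 : 0 ≤ (l.map (q · ^ p)).sum := List.sum_nonneg (by simpa using fun a _ => hq0 a)
    calc q f ^ p ≤ (max C 1 * ((l.map (q · ^ p)).sum) ^ (1 / p)) ^ p := by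
          refine Real.rpow_le_rpow (q.nonneg _) (h1.trans ?_) hp.le
          gcongr
          exact le_max_left _ _
      _ = _ := by
          rw [Real.mul_rpow (by positivity) (by positivity), ← Real.rpow_mul h0,
            one_div_mul_cancel hp.ne', Real.rpow_one]

theorem QuasiNorm.exists_isPNorm (q : QuasiNorm 𝕜 X) : ∃ (p : ℝ) (r : X → ℝ), IsPNorm q p r := by
  obtain ⟨p, hp, -, h⟩ := q.exists_isPConvex
  exact ⟨p, h.exists_isPNorm hp⟩

namespace IsPNorm

variable {q : QuasiNorm 𝕜 X} {p : ℝ} {r : X → ℝ} (hr : IsPNorm q p r)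

include hr

lemma nonneg (f : X) : 0 ≤ r f := by
  obtain ⟨K, hK, h⟩ := hr.rpow_le
  exact (mul_nonneg_iff_of_pos_left hK).1 ((Real.rpow_nonneg (q.nonneg f) p).trans (h f))

lemma map_zero : r 0 = 0 := by
  simpa [Real.zero_rpow hr.p_pos.ne'] using hr.smul 0 0

lemma map_neg (f : X) : r (-f) = r f := by simpa using hr.smul (-1) f

lemma sub_le (f g : X) : r (f - g) ≤ r f + r g := by
  simpa [sub_eq_add_neg, hr.map_neg] using hr.add_le f (-g)

lemma le_add_sub (f g : X) : r f ≤ r g + r (f - g) := by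
  simpa using hr.add_le g (f - g)

lemma sum_le {ι : Type*} (s : Finset ι) (f : ι → X) : r (∑ i ∈ s, f i) ≤ ∑ i ∈ s, r (f i) := by
  classical
  induction s using Finset.induction_on with
  | empty => simp [hr.map_zero]
  | insert a s ha ih =>
    rw [Finset.sum_insert ha, Finset.sum_insert ha]
    exact (hr.add_le _ _).trans (by gcongr)

lemma smul_real {t : ℝ} (ht : 0 ≤ t) (f : X) : r ((t : 𝕜) • f) = t ^ p * r f := by
  simp [hr.smul, abs_of_nonneg ht]

/-- Estimates for the quasi-norm give estimates for the `p`-norm. -/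
lemma exists_le_of_le (C : ℝ) : ∃ C' : ℝ, 0 ≤ C' ∧ ∀ f g, q f ≤ C * q g → r f ≤ C' * r g := by
  obtain ⟨K, hK, h⟩ := hr.rpow_le
  refine ⟨|C| ^ p * K, by positivity, fun f g hfg => ?_⟩
  calc r f ≤ q f ^ p := hr.le_rpow f
    _ ≤ (|C| * q g) ^ p := by
        refine Real.rpow_le_rpow (q.nonneg _) (hfg.trans ?_) hr.p_pos.le
        exact mul_le_mul_of_nonneg_right (le_abs_self C) (q.nonneg _)
    _ = |C| ^ p * q g ^ p := Real.mul_rpow (abs_nonneg C) (q.nonneg _)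
    _ ≤ |C| ^ p * (K * r g) := by gcongr; exact h g
    _ = _ := by ring

/-- Estimates for the `p`-norm give estimates for the quasi-norm. -/
lemma exists_le_of_le' (C : ℝ) : ∃ C' : ℝ, 1 ≤ C' ∧ ∀ f g, r f ≤ C * r g → q f ≤ C' * q g := by
  obtain ⟨K, hK, h⟩ := hr.rpow_le
  have hp := hr.p_pos
  refine ⟨max 1 ((K * |C|) ^ (1 / p)), le_max_left _ _, fun f g hfg => ?_⟩
  have h1 : q f ^ p ≤ (K * |C|) * q g ^ p :=
    calc q f ^ p ≤ K * r f := h f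
      _ ≤ K * (|C| * q g ^ p) := by
          gcongr
          refine hfg.trans ?_
          calc C * r g ≤ |C| * r g := mul_le_mul_of_nonneg_right (le_abs_self C) (hr.nonneg g)
            _ ≤ _ := by gcongr; exact hr.le_rpow g
      _ = _ := by ring
  have hg0 := q.nonneg g
  calc q f = (q f ^ p) ^ (1 / p) := by
        rw [← Real.rpow_mul (q.nonneg _), mul_one_div_cancel hp.ne', Real.rpow_one]
    _ ≤ ((K * |C|) * q g ^ p) ^ (1 / p) :=
        Real.rpow_le_rpow (Real.rpow_nonneg (q.nonneg _) _) h1 (by positivity)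
    _ = (K * |C|) ^ (1 / p) * q g := by
        rw [Real.mul_rpow (by positivity) (by positivity), ← Real.rpow_mul hg0,
          mul_one_div_cancel hp.ne', Real.rpow_one]
    _ ≤ _ := by gcongr; exact le_max_right _ _

lemma exists_lt_of_lt {ε : ℝ} (hε : 0 < ε) : ∃ δ : ℝ, 0 < δ ∧ ∀ f, q f < δ → r f < ε := by
  have hp := hr.p_pos
  refine ⟨ε ^ (1 / p), by positivity, fun f hf => (hr.le_rpow f).trans_lt ?_⟩
  calc q f ^ p < (ε ^ (1 / p)) ^ p := Real.rpow_lt_rpow (q.nonneg f) hf hp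
    _ = ε := by rw [← Real.rpow_mul hε.le, one_div_mul_cancel hp.ne', Real.rpow_one]

lemma exists_lt_of_lt' {ε : ℝ} (hε : 0 < ε) : ∃ δ : ℝ, 0 < δ ∧ ∀ f, r f < δ → q f < ε := by
  obtain ⟨K, hK, h⟩ := hr.rpow_le
  have hp := hr.p_pos
  refine ⟨ε ^ p / K, by positivity, fun f hf => ?_⟩
  rw [lt_div_iff₀' hK] at hf
  exact (Real.rpow_lt_rpow_iff (q.nonneg f) hε.le hp).1 ((h f).trans_lt hf)

lemma convergesTo_iff {u : ℕ → X} {f : X} :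
    q.ConvergesTo u f ↔ Tendsto (fun k => r (u k - f)) atTop (𝓝 0) := by
  simp only [QuasiNorm.ConvergesTo, Metric.tendsto_atTop, Real.dist_eq, sub_zero,
    abs_of_nonneg (q.nonneg _), abs_of_nonneg (hr.nonneg _)]
  constructor
  · intro h ε hε
    obtain ⟨δ, hδ, h'⟩ := hr.exists_lt_of_lt hε
    obtain ⟨N, hN⟩ := h δ hδ
    exact ⟨N, fun n hn => h' _ (hN n hn)⟩
  · intro h ε hε
    obtain ⟨δ, hδ, h'⟩ := hr.exists_lt_of_lt' hε
    obtain ⟨N, hN⟩ := h δ hδ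
    exact ⟨N, fun n hn => h' _ (hN n hn)⟩

lemma exists_convergesTo (hq : q.IsComplete) {u : ℕ → X}
    (hu : ∀ ε : ℝ, 0 < ε → ∃ K, ∀ i ≥ K, ∀ j ≥ K, r (u i - u j) < ε) :
    ∃ f, q.ConvergesTo u f := by
  refine hq u fun ε hε => ?_
  obtain ⟨δ, hδ, h'⟩ := hr.exists_lt_of_lt' hε
  obtain ⟨K, hK⟩ := hu δ hδ
  exact ⟨K, fun i hi j hj => h' _ (hK i hi j hj)⟩

/-- If all the subset sums of a finite family are bounded, so are its combinations with
coefficients in `[0, 1]`. -/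
lemma sum_smul_le_of_subset_sums (E : Finset ℕ) (v : ℕ → X) {M : ℝ}
    (hM : ∀ A ⊆ E, r (∑ n ∈ A, v n) ≤ M) (t : ℕ → ℝ) (ht : ∀ n ∈ E, 0 ≤ t n ∧ t n ≤ 1) :
    r (∑ n ∈ E, ((t n : ℝ) : 𝕜) • v n) ≤ M / (2 ^ p - 1) := by
  have hp := hr.p_pos
  have h2p : (1 : ℝ) < 2 ^ p := Real.one_lt_rpow (by norm_num) hp
  set T : Set ℝ := {x | ∃ t : ℕ → ℝ, (∀ n ∈ E, 0 ≤ t n ∧ t n ≤ 1) ∧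
    r (∑ n ∈ E, ((t n : ℝ) : 𝕜) • v n) = x} with hT
  have hTbdd : BddAbove T := by
    refine ⟨∑ n ∈ E, r (v n), ?_⟩
    rintro x ⟨t, ht, rfl⟩
    refine (hr.sum_le _ _).trans (Finset.sum_le_sum fun n hn => ?_)
    rw [hr.smul_real (ht n hn).1]
    exact mul_le_of_le_one_left (hr.nonneg _) (Real.rpow_le_one (ht n hn).1 (ht n hn).2 hp.le)
  have hmem : r (∑ n ∈ E, ((t n : ℝ) : 𝕜) • v n) ∈ T := ⟨t, ht, rfl⟩
  -- Peel off one binary digit: `2 t` is the indicator of `t ≥ 1/2` plus another coefficient vector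
  -- in `[0, 1]`. As the supremum is finite, the resulting inequality can be solved for it, giving
  -- `M / (2 ^ p - 1)`.
  have hstep : ∀ x ∈ T, 2 ^ p * x ≤ M + sSup T := by
    rintro x ⟨t, ht, rfl⟩
    set t' : ℕ → ℝ := fun n => 2 * t n - if 1 / 2 ≤ t n then 1 else 0 with ht'
    have h1 : ((2 : ℝ) : 𝕜) • ∑ n ∈ E, ((t n : ℝ) : 𝕜) • v n =
        ∑ n ∈ E.filter (fun n => 1 / 2 ≤ t n), v n + ∑ n ∈ E, ((t' n : ℝ) : 𝕜) • v n := by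
      rw [Finset.sum_filter, ← Finset.sum_add_distrib, Finset.smul_sum]
      refine Finset.sum_congr rfl fun n _ => ?_
      rw [smul_smul]
      by_cases h : 1 / 2 ≤ t n
      · simp only [ht', h, if_true]
        push_cast
        rw [sub_smul]; simp
      · simp only [ht', h, if_false]
        push_cast
        simp
    rw [← hr.smul_real (by norm_num : (0 : ℝ) ≤ 2), h1]
    refine (hr.add_le _ _).trans (add_le_add (hM _ (Finset.filter_subset _ _)) ?_)
    refine le_csSup hTbdd ⟨t', fun n hn => ?_, rfl⟩
    have := ht n hn
    simp only [ht']
    split_ifs with h <;> constructor <;> linarith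
  have hsup : sSup T ≤ (M + sSup T) / 2 ^ p :=
    csSup_le ⟨_, hmem⟩ fun x hx => by
      rw [le_div_iff₀' (by positivity)]; exact hstep x hx
  rw [le_div_iff₀' (by positivity)] at hsup
  refine (le_csSup hTbdd hmem).trans ?_
  rw [le_div_iff₀' (by linarith)]
  linarith

end IsPNorm

end PNorms

/-! ### Non-increasing rearrangements -/

section Rearrangement

variable {𝕜 : Type*} [RCLike 𝕜]

lemma rearrangement_le_of_encard_le {f : ℕ → 𝕜} {n : ℕ} {t : ℝ≥0∞}
    (h : {k | t < ENNReal.ofReal ‖f k‖}.encard ≤ n) : rearrangement f n ≤ t :=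
  sInf_le (Set.mem_ofPred.2 h)

/-- Reduces comparisons of rearrangements to finite witness sets; the set has `n + 1` points because
the index starts at zero. Conversely, any admissible level is at least the minimum over the witness
set, which is strictly above `t` by finiteness. -/
lemma lt_rearrangement_iff {f : ℕ → 𝕜} {n : ℕ} {t : ℝ≥0∞} :
    t < rearrangement f n ↔
      ∃ A : Finset ℕ, A.card = n + 1 ∧ ∀ k ∈ A, t < ENNReal.ofReal ‖f k‖ := by
  constructor
  · intro h
    have h1 : ¬ {k | t < ENNReal.ofReal ‖f k‖}.encard ≤ n := fun h' =>
      (rearrangement_le_of_encard_le h').not_gt h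
    have h2 : ((n + 1 : ℕ) : ℕ∞) ≤ {k | t < ENNReal.ofReal ‖f k‖}.encard := by
      push_cast
      exact Order.add_one_le_of_lt (not_le.1 h1)
    obtain ⟨s, hs, hcard⟩ := Set.exists_subset_encard_eq h2
    have hfin : s.Finite := Set.finite_of_encard_eq_coe hcard
    refine ⟨hfin.toFinset, ?_, fun k hk => hs (hfin.mem_toFinset.1 hk)⟩
    rw [hfin.encard_eq_coe_toFinset_card] at hcard
    exact_mod_cast hcard
  · rintro ⟨A, hA, h⟩
    have hne : A.Nonempty := Finset.card_pos.1 (by omega)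
    have hlt : t < A.inf' hne (fun k => ENNReal.ofReal ‖f k‖) := (Finset.lt_inf'_iff _).2 h
    refine hlt.trans_le (le_sInf fun t' ht' => ?_)
    by_contra hcon
    have h1 : (A : Set ℕ) ⊆ {k | t' < ENNReal.ofReal ‖f k‖} := fun k hk =>
      (not_le.1 hcon).trans_le (Finset.inf'_le _ hk)
    have h2 := (Set.encard_le_encard h1).trans ht'
    rw [Set.encard_coe_eq_coe_finsetCard, hA] at h2
    have : n + 1 ≤ n := by exact_mod_cast h2
    omega

/-- The infimum defining the rearrangement is attained; otherwise `n + 1` witnesses would put the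
value strictly above itself. -/
lemma encard_rearrangement_lt_le (f : ℕ → 𝕜) (n : ℕ) :
    {k | rearrangement f n < ENNReal.ofReal ‖f k‖}.encard ≤ n := by
  by_contra hcon
  have h2 : ((n + 1 : ℕ) : ℕ∞) ≤ {k | rearrangement f n < ENNReal.ofReal ‖f k‖}.encard := by
    push_cast
    exact Order.add_one_le_of_lt (not_le.1 hcon)
  obtain ⟨s, hs, hcard⟩ := Set.exists_subset_encard_eq h2
  have hfin : s.Finite := Set.finite_of_encard_eq_coe hcard
  rw [hfin.encard_eq_coe_toFinset_card] at hcard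
  exact (lt_irrefl _) (lt_rearrangement_iff.2 ⟨hfin.toFinset, by exact_mod_cast hcard,
    fun k hk => hs (hfin.mem_toFinset.1 hk)⟩)

lemma rearrangement_mono {f g : ℕ → 𝕜} (h : ∀ k, ‖g k‖ ≤ ‖f k‖) (n : ℕ) :
    rearrangement g n ≤ rearrangement f n := by
  refine le_of_forall_lt fun t ht => ?_
  obtain ⟨A, hA, hAt⟩ := lt_rearrangement_iff.1 ht
  exact lt_rearrangement_iff.2
    ⟨A, hA, fun k hk => (hAt k hk).trans_le (ENNReal.ofReal_le_ofReal (h k))⟩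

lemma rearrangement_antitone (f : ℕ → 𝕜) : Antitone (rearrangement f) := by
  intro m n hmn
  exact rearrangement_le_of_encard_le
    ((encard_rearrangement_lt_le f m).trans (by exact_mod_cast hmn))

lemma rearrangement_smul (t : 𝕜) (f : ℕ → 𝕜) (n : ℕ) :
    rearrangement (t • f) n = ENNReal.ofReal ‖t‖ * rearrangement f n := by
  have key : ∀ (t : 𝕜) (f : ℕ → 𝕜),
      rearrangement (t • f) n ≤ ENNReal.ofReal ‖t‖ * rearrangement f n := by
    intro t f
    refine rearrangement_le_of_encard_le (le_trans (Set.encard_le_encard fun k hk => ?_) (encard_rearrangement_lt_le f n))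
    simp only [Set.mem_ofPred_eq, Pi.smul_apply, smul_eq_mul, norm_mul,
      ENNReal.ofReal_mul (norm_nonneg t)] at hk ⊢
    exact lt_of_mul_lt_mul_left' hk
  refine le_antisymm (key t f) ?_
  rcases eq_or_ne t 0 with rfl | ht
  · simp
  · have h := key t⁻¹ (t • f)
    rw [inv_smul_smul₀ ht] at h
    calc ENNReal.ofReal ‖t‖ * rearrangement f n
        ≤ ENNReal.ofReal ‖t‖ * (ENNReal.ofReal ‖t⁻¹‖ * rearrangement (t • f) n) := by gcongr
      _ = rearrangement (t • f) n := by
          rw [← mul_assoc, ← ENNReal.ofReal_mul (norm_nonneg t), ← norm_mul, mul_inv_cancel₀ ht]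
          simp

/-- Where the sum exceeds the sum of the two levels, one of the summands exceeds its own level, so
the sizes of the exceptional sets add. -/
lemma rearrangement_add_le (f g : ℕ → 𝕜) (m n : ℕ) :
    rearrangement (f + g) (m + n) ≤ rearrangement f m + rearrangement g n := by
  refine rearrangement_le_of_encard_le ?_
  have hsub : {k | rearrangement f m + rearrangement g n < ENNReal.ofReal ‖(f + g) k‖} ⊆
      {k | rearrangement f m < ENNReal.ofReal ‖f k‖} ∪
        {k | rearrangement g n < ENNReal.ofReal ‖g k‖} := by
    intro k hk
    by_contra hcon
    simp only [Set.mem_union, Set.mem_ofPred_eq, not_or, not_lt] at hcon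
    refine (lt_irrefl _) (lt_of_lt_of_le (Set.mem_ofPred.1 hk) ?_)
    calc ENNReal.ofReal ‖(f + g) k‖ ≤ ENNReal.ofReal (‖f k‖ + ‖g k‖) :=
          ENNReal.ofReal_le_ofReal (norm_add_le _ _)
      _ ≤ ENNReal.ofReal ‖f k‖ + ENNReal.ofReal ‖g k‖ := ENNReal.ofReal_add_le
      _ ≤ _ := add_le_add hcon.1 hcon.2
  refine (Set.encard_le_encard hsub).trans ((Set.encard_union_le _ _).trans ?_)
  push_cast
  exact add_le_add (encard_rearrangement_lt_le f m) (encard_rearrangement_lt_le g n)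

lemma rearrangement_add_le_half (f g : ℕ → 𝕜) (n : ℕ) :
    rearrangement (f + g) n ≤ rearrangement f (n / 2) + rearrangement g (n / 2) :=
  (rearrangement_antitone _ (by omega : n / 2 + n / 2 ≤ n)).trans (rearrangement_add_le f g _ _)

lemma rearrangement_comp_perm (π : Equiv.Perm ℕ) (f : ℕ → 𝕜) :
    rearrangement (f ∘ π) = rearrangement f := by
  ext n
  unfold rearrangement
  congr 1
  ext t
  have : {k | t < ENNReal.ofReal ‖(f ∘ π) k‖} = π ⁻¹' {k | t < ENNReal.ofReal ‖f k‖} := rfl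
  rw [Set.mem_ofPred_eq, Set.mem_ofPred_eq, this,
    Set.encard_preimage_of_bijective π.bijective]

lemma rearrangement_zero_pos {f : ℕ → 𝕜} (hf : f ≠ 0) : 0 < rearrangement f 0 := by
  obtain ⟨k, hk⟩ := Function.ne_iff.1 hf
  exact lt_rearrangement_iff.2 ⟨{k}, by simp, by simpa using hk⟩

lemma rearrangement_indicator (A : Finset ℕ) (n : ℕ) :
    rearrangement (Set.indicator (A : Set ℕ) (1 : ℕ → 𝕜)) n = if n < A.card then 1 else 0 := by
  refine eq_of_forall_lt_iff fun t => ?_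
  rw [lt_rearrangement_iff]
  constructor
  · rintro ⟨A', hA', h⟩
    have hmem : ∀ k ∈ A', k ∈ A ∧ t < 1 := by
      intro k hk
      have := h k hk
      by_cases hkA : k ∈ A
      · simpa [hkA] using this
      · simp [hkA] at this
    have hle : A'.card ≤ A.card := Finset.card_le_card fun k hk => (hmem k hk).1
    obtain ⟨k, hk⟩ : A'.Nonempty := Finset.card_pos.1 (by omega)
    rw [if_pos (by omega)]
    exact (hmem k hk).2
  · intro h
    split_ifs at h with hn
    · obtain ⟨A', hA', hcard⟩ := Finset.exists_subset_card_eq (show n + 1 ≤ A.card from hn)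
      exact ⟨A', hcard, fun k hk => by simpa [hA' hk] using h⟩
    · exact absurd h not_lt_zero

/-- A finite witness set for the limit eventually witnesses the same level for the approximants; the
other inequality is monotonicity. This underlies the Fatou property of both Lorentz gauges. -/
lemma tendsto_rearrangement {a : ℕ → ℕ → ℝ} {b : ℕ → ℝ} (h0 : ∀ k n, 0 ≤ a k n)
    (hmono : ∀ n, Monotone fun k => a k n)
    (hlim : ∀ n, Tendsto (fun k => a k n) atTop (𝓝 (b n))) (n : ℕ) :
    Tendsto (fun k => rearrangement (fun i => ((a k i : ℝ) : 𝕜)) n) atTop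
      (𝓝 (rearrangement (fun i => ((b i : ℝ) : 𝕜)) n)) := by
  have hle : ∀ k i, a k i ≤ b i := fun k i => (hmono i).ge_of_tendsto (hlim i) k
  rw [tendsto_order]
  refine ⟨fun t ht => ?_, fun t ht => Eventually.of_forall fun k => lt_of_le_of_lt ?_ ht⟩
  · obtain ⟨A, hA, hAt⟩ := lt_rearrangement_iff.1 ht
    have hev : ∀ i ∈ A, ∀ᶠ k in atTop, t < ENNReal.ofReal ‖((a k i : ℝ) : 𝕜)‖ := by
      intro i hi
      have h1 : Tendsto (fun k => ENNReal.ofReal ‖((a k i : ℝ) : 𝕜)‖) atTop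
          (𝓝 (ENNReal.ofReal ‖((b i : ℝ) : 𝕜)‖)) := by
        simp only [RCLike.norm_ofReal]
        exact ENNReal.tendsto_ofReal (hlim i).abs
      exact h1.eventually_const_lt (hAt i hi)
    filter_upwards [(Finset.eventually_all A).2 hev] with k hk
    exact lt_rearrangement_iff.2 ⟨A, hA, hk⟩
  · refine rearrangement_mono (fun i => ?_) n
    simp only [RCLike.norm_ofReal]
    rw [abs_of_nonneg (h0 k i), abs_of_nonneg ((h0 k i).trans (hle k i))]
    exact hle k i

lemma rearrangement_monotone_of_monotone {a : ℕ → ℕ → ℝ} (h0 : ∀ k n, 0 ≤ a k n)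
    (hmono : ∀ n, Monotone fun k => a k n) (n : ℕ) :
    Monotone fun k => rearrangement (fun i => ((a k i : ℝ) : 𝕜)) n := by
  intro k l hkl
  refine rearrangement_mono (fun i => ?_) n
  simp only [RCLike.norm_ofReal]
  rw [abs_of_nonneg (h0 k i), abs_of_nonneg (h0 l i)]
  exact hmono i hkl

end Rearrangement

/-! ### Symmetric gauges: indicators, coordinates, completeness -/

section Gauges

variable {𝕜 : Type*} [RCLike 𝕜]

namespace IsSymmetricGauge

variable {S : (ℕ → 𝕜) → ℝ≥0∞} (hS : IsSymmetricGauge S)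

include hS

lemma map_zero : S 0 = 0 := by simpa using hS.smul 0 0

lemma congr_norm {f g : ℕ → 𝕜} (h : ∀ n, ‖f n‖ = ‖g n‖) : S f = S g :=
  le_antisymm (hS.mono _ _ fun n => (h n).le) (hS.mono _ _ fun n => (h n).ge)

/-- The complements of both sets are countably infinite, so a bijection between the sets extends to
a permutation of `ℕ`. -/
lemma indicator_eq_of_card_eq {A D : Finset ℕ} (h : A.card = D.card) :
    S (Set.indicator (A : Set ℕ) 1) = S (Set.indicator (D : Set ℕ) 1) := by
  classical
  have : Infinite {x // ¬ x ∈ A} := A.finite_toSet.infinite_compl.to_subtype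
  have : Infinite {x // ¬ x ∈ D} := D.finite_toSet.infinite_compl.to_subtype
  obtain ⟨e'⟩ : Nonempty ({x // ¬ x ∈ A} ≃ {x // ¬ x ∈ D}) := nonempty_equiv_of_countable
  set π : Equiv.Perm ℕ := Equiv.subtypeCongr (Finset.equivOfCardEq h) e' with hπ
  rw [← hS.symm π (Set.indicator (D : Set ℕ) 1)]
  congr 1
  ext n
  simp only [Function.comp_apply, Set.indicator, Finset.mem_coe, Pi.one_apply]
  have : n ∈ A ↔ π n ∈ D := by
    by_cases hn : n ∈ A
    · simp [hπ, Equiv.subtypeCongr, hn]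
    · have := (e' ⟨n, hn⟩).2
      simpa [hπ, Equiv.subtypeCongr, hn] using this
  simp [this]

lemma indicator_eq_fundamentalFunction (A : Finset ℕ) :
    S (Set.indicator (A : Set ℕ) 1) = fundamentalFunction S A.card :=
  hS.indicator_eq_of_card_eq (by simp)

lemma fundamentalFunction_mono : Monotone (fundamentalFunction S) := by
  classical
  intro m n hmn
  refine hS.mono _ _ fun k => norm_indicator_le_of_subset ?_ _ _
  simpa using hmn

lemma mem_gaugeSpaceZero_of_finite_support {f : ℕ → 𝕜} (hf : f.support.Finite) :
    f ∈ gaugeSpaceZero S := by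
  refine ⟨?_, fun ε hε => ⟨f, hf, by simpa [hS.map_zero] using hε⟩⟩
  set M : ℝ := ∑ n ∈ hf.toFinset, ‖f n‖ with hM
  have h1 : S f ≤ S ((M : 𝕜) • Set.indicator (hf.toFinset : Set ℕ) 1) := by
    refine hS.mono _ _ fun n => ?_
    by_cases hn : n ∈ hf.toFinset
    · have : ‖f n‖ ≤ M := Finset.single_le_sum (f := fun n => ‖f n‖) (fun _ _ => norm_nonneg _) hn
      have hM0 : 0 ≤ M := (norm_nonneg _).trans this
      rw [Pi.smul_apply, Set.indicator_of_mem (show n ∈ (hf.toFinset : Set ℕ) from hn)]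
      simpa [abs_of_nonneg hM0] using this
    · have : f n = 0 := by simpa using hn
      simp [this]
  refine h1.trans_lt ?_
  rw [hS.smul]
  exact ENNReal.mul_lt_top ENNReal.ofReal_lt_top (hS.finite _)

lemma norm_apply_mul_le (f : ℕ → 𝕜) (n : ℕ) :
    ENNReal.ofReal ‖f n‖ * fundamentalFunction S 1 ≤ S f := by
  have h1 : fundamentalFunction S 1 = S (Set.indicator (({n} : Finset ℕ) : Set ℕ) 1) := by
    rw [hS.indicator_eq_fundamentalFunction, Finset.card_singleton]
  rw [h1, ← hS.smul]
  refine hS.mono _ _ fun k => ?_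
  by_cases hk : k = n
  · subst hk; simp
  · simp [hk]

lemma fundamentalFunction_one_pos : 0 < fundamentalFunction S 1 := by
  refine hS.pos _ fun h => ?_
  have := congr_fun h 0
  simp at this

/-- A symmetric space with a quasi-triangle law is complete. -/
theorem isQuasiBanachGauge (hadd : ∃ κ : ℝ≥0, ∀ f g, S (f + g) ≤ κ * (S f + S g)) :
    IsQuasiBanachGauge S := by
  refine ⟨hadd, fun u hu hcauchy => ?_⟩
  obtain ⟨κ, hκ⟩ := hadd
  set c := fundamentalFunction S 1 with hc
  have hc0 : 0 < c := hS.fundamentalFunction_one_pos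
  have hctop : c ≠ ∞ := (hS.finite _).ne
  have hcoord : ∀ n, ∃ y, Tendsto (fun k => u k n) atTop (𝓝 y) := by
    intro n
    refine cauchySeq_tendsto_of_complete (Metric.cauchySeq_iff.2 fun ε hε => ?_)
    obtain ⟨K, hK⟩ := hcauchy (ENNReal.ofReal ε * c)
      (ENNReal.mul_pos (by simpa using hε) hc0.ne')
    refine ⟨K, fun i hi j hj => ?_⟩
    have h1 := (hS.norm_apply_mul_le (u i - u j) n).trans_lt (hK i hi j hj)
    have h2 := lt_of_mul_lt_mul_right' h1
    rw [dist_eq_norm]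
    exact (ENNReal.ofReal_lt_ofReal_iff hε).1 h2
  choose f hf using hcoord
  have key : ∀ (ε : ℝ≥0∞) (K i : ℕ), (∀ j ≥ K, S (u i - u j) ≤ ε) → S (u i - f) ≤ ε := by
    intro ε K i h
    -- The Fatou property applies only to increasing sequences, and `|u_i - u_j|` need not increase
    -- with `j`. Its tail infima do: they increase to `|u_i - f|` and are dominated by a single
    -- difference of index at least `K`.
    set a : ℕ → ℕ → ℝ := fun j n => ⨅ l : ℕ, ‖u i n - u (j + K + l) n‖ with ha
    have hbdd : ∀ j n, BddBelow (Set.range fun l : ℕ => ‖u i n - u (j + K + l) n‖) :=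
      fun j n => ⟨0, by rintro _ ⟨l, rfl⟩; exact norm_nonneg _⟩
    have ha0 : ∀ j n, 0 ≤ a j n := fun j n => le_ciInf fun l => norm_nonneg _
    have hmono : ∀ n, Monotone fun j => a j n := by
      intro n j j' hjj'
      refine le_ciInf fun l => (ciInf_le (hbdd j n) (j' - j + l)).trans (le_of_eq ?_)
      have : j + K + (j' - j + l) = j' + K + l := by omega
      rw [this]
    have hlim : ∀ n, Tendsto (fun j => a j n) atTop (𝓝 ‖u i n - f n‖) := by
      intro n
      have h1 : Tendsto (fun j => ‖u i n - u j n‖) atTop (𝓝 ‖u i n - f n‖) :=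
        (tendsto_const_nhds.sub (hf n)).norm
      rw [Metric.tendsto_atTop] at h1 ⊢
      intro δ hδ
      obtain ⟨N, hN⟩ := h1 (δ / 2) (by linarith)
      refine ⟨N, fun j hj => ?_⟩
      have h2 : ∀ l, |‖u i n - u (j + K + l) n‖ - ‖u i n - f n‖| < δ / 2 := fun l =>
        hN _ (by omega)
      have h3 : a j n ≤ ‖u i n - u (j + K + 0) n‖ := ciInf_le (hbdd j n) 0
      have h4 : ‖u i n - f n‖ - δ / 2 ≤ a j n :=
        le_ciInf fun l => by linarith [(abs_lt.1 (h2 l)).1]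
      rw [Real.dist_eq, abs_lt]
      constructor <;> linarith [(abs_lt.1 (h2 0)).2]
    have hfat := hS.fatou a _ ha0 hmono hlim
    have heq : S (fun n => ((‖u i n - f n‖ : ℝ) : 𝕜)) = S (u i - f) :=
      hS.congr_norm fun n => by simp
    rw [heq] at hfat
    refine le_of_tendsto' hfat fun j => ?_
    refine (hS.mono (u i - u (j + K + 0)) _ fun n => ?_).trans (h _ (by omega))
    rw [RCLike.norm_ofReal, abs_of_nonneg (ha0 j n)]
    exact ciInf_le (hbdd j n) 0
  have hcvg : ∀ ε : ℝ≥0∞, 0 < ε → ∃ K, ∀ i ≥ K, S (u i - f) ≤ ε := fun ε hε => by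
    obtain ⟨K, hK⟩ := hcauchy ε hε
    exact ⟨K, fun i hi => key ε K i fun j hj => (hK i hi j hj).le⟩
  refine ⟨f, ?_, ?_⟩
  · obtain ⟨K, hK⟩ := hcvg 1 one_pos
    have h1 : S (f - u K) ≤ 1 := by
      rw [hS.congr_norm (g := u K - f) fun n => by simp [norm_sub_rev]]
      exact hK K le_rfl
    have h2 := hκ (f - u K) (u K)
    rw [sub_add_cancel] at h2
    refine h2.trans_lt (ENNReal.mul_lt_top ENNReal.coe_lt_top (ENNReal.add_lt_top.2 ⟨?_, hu K⟩))
    exact h1.trans_lt ENNReal.one_lt_top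
  · rw [ENNReal.tendsto_nhds_zero]
    intro ε hε
    obtain ⟨K, hK⟩ := hcvg ε hε
    exact eventually_atTop.2 ⟨K, hK⟩

end IsSymmetricGauge

end Gauges

/-! ### Primitive weights and the weight of `d_{1,p}(w)` -/

section Weights

variable {w : ℕ → ℝ}

lemma primitive_zero : primitive w 0 = 0 := by simp [primitive]

lemma primitive_succ (n : ℕ) : primitive w (n + 1) = primitive w n + w n :=
  Finset.sum_range_succ _ _

lemma primitive_mono (hw : ∀ n, 0 < w n) : Monotone (primitive w) :=
  monotone_nat_of_le_succ fun n => by rw [primitive_succ]; linarith [hw n]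

lemma primitive_nonneg (hw : ∀ n, 0 < w n) (n : ℕ) : 0 ≤ primitive w n :=
  Finset.sum_nonneg fun i _ => (hw i).le

lemma primitive_succ_pos (hw : ∀ n, 0 < w n) (n : ℕ) : 0 < primitive w (n + 1) := by
  rw [primitive_succ]; linarith [hw n, primitive_nonneg hw n]

/-- The weight `s_n^{p-1} w_n` of the gauge of `d_{1,p}(w)`. -/
noncomputable def lorentzWeight (w : ℕ → ℝ) (p : ℝ) (n : ℕ) : ℝ :=
  primitive w (n + 1) ^ (p - 1) * w n

lemma lorentzWeight_pos (hw : ∀ n, 0 < w n) (p : ℝ) (n : ℕ) : 0 < lorentzWeight w p n :=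
  mul_pos (Real.rpow_pos_of_pos (primitive_succ_pos hw n) _) (hw n)

/-- For `p ≤ 1` the factor `s_i^{p-1}` is non-increasing, so each one may be replaced by the last
one, and the sum of the `w_i` is `s_n`. -/
lemma rpow_primitive_le_sum_lorentzWeight (hw : ∀ n, 0 < w n) {p : ℝ} (hp : 0 < p) (hp1 : p ≤ 1)
    (n : ℕ) : primitive w n ^ p ≤ ∑ i ∈ Finset.range n, lorentzWeight w p i := by
  rcases n with _ | n
  · simp [primitive_zero, Real.zero_rpow hp.ne']
  · have hs := primitive_succ_pos hw n
    calc primitive w (n + 1) ^ p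
        = primitive w (n + 1) ^ (p - 1) * primitive w (n + 1) := by
          rw [← Real.rpow_add_one hs.ne', sub_add_cancel]
      _ = ∑ i ∈ Finset.range (n + 1), primitive w (n + 1) ^ (p - 1) * w i := by
          rw [← Finset.mul_sum]; rfl
      _ ≤ _ := by
          refine Finset.sum_le_sum fun i hi => mul_le_mul_of_nonneg_right ?_ (hw i).le
          refine Real.rpow_le_rpow_of_nonpos (primitive_succ_pos hw i) ?_ (by linarith)
          exact primitive_mono hw (by simpa [Nat.lt_succ_iff] using hi)

/-- A discrete form of `∫ s^{p-1} ds = s^p / p`: Bernoulli's inequality for exponents at most one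
bounds `p s_n^{p-1} w_n` by `s_n^p - s_{n-1}^p`, and this telescopes. -/
lemma sum_lorentzWeight_le_of_le_one (hw : ∀ n, 0 < w n) {p : ℝ} (hp : 0 < p) (hp1 : p ≤ 1)
    (n : ℕ) : ∑ i ∈ Finset.range n, lorentzWeight w p i ≤ 1 / p * primitive w n ^ p := by
  induction n with
  | zero => simp [primitive_zero, Real.zero_rpow hp.ne']
  | succ n ih =>
    rw [Finset.sum_range_succ]
    have hs := primitive_succ_pos hw n
    have hs0 := primitive_nonneg hw n
    set s := primitive w n
    set s' := primitive w (n + 1) with hs'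
    have hss : s' = s + w n := primitive_succ n
    have h1 := rpow_one_add_le_one_add_mul_self (s := s / s' - 1) (p := p)
      (by linarith [div_nonneg hs0 hs.le]) hp.le hp1
    rw [add_sub_cancel, Real.div_rpow hs0 hs.le, div_le_iff₀ (Real.rpow_pos_of_pos hs p)] at h1
    have h2 : lorentzWeight w p n = (1 - s / s') * s' ^ p := by
      have : s' ^ p = s' ^ (p - 1) * s' := by rw [← Real.rpow_add_one hs.ne', sub_add_cancel]
      rw [lorentzWeight, this, ← hs']
      field_simp
      linarith
    have h3 : p * lorentzWeight w p n ≤ s' ^ p - s ^ p := by rw [h2]; linarith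
    calc _ ≤ 1 / p * s ^ p + 1 / p * (s' ^ p - s ^ p) := by
          refine add_le_add ih ?_
          rw [div_mul_eq_mul_div, one_mul, le_div_iff₀ hp]
          linarith
      _ = _ := by ring

lemma sum_lorentzWeight_le_of_one_le (hw : ∀ n, 0 < w n) {p : ℝ} (hp1 : 1 ≤ p)
    (n : ℕ) : ∑ i ∈ Finset.range n, lorentzWeight w p i ≤ primitive w n ^ p := by
  rcases n with _ | n
  · simp [primitive_zero, Real.zero_rpow (by linarith : p ≠ 0)]
  · have hs := primitive_succ_pos hw n
    calc _ ≤ ∑ i ∈ Finset.range (n + 1), primitive w (n + 1) ^ (p - 1) * w i := by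
          refine Finset.sum_le_sum fun i hi => mul_le_mul_of_nonneg_right ?_ (hw i).le
          refine Real.rpow_le_rpow (primitive_succ_pos hw i).le ?_ (by linarith)
          exact primitive_mono hw (by simpa [Nat.lt_succ_iff] using hi)
      _ = primitive w (n + 1) ^ (p - 1) * primitive w (n + 1) := by
          rw [← Finset.mul_sum]; rfl
      _ = _ := by rw [← Real.rpow_add_one hs.ne', sub_add_cancel]

lemma exists_sum_lorentzWeight_le (hw : ∀ n, 0 < w n) {p : ℝ} (hp : 0 < p) :
    ∃ C : ℝ, 0 < C ∧
      ∀ n, ∑ i ∈ Finset.range n, lorentzWeight w p i ≤ C * primitive w n ^ p := by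
  rcases le_total p 1 with h | h
  · exact ⟨1 / p, by positivity, sum_lorentzWeight_le_of_le_one hw hp h⟩
  · exact ⟨1, one_pos, fun n => by simpa using sum_lorentzWeight_le_of_one_le hw h n⟩

end Weights

/-! ### Lorentz gauges: symmetry, quasi-triangle law, density of finite sequences -/

section Lorentz

variable {𝕜 : Type*} [RCLike 𝕜] {w : ℕ → ℝ}

/-- The sum in the definition of the gauge of `d_{1,p}(w)`. -/
noncomputable def lorentzSum (w : ℕ → ℝ) (p : ℝ) (f : ℕ → 𝕜) : ℝ≥0∞ :=
  ∑' n, rearrangement f n ^ p * ENNReal.ofReal (lorentzWeight w p n)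

lemma lorentz_eq (w : ℕ → ℝ) (p : ℝ) (f : ℕ → 𝕜) :
    lorentz w p f = lorentzSum w p f ^ (1 / p) := rfl

lemma lorentz_rpow (w : ℕ → ℝ) {p : ℝ} (hp : 0 < p) (f : ℕ → 𝕜) :
    lorentz w p f ^ p = lorentzSum w p f := by
  rw [lorentz_eq, ← ENNReal.rpow_mul, one_div_mul_cancel hp.ne', ENNReal.rpow_one]

lemma lorentzSum_mono {p : ℝ} (hp : 0 < p) {f g : ℕ → 𝕜} (h : ∀ k, ‖g k‖ ≤ ‖f k‖) :
    lorentzSum w p g ≤ lorentzSum w p f :=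
  ENNReal.tsum_le_tsum fun n => by
    gcongr
    exact rearrangement_mono h n

lemma lorentzSum_indicator (hw : ∀ n, 0 < w n) {p : ℝ} (hp : 0 < p) (A : Finset ℕ) :
    lorentzSum w p (Set.indicator (A : Set ℕ) (1 : ℕ → 𝕜)) =
      ENNReal.ofReal (∑ i ∈ Finset.range A.card, lorentzWeight w p i) := by
  rw [lorentzSum, tsum_eq_sum (s := Finset.range A.card),
    ENNReal.ofReal_sum_of_nonneg fun i _ => (lorentzWeight_pos hw p i).le]
  · refine Finset.sum_congr rfl fun i hi => ?_
    rw [rearrangement_indicator, if_pos (Finset.mem_range.1 hi), ENNReal.one_rpow, one_mul]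
  · intro i hi
    rw [rearrangement_indicator, if_neg (by simpa using hi), ENNReal.zero_rpow_of_pos hp, zero_mul]

lemma isSymmetricGauge_lorentz (hw : ∀ n, 0 < w n) {p : ℝ} (hp : 0 < p) :
    IsSymmetricGauge (lorentz w p : (ℕ → 𝕜) → ℝ≥0∞) where
  pos f hf := by
    rw [lorentz_eq]
    refine ENNReal.rpow_pos_of_nonneg ?_ (by positivity)
    refine lt_of_lt_of_le ?_ (ENNReal.le_tsum 0)
    exact ENNReal.mul_pos (ENNReal.rpow_pos_of_nonneg (rearrangement_zero_pos hf) hp.le).ne'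
      (by simpa using lorentzWeight_pos hw p 0)
  smul t f := by
    have h : lorentzSum w p (t • f) = ENNReal.ofReal ‖t‖ ^ p * lorentzSum w p f := by
      rw [lorentzSum, lorentzSum, ← ENNReal.tsum_mul_left]
      refine tsum_congr fun n => ?_
      rw [rearrangement_smul, ENNReal.mul_rpow_of_nonneg _ _ hp.le, mul_assoc]
    rw [lorentz_eq, lorentz_eq, h, ENNReal.mul_rpow_of_nonneg _ _ (by positivity),
      ← ENNReal.rpow_mul, mul_one_div_cancel hp.ne', ENNReal.rpow_one]
  mono f g h := ENNReal.rpow_le_rpow (lorentzSum_mono hp h) (by positivity)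
  finite A := by
    rw [lorentz_eq, lorentzSum_indicator hw hp]
    exact ENNReal.rpow_lt_top_of_nonneg (by positivity) ENNReal.ofReal_ne_top
  fatou a b h0 hmono hlim := by
    simp only [lorentz_eq]
    refine (ENNReal.continuous_rpow_const.tendsto _).comp ?_
    simp only [lorentzSum, ← MeasureTheory.lintegral_count]
    refine MeasureTheory.lintegral_tendsto_of_tendsto_of_monotone
      (fun k => (measurable_of_countable _).aemeasurable) (Eventually.of_forall fun n => ?_)
      (Eventually.of_forall fun n => ?_)
    · intro k l hkl
      have := rearrangement_monotone_of_monotone (𝕜 := 𝕜) h0 hmono n hkl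
      dsimp only at this ⊢
      gcongr
    · refine ENNReal.Tendsto.mul_const ?_ (Or.inr ENNReal.ofReal_ne_top)
      exact (ENNReal.continuous_rpow_const.tendsto _).comp (tendsto_rearrangement h0 hmono hlim n)
  symm π f := by rw [lorentz_eq, lorentz_eq, lorentzSum, lorentzSum, rearrangement_comp_perm]

lemma weakLorentz_indicator (hw : ∀ n, 0 < w n) (A : Finset ℕ) :
    weakLorentz w (Set.indicator (A : Set ℕ) (1 : ℕ → 𝕜)) =
      ENNReal.ofReal (primitive w A.card) := by
  refine le_antisymm (iSup_le fun n => ?_) ?_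
  · rw [rearrangement_indicator]
    split_ifs with h
    · rw [one_mul]
      exact ENNReal.ofReal_le_ofReal (primitive_mono hw h)
    · simp
  · rcases hA : A.card with _ | n
    · simp [primitive_zero]
    · refine le_trans ?_ (le_iSup _ n)
      rw [rearrangement_indicator, if_pos (by omega), one_mul]

lemma isSymmetricGauge_weakLorentz (hw : ∀ n, 0 < w n) :
    IsSymmetricGauge (weakLorentz w : (ℕ → 𝕜) → ℝ≥0∞) where
  pos f hf := by
    refine lt_of_lt_of_le ?_ (le_iSup _ 0)
    exact ENNReal.mul_pos (rearrangement_zero_pos hf).ne'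
      (by simpa using primitive_succ_pos hw 0)
  smul t f := by
    simp only [weakLorentz, rearrangement_smul, ENNReal.mul_iSup, mul_assoc]
  mono f g h := iSup_mono fun n => by
    gcongr
    exact rearrangement_mono h n
  finite A := by
    rw [weakLorentz_indicator hw]
    exact ENNReal.ofReal_lt_top
  fatou a b h0 hmono hlim := by
    have h1 := fun n => rearrangement_monotone_of_monotone (𝕜 := 𝕜) h0 hmono n
    have h2 : ∀ n, rearrangement (fun i => ((b i : ℝ) : 𝕜)) n =
        ⨆ k, rearrangement (fun i => ((a k i : ℝ) : 𝕜)) n := fun n =>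
      tendsto_nhds_unique (tendsto_rearrangement h0 hmono hlim n) (tendsto_atTop_iSup (h1 n))
    have h3 : weakLorentz w (fun i => ((b i : ℝ) : 𝕜)) =
        ⨆ k, weakLorentz w (fun i => ((a k i : ℝ) : 𝕜)) := by
      simp only [weakLorentz, h2, ENNReal.iSup_mul]
      rw [iSup_comm]
    rw [h3]
    refine tendsto_atTop_iSup fun k l hkl => iSup_mono fun n => ?_
    have := h1 n hkl
    dsimp only at this
    gcongr
  symm π f := by rw [weakLorentz, weakLorentz, rearrangement_comp_perm]

lemma fundamentalFunction_weakLorentz (hw : ∀ n, 0 < w n) (m : ℕ) :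
    fundamentalFunction (weakLorentz w : (ℕ → 𝕜) → ℝ≥0∞) m = ENNReal.ofReal (primitive w m) := by
  rw [fundamentalFunction, weakLorentz_indicator hw, Finset.card_range]

lemma fundamentalFunction_lorentz (hw : ∀ n, 0 < w n) {p : ℝ} (hp : 0 < p) (m : ℕ) :
    fundamentalFunction (lorentz w p : (ℕ → 𝕜) → ℝ≥0∞) m =
      ENNReal.ofReal ((∑ i ∈ Finset.range m, lorentzWeight w p i) ^ (1 / p)) := by
  rw [fundamentalFunction, lorentz_eq, lorentzSum_indicator hw hp, Finset.card_range,
    ENNReal.ofReal_rpow_of_nonneg (Finset.sum_nonneg fun i _ => (lorentzWeight_pos hw p i).le)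
      (by positivity)]

lemma exists_fundamentalFunction_lorentz_le (hw : ∀ n, 0 < w n) {p : ℝ} (hp : 0 < p) :
    ∃ C : ℝ≥0, ∀ m, fundamentalFunction (lorentz w p : (ℕ → 𝕜) → ℝ≥0∞) m ≤
      C * ENNReal.ofReal (primitive w m) := by
  obtain ⟨C, hC0, hC⟩ := exists_sum_lorentzWeight_le hw hp
  refine ⟨(C ^ (1 / p)).toNNReal, fun m => ?_⟩
  rw [fundamentalFunction_lorentz hw hp, ENNReal.ofNNReal_toNNReal,
    ← ENNReal.ofReal_mul (by positivity)]
  refine ENNReal.ofReal_le_ofReal ?_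
  have hs := primitive_nonneg hw m
  calc _ ≤ (C * primitive w m ^ p) ^ (1 / p) :=
        Real.rpow_le_rpow (Finset.sum_nonneg fun i _ => (lorentzWeight_pos hw p i).le) (hC m)
          (by positivity)
    _ = _ := by
        rw [Real.mul_rpow hC0.le (by positivity), ← Real.rpow_mul hs, mul_one_div_cancel hp.ne',
          Real.rpow_one]

lemma seqEquiv_fundamentalFunction_lorentz (hw : ∀ n, 0 < w n) {p : ℝ} (hp : 0 < p)
    (hp1 : p ≤ 1) :
    SeqEquiv (fundamentalFunction (lorentz w p : (ℕ → 𝕜) → ℝ≥0∞))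
      (fundamentalFunction (weakLorentz w : (ℕ → 𝕜) → ℝ≥0∞)) := by
  obtain ⟨C, hC⟩ := exists_fundamentalFunction_lorentz_le (𝕜 := 𝕜) hw hp
  refine ⟨max C 1, fun m _ => ?_⟩
  simp only [fundamentalFunction_weakLorentz hw]
  constructor
  · refine (hC m).trans ?_
    gcongr
    exact le_max_left _ _
  · have h1 : ENNReal.ofReal (primitive w m) ≤
        fundamentalFunction (lorentz w p : (ℕ → 𝕜) → ℝ≥0∞) m := by
      rw [fundamentalFunction_lorentz hw hp]
      refine ENNReal.ofReal_le_ofReal ?_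
      have hs := primitive_nonneg hw m
      calc primitive w m = (primitive w m ^ p) ^ (1 / p) := by
            rw [← Real.rpow_mul hs, mul_one_div_cancel hp.ne', Real.rpow_one]
        _ ≤ _ := Real.rpow_le_rpow (by positivity)
            (rpow_primitive_le_sum_lorentzWeight hw hp hp1 m) (by positivity)
    calc _ ≤ 1 * fundamentalFunction (lorentz w p : (ℕ → 𝕜) → ℝ≥0∞) m := by rwa [one_mul]
      _ ≤ _ := by
        gcongr
        exact_mod_cast le_max_right C 1

/-- Hardy's lemma: sums against a non-increasing sequence are controlled by partial sums. -/
lemma sum_range_mul_le_of_antitone {u v : ℕ → ℝ≥0∞}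
    (h : ∀ n, ∑ i ∈ Finset.range n, v i ≤ ∑ i ∈ Finset.range n, u i) (N : ℕ)
    {a : ℕ → ℝ≥0∞} (ha : Antitone a) :
    ∑ i ∈ Finset.range N, a i * v i ≤ ∑ i ∈ Finset.range N, a i * u i := by
  induction N generalizing a with
  | zero => simp
  | succ N ih =>
    -- Summation by parts without signs: remove the constant `a N`, to which the hypothesis on
    -- partial sums applies. The differences `a i - a N` are again antitone, and the last one
    -- vanishes, so the induction hypothesis handles them.
    have hdecomp : ∀ x : ℕ → ℝ≥0∞, ∑ i ∈ Finset.range (N + 1), a i * x i =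
        a N * ∑ i ∈ Finset.range (N + 1), x i + ∑ i ∈ Finset.range N, (a i - a N) * x i := by
      intro x
      have h1 : ∑ i ∈ Finset.range N, (a i - a N) * x i =
          ∑ i ∈ Finset.range (N + 1), (a i - a N) * x i := by
        rw [Finset.sum_range_succ, tsub_self, zero_mul, add_zero]
      rw [h1, Finset.mul_sum, ← Finset.sum_add_distrib]
      refine Finset.sum_congr rfl fun i hi => ?_
      rw [← add_mul, add_tsub_cancel_of_le (ha (by simpa [Nat.lt_succ_iff] using hi))]
    rw [hdecomp, hdecomp]
    exact add_le_add (mul_le_mul_right (h _) _)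
      (ih fun i j hij => tsub_le_tsub_right (ha hij) _)

lemma tsum_mul_le_of_antitone {u v : ℕ → ℝ≥0∞}
    (h : ∀ n, ∑ i ∈ Finset.range n, v i ≤ ∑ i ∈ Finset.range n, u i)
    {a : ℕ → ℝ≥0∞} (ha : Antitone a) : ∑' i, a i * v i ≤ ∑' i, a i * u i :=
  ENNReal.tsum_le_of_sum_range_le fun N =>
    (sum_range_mul_le_of_antitone h N ha).trans (ENNReal.sum_le_tsum _)

lemma sum_range_double {M : Type*} [AddCommMonoid M] (u : ℕ → M) (n : ℕ) :
    ∑ i ∈ Finset.range n, (u (2 * i) + u (2 * i + 1)) = ∑ i ∈ Finset.range (2 * n), u i := by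
  induction n with
  | zero => simp
  | succ n ih =>
    rw [Finset.sum_range_succ, ih, show 2 * (n + 1) = 2 * n + 1 + 1 by ring,
      Finset.sum_range_succ, Finset.sum_range_succ, add_assoc]

/-- By `rearrangement_add_le_half` it suffices to bound the sum with `f^*` dilated by two. Pairing
even and odd indices moves the dilation to the weight, whose partial sums up to `2n` are comparable
to `s_{2n}^p`, hence by doubling bounded by those up to `n`; Hardy's lemma concludes. -/
lemma exists_lorentzSum_add_le (hw : ∀ n, 0 < w n) {p : ℝ} (hp : 0 < p) (hp1 : p ≤ 1)
    (hdbl : ∃ D : ℝ, ∀ n, primitive w (2 * n) ≤ D * primitive w n) :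
    ∃ C : ℝ≥0, ∀ f g : ℕ → 𝕜,
      lorentzSum w p (f + g) ≤ C * (lorentzSum w p f + lorentzSum w p g) := by
  obtain ⟨D, hD⟩ := hdbl
  set u : ℕ → ℝ≥0∞ := fun n => ENNReal.ofReal (lorentzWeight w p n) with hu
  set C : ℝ := 1 / p * |D| ^ p with hCdef
  have hC0 : 0 ≤ C := by positivity
  have hu0 := fun n => (lorentzWeight_pos hw p n).le
  have hU : ∀ n, ∑ i ∈ Finset.range n, (u (2 * i) + u (2 * i + 1)) ≤
      ∑ i ∈ Finset.range n, ENNReal.ofReal C * u i := by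
    intro n
    rw [sum_range_double, ← Finset.mul_sum]
    simp only [hu]
    rw [← ENNReal.ofReal_sum_of_nonneg fun i _ => hu0 i,
      ← ENNReal.ofReal_sum_of_nonneg fun i _ => hu0 i, ← ENNReal.ofReal_mul hC0]
    refine ENNReal.ofReal_le_ofReal ?_
    have hs := primitive_nonneg hw n
    calc _ ≤ 1 / p * primitive w (2 * n) ^ p := sum_lorentzWeight_le_of_le_one hw hp hp1 _
      _ ≤ 1 / p * (|D| * primitive w n) ^ p := by
          gcongr
          · exact primitive_nonneg hw _
          · exact (hD n).trans (mul_le_mul_of_nonneg_right (le_abs_self D) hs)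
      _ = C * primitive w n ^ p := by
          rw [Real.mul_rpow (abs_nonneg _) hs, hCdef]; ring
      _ ≤ _ := by
          gcongr
          exact rpow_primitive_le_sum_lorentzWeight hw hp hp1 n
  have hhalf : ∀ f : ℕ → 𝕜, ∑' n, rearrangement f (n / 2) ^ p * u n ≤
      ENNReal.ofReal C * lorentzSum w p f := by
    intro f
    have h1 : ∑' n, rearrangement f (n / 2) ^ p * u n =
        ∑' n, rearrangement f n ^ p * (u (2 * n) + u (2 * n + 1)) := by
      rw [← tsum_even_add_odd ENNReal.summable ENNReal.summable, ← ENNReal.tsum_add]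
      refine tsum_congr fun n => ?_
      rw [show 2 * n / 2 = n by omega, show (2 * n + 1) / 2 = n by omega, mul_add]
    rw [h1, lorentzSum, ← ENNReal.tsum_mul_left]
    refine (tsum_mul_le_of_antitone hU fun i j hij => ?_).trans (le_of_eq (tsum_congr fun n => ?_))
    · exact ENNReal.rpow_le_rpow (rearrangement_antitone f hij) hp.le
    · simp only [hu]; ring
  refine ⟨C.toNNReal, fun f g => ?_⟩
  rw [ENNReal.ofNNReal_toNNReal, mul_add]
  refine le_trans ?_ (add_le_add (hhalf f) (hhalf g))
  rw [← ENNReal.tsum_add]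
  refine ENNReal.tsum_le_tsum fun n => ?_
  rw [← add_mul]
  gcongr
  exact (ENNReal.rpow_le_rpow (rearrangement_add_le_half f g n) hp.le).trans
    (ENNReal.rpow_add_le_add_rpow _ _ hp.le hp1)

theorem isQuasiBanachGauge_lorentz (hw : ∀ n, 0 < w n) {p : ℝ} (hp : 0 < p) (hp1 : p ≤ 1)
    (hdbl : ∃ D : ℝ, ∀ n, primitive w (2 * n) ≤ D * primitive w n) :
    IsQuasiBanachGauge (lorentz w p : (ℕ → 𝕜) → ℝ≥0∞) := by
  refine (isSymmetricGauge_lorentz hw hp).isQuasiBanachGauge ?_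
  obtain ⟨C, hC⟩ := exists_lorentzSum_add_le (𝕜 := 𝕜) hw hp hp1 hdbl
  refine ⟨(2 * C) ^ (1 / p), fun f g => ?_⟩
  have hp' : 0 ≤ 1 / p := by positivity
  rw [ENNReal.coe_rpow_of_nonneg _ hp', lorentz_eq, lorentz_eq, lorentz_eq]
  set x := lorentzSum w p f
  set y := lorentzSum w p g
  calc _ ≤ (((2 * C : ℝ≥0) : ℝ≥0∞) * max x y) ^ (1 / p) := by
        refine ENNReal.rpow_le_rpow ((hC f g).trans ?_) hp'
        push_cast
        rw [mul_comm 2, mul_assoc, two_mul]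
        gcongr
        · exact le_max_left _ _
        · exact le_max_right _ _
    _ = ((2 * C : ℝ≥0) : ℝ≥0∞) ^ (1 / p) * max x y ^ (1 / p) :=
        ENNReal.mul_rpow_of_nonneg _ _ hp'
    _ ≤ _ := by
        gcongr
        rcases max_choice x y with h | h <;> rw [h]
        · exact le_self_add
        · exact le_add_self

theorem isQuasiBanachGauge_weakLorentz (hw : ∀ n, 0 < w n)
    (hdbl : ∃ D : ℝ, ∀ n, primitive w (2 * n) ≤ D * primitive w n) :
    IsQuasiBanachGauge (weakLorentz w : (ℕ → 𝕜) → ℝ≥0∞) := by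
  refine (isSymmetricGauge_weakLorentz hw).isQuasiBanachGauge ?_
  obtain ⟨D, hD⟩ := hdbl
  refine ⟨D.toNNReal, fun f g => iSup_le fun n => ?_⟩
  -- Doubling applies because `n + 1 ≤ 2 (n / 2 + 1)`, and `n / 2 + 1` is the index of `s` paired
  -- with the rearrangement at `n / 2`.
  have h1 : ENNReal.ofReal (primitive w (n + 1)) ≤
      (D.toNNReal : ℝ≥0∞) * ENNReal.ofReal (primitive w (n / 2 + 1)) := by
    rw [ENNReal.ofNNReal_toNNReal, ← ENNReal.ofReal_mul' (primitive_nonneg hw _)]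
    exact ENNReal.ofReal_le_ofReal ((primitive_mono hw (by omega)).trans (hD (n / 2 + 1)))
  calc _ ≤ (rearrangement f (n / 2) + rearrangement g (n / 2)) *
        ((D.toNNReal : ℝ≥0∞) * ENNReal.ofReal (primitive w (n / 2 + 1))) := by
        gcongr
        exact rearrangement_add_le_half f g n
    _ = (D.toNNReal : ℝ≥0∞) *
        (rearrangement f (n / 2) * ENNReal.ofReal (primitive w (n / 2 + 1)) +
          rearrangement g (n / 2) * ENNReal.ofReal (primitive w (n / 2 + 1))) := by ring
    _ ≤ _ := by
        gcongr
        · exact le_iSup (fun n => rearrangement f n * ENNReal.ofReal (primitive w (n + 1))) _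
        · exact le_iSup (fun n => rearrangement g n * ENNReal.ofReal (primitive w (n + 1))) _

/-- If the primitive weight is unbounded, the finitely supported sequences are dense in
`d_{1,p}(w)`. -/
theorem gaugeSpace_lorentz_subset_gaugeSpaceZero (hw : ∀ n, 0 < w n) {p : ℝ} (hp : 0 < p)
    (hp1 : p ≤ 1) (hunb : ∀ M : ℝ, ∃ n, M ≤ primitive w n) :
    gaugeSpace (lorentz w p : (ℕ → 𝕜) → ℝ≥0∞) ⊆ gaugeSpaceZero (lorentz w p) := by
  intro f hf
  have hf : lorentz w p f < ∞ := hf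
  refine ⟨hf, fun ε hε => ?_⟩
  have hsum : lorentzSum w p f ≠ ∞ := by
    rw [← lorentz_rpow w hp]
    exact (ENNReal.rpow_lt_top_of_nonneg hp.le hf.ne).ne
  set u : ℕ → ℝ≥0∞ := fun n => ENNReal.ofReal (lorentzWeight w p n) with hu
  -- An infinite level set would keep the whole rearrangement above `t`, and the weights have
  -- infinite sum since `s` is unbounded.
  have hfin : ∀ t : ℝ, 0 < t → {k | t < ‖f k‖}.Finite := by
    intro t ht
    by_contra hinf
    refine hsum (ENNReal.eq_top_of_forall_nnreal_le fun M => ?_)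
    obtain ⟨n, hn⟩ := hunb ((M / t ^ p) ^ (1 / p))
    have hM : (M : ℝ) / t ^ p ≤ ∑ i ∈ Finset.range n, lorentzWeight w p i := by
      refine le_trans ?_ (rpow_primitive_le_sum_lorentzWeight hw hp hp1 n)
      have h1 := Real.rpow_le_rpow (by positivity) hn hp.le
      rwa [← Real.rpow_mul (by positivity), one_div_mul_cancel hp.ne', Real.rpow_one] at h1
    rw [div_le_iff₀ (by positivity), Finset.sum_mul] at hM
    calc (M : ℝ≥0∞) = ENNReal.ofReal M := by simp
      _ ≤ ENNReal.ofReal (∑ i ∈ Finset.range n, lorentzWeight w p i * t ^ p) :=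
          ENNReal.ofReal_le_ofReal hM
      _ = ∑ i ∈ Finset.range n, ENNReal.ofReal (lorentzWeight w p i * t ^ p) :=
          ENNReal.ofReal_sum_of_nonneg fun i _ =>
            mul_nonneg (lorentzWeight_pos hw p i).le (by positivity)
      _ ≤ ∑ i ∈ Finset.range n, rearrangement f i ^ p * u i := by
          refine Finset.sum_le_sum fun i _ => ?_
          rw [mul_comm, ENNReal.ofReal_mul (by positivity), ← ENNReal.ofReal_rpow_of_pos ht]
          gcongr
          obtain ⟨A, hA, hcard⟩ := Set.Infinite.exists_subset_card_eq hinf (i + 1)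
          refine (lt_rearrangement_iff.2 ⟨A, hcard, fun k hk => ?_⟩).le
          have h2 : t < ‖f k‖ := hA hk
          exact (ENNReal.ofReal_lt_ofReal_iff (ht.trans h2)).2 h2
      _ ≤ _ := ENNReal.sum_le_tsum _
  -- The minimum with one keeps the tolerance finite when `ε = ∞`.
  have hε' : 0 < min ε 1 ^ p := ENNReal.rpow_pos_of_nonneg (by simpa using hε) hp.le
  have hε'' : min ε 1 ^ p ≠ ∞ :=
    (ENNReal.rpow_lt_top_of_nonneg hp.le ((min_le_right ε 1).trans_lt ENNReal.one_lt_top).ne).ne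
  set η : ℝ≥0∞ := min ε 1 ^ p / 2 with hη
  have hη0 : 0 < η := ENNReal.half_pos hε'.ne'
  obtain ⟨N, hN⟩ := ((ENNReal.tendsto_sum_nat_add (fun n => rearrangement f n ^ p * u n)
    hsum).eventually_lt_const hη0).exists
  set U : ℝ := ∑ i ∈ Finset.range N, lorentzWeight w p i with hU
  have hU0 : 0 ≤ U := Finset.sum_nonneg fun i _ => (lorentzWeight_pos hw p i).le
  have hηtop : η ≠ ∞ := (ENNReal.half_lt_self hε'.ne' hε'').ne_top
  set η' : ℝ := η.toReal with hη'
  have hη'0 : 0 < η' := ENNReal.toReal_pos hη0.ne' hηtop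
  -- The approximant keeps the entries above height `t`, so the rearrangement of the remainder is at
  -- most `t` and at most that of `f`. The first bound makes the first `N` terms at most `η`, the
  -- second makes the tail less than `η`. Adding one to `U` avoids a zero denominator.
  set t : ℝ := (η' / (U + 1)) ^ (1 / p) with ht
  have ht0 : 0 < t := by positivity
  have htU : t ^ p * U ≤ η' := by
    rw [ht, ← Real.rpow_mul (by positivity), one_div_mul_cancel hp.ne', Real.rpow_one,
      div_mul_eq_mul_div, div_le_iff₀ (by positivity)]
    nlinarith
  refine ⟨Set.indicator {k | t < ‖f k‖} f, (hfin t ht0).subset ?_, ?_⟩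
  · intro k hk
    by_contra h
    exact hk (Set.indicator_of_notMem h f)
  · set g := f - Set.indicator {k | t < ‖f k‖} f with hg
    have hg1 : ∀ k, ‖g k‖ ≤ ‖f k‖ ∧ ‖g k‖ ≤ t := by
      intro k
      by_cases hk : t < ‖f k‖
      · have : g k = 0 := by
          simp [hg, Set.indicator_of_mem (show k ∈ {k | t < ‖f k‖} from hk)]
        simp [this, ht0.le]
      · have : g k = f k := by
          simp [hg, Set.indicator_of_notMem (show k ∉ {k | t < ‖f k‖} from hk)]
        rw [this]
        exact ⟨le_rfl, not_lt.1 hk⟩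
    have hgt : ∀ n, rearrangement g n ≤ ENNReal.ofReal t := fun n => by
      refine rearrangement_le_of_encard_le ?_
      have : {k | ENNReal.ofReal t < ENNReal.ofReal ‖g k‖} = ∅ := by
        ext k
        simpa using (ENNReal.ofReal_le_ofReal (hg1 k).2).not_gt
      rw [this]
      simp
    have hlt : lorentzSum w p g < min ε 1 ^ p := by
      have hhead : ∑ i ∈ Finset.range N, rearrangement g i ^ p * u i ≤ η := by
        calc _ ≤ ∑ i ∈ Finset.range N, ENNReal.ofReal (t ^ p * lorentzWeight w p i) := by
              refine Finset.sum_le_sum fun i _ => ?_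
              rw [ENNReal.ofReal_mul (by positivity), ← ENNReal.ofReal_rpow_of_pos ht0]
              gcongr
              exact hgt i
          _ = ENNReal.ofReal (t ^ p * U) := by
              rw [hU, Finset.mul_sum, ENNReal.ofReal_sum_of_nonneg]
              exact fun i _ => mul_nonneg (by positivity) (lorentzWeight_pos hw p i).le
          _ ≤ ENNReal.ofReal η' := ENNReal.ofReal_le_ofReal htU
          _ = η := ENNReal.ofReal_toReal hηtop
      rw [lorentzSum, ← (ENNReal.summable (α := ℕ)).sum_add_tsum_nat_add' (k := N),
        ← ENNReal.add_halves (min ε 1 ^ p)]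
      refine ENNReal.add_lt_add_of_le_of_lt (ne_top_of_le_ne_top hηtop hhead) hhead
        (lt_of_le_of_lt ?_ hN)
      refine ENNReal.tsum_le_tsum fun n => ?_
      gcongr
      exact rearrangement_mono (fun k => (hg1 k).1) _
    have h1 := ENNReal.rpow_lt_rpow hlt (by positivity : 0 < 1 / p)
    rw [← ENNReal.rpow_mul, mul_one_div_cancel hp.ne', ENNReal.rpow_one] at h1
    exact h1.trans_le (min_le_left _ _)

end Lorentz

/-! ### Greedy sets, truncation, and almost greedy bases -/

section Bases

variable {𝕜 X : Type*} [RCLike 𝕜] [AddCommGroup X] [Module 𝕜 X]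

namespace MarkushevichBasis

variable {q : QuasiNorm 𝕜 X} (B : MarkushevichBasis q) {p : ℝ} {r : X → ℝ}

lemma norm_sgn (a : 𝕜) : ‖sgn a‖ = 1 := by
  unfold sgn
  split_ifs with h
  · simp
  · simp [h]

lemma norm_mul_sgn (a : 𝕜) : ((‖a‖ : ℝ) : 𝕜) * sgn a = a := by
  unfold sgn
  split_ifs with h
  · simp [h]
  · have : ((‖a‖ : ℝ) : 𝕜) ≠ 0 := by simpa using h
    field_simp

lemma coord_sum_smul (a : ℕ → 𝕜) (A : Finset ℕ) (n : ℕ) :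
    B.coord n (∑ k ∈ A, a k • B.vec k) = if n ∈ A then a n else 0 := by
  simp [map_sum, B.biorthogonal]

lemma coord_proj (A : Finset ℕ) (f : X) (n : ℕ) :
    B.coord n (B.proj A f) = if n ∈ A then B.coord n f else 0 :=
  B.coord_sum_smul _ A n

lemma coord_signedSum (ε : ℕ → 𝕜) (A : Finset ℕ) (n : ℕ) :
    B.coord n (B.signedSum ε A) = if n ∈ A then ε n else 0 :=
  B.coord_sum_smul _ A n

lemma proj_add (A : Finset ℕ) (f g : X) : B.proj A (f + g) = B.proj A f + B.proj A g := by
  simp [proj, add_smul, Finset.sum_add_distrib]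

lemma proj_smul (A : Finset ℕ) (t : 𝕜) (f : X) : B.proj A (t • f) = t • B.proj A f := by
  simp [proj, Finset.smul_sum, smul_smul]

lemma proj_sub (A : Finset ℕ) (f g : X) : B.proj A (f - g) = B.proj A f - B.proj A g := by
  simp [proj, sub_smul, Finset.sum_sub_distrib]

lemma proj_sdiff {A D : Finset ℕ} (h : A ⊆ D) (f : X) :
    B.proj (D \ A) f = B.proj D f - B.proj A f := by
  rw [proj, Finset.sum_sdiff_eq_sub h]; rfl

lemma proj_inter_add_sdiff (A D : Finset ℕ) (f : X) :
    B.proj (A ∩ D) f + B.proj (A \ D) f = B.proj A f :=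
  Finset.sum_inter_add_sum_sdiff A D _

lemma proj_congr {A : Finset ℕ} {f g : X} (h : ∀ n ∈ A, B.coord n f = B.coord n g) :
    B.proj A f = B.proj A g :=
  Finset.sum_congr rfl fun n hn => by rw [h n hn]

lemma proj_sum_smul (A E : Finset ℕ) (a : ℕ → 𝕜) :
    B.proj A (∑ k ∈ E, a k • B.vec k) = ∑ k ∈ A ∩ E, a k • B.vec k := by
  simp only [proj, coord_sum_smul, ite_smul, zero_smul, Finset.sum_ite_mem]

lemma exists_norm_coord_le (hM : B.IsMBounded) (hS : B.IsSemiNormalized) :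
    ∃ C : ℝ, 0 < C ∧ ∀ n f, ‖B.coord n f‖ ≤ C * q f := by
  obtain ⟨C, hC⟩ := hM
  obtain ⟨c, _, hc, hcC⟩ := hS
  refine ⟨(|C| + 1) / c, by positivity, fun n f => ?_⟩
  rw [div_mul_eq_mul_div, le_div_iff₀ hc]
  calc ‖B.coord n f‖ * c ≤ ‖B.coord n f‖ * q (B.vec n) := by gcongr; exact (hcC n).1
    _ ≤ C * q f := by rw [mul_comm]; exact hC n f
    _ ≤ (|C| + 1) * q f :=
        mul_le_mul_of_nonneg_right (by linarith [le_abs_self C]) (q.nonneg f)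

lemma exists_proj_eq_of_mem_span {g : X} (hg : g ∈ Submodule.span 𝕜 (Set.range B.vec)) :
    ∃ A₀ : Finset ℕ, ∀ A, A₀ ⊆ A → B.proj A g = g := by
  induction hg using Submodule.span_induction with
  | mem x hx =>
    obtain ⟨k, rfl⟩ := hx
    refine ⟨{k}, fun A hA => ?_⟩
    have hk : k ∈ A := by simpa using hA
    simp [proj, B.biorthogonal, ite_smul, hk]
  | zero => exact ⟨∅, fun A _ => by simp [proj]⟩
  | add x y _ _ hx hy =>
    obtain ⟨A₁, h₁⟩ := hx
    obtain ⟨A₂, h₂⟩ := hy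
    exact ⟨A₁ ∪ A₂, fun A hA => by
      rw [proj_add, h₁ A (Finset.union_subset_left hA), h₂ A (Finset.union_subset_right hA)]⟩
  | smul t x _ hx =>
    obtain ⟨A₁, h₁⟩ := hx
    exact ⟨A₁, fun A hA => by rw [proj_smul, h₁ A hA]⟩

/-- Uniformly bounded functionals and density of the span make the coordinates tend to zero: a
finite combination within `t / C` of `f` has nonzero coordinates at all these indices. -/
lemma finite_setOf_le_norm_coord (hb : ∃ C : ℝ, 0 < C ∧ ∀ n f, ‖B.coord n f‖ ≤ C * q f) (f : X)
    {t : ℝ} (ht : 0 < t) : {n | t ≤ ‖B.coord n f‖}.Finite := by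
  obtain ⟨C, hC0, hC⟩ := hb
  obtain ⟨g, hg, hfg⟩ := B.dense_span f (t / C) (by positivity)
  obtain ⟨A₀, hA₀⟩ := B.exists_proj_eq_of_mem_span hg
  refine A₀.finite_toSet.subset fun n hn => ?_
  by_contra hnA
  have h1 : B.coord n g = 0 := by
    rw [← hA₀ A₀ subset_rfl, coord_proj, if_neg (by simpa using hnA)]
  have h2 : ‖B.coord n f‖ < t := by
    calc ‖B.coord n f‖ = ‖B.coord n (f - g)‖ := by rw [map_sub, h1, sub_zero]
      _ ≤ C * q (f - g) := hC _ _
      _ < C * (t / C) := by gcongr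
      _ = t := by field_simp
  exact (lt_irrefl _) (h2.trans_le hn)

lemma IsStandardGreedySet.isGreedySet {B : MarkushevichBasis q} {f : X} {A : Finset ℕ}
    (h : B.IsStandardGreedySet f A) : B.IsGreedySet f A := by
  intro n hn k hk
  rcases h n hn k hk with h | h
  · exact h.le
  · exact h.1.ge

lemma exists_isStandardGreedySet
    (hb : ∃ C : ℝ, 0 < C ∧ ∀ n f, ‖B.coord n f‖ ≤ C * q f) (f : X) (m : ℕ) :
    ∃ A : Finset ℕ, A.card = m ∧ B.IsStandardGreedySet f A := by
  have hnext : ∀ A : Finset ℕ, ∃ n ∉ A, ∀ k ∉ A, ‖B.coord k f‖ < ‖B.coord n f‖ ∨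
      (‖B.coord n f‖ = ‖B.coord k f‖ ∧ n ≤ k) := by
    intro A
    by_cases h0 : ∀ k ∉ A, ‖B.coord k f‖ = 0
    · have hex : ∃ n, n ∉ A := Infinite.exists_notMem_finset A
      classical
      refine ⟨Nat.find hex, Nat.find_spec hex, fun k hk => Or.inr ⟨?_, Nat.find_min' hex hk⟩⟩
      rw [h0 _ (Nat.find_spec hex), h0 k hk]
    · push Not at h0
      obtain ⟨k₀, hk₀, hk₀f⟩ := h0
      have hpos : 0 < ‖B.coord k₀ f‖ := lt_of_le_of_ne (norm_nonneg _) hk₀f.symm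
      have hfin := B.finite_setOf_le_norm_coord hb f hpos
      set F := hfin.toFinset \ A with hF
      have hmem : ∀ k, k ∈ F ↔ ‖B.coord k₀ f‖ ≤ ‖B.coord k f‖ ∧ k ∉ A := by
        intro k; simp [hF]
      -- The lexicographic order with reversed indices selects the largest modulus and, among ties,
      -- the smallest index.
      obtain ⟨n, hn, hmax⟩ := Finset.exists_max_image F
        (fun k => toLex (‖B.coord k f‖, OrderDual.toDual k)) ⟨k₀, (hmem k₀).2 ⟨le_rfl, hk₀⟩⟩
      refine ⟨n, ((hmem n).1 hn).2, fun k hk => ?_⟩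
      by_cases hkF : k ∈ F
      · have := hmax k hkF
        rw [Prod.Lex.le_iff] at this
        simpa [eq_comm] using this
      · have hlt : ‖B.coord k f‖ < ‖B.coord k₀ f‖ := by
          by_contra hcon
          exact hkF ((hmem k).2 ⟨not_lt.1 hcon, hk⟩)
        exact Or.inl (hlt.trans_le ((hmem n).1 hn).1)
  induction m with
  | zero => exact ⟨∅, rfl, fun n hn => by simp at hn⟩
  | succ m ih =>
    obtain ⟨A, hA, hst⟩ := ih
    obtain ⟨n, hn, hmax⟩ := hnext A
    refine ⟨insert n A, by rw [Finset.card_insert_of_notMem hn, hA], fun j hj k hk => ?_⟩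
    rw [Finset.mem_insert, not_or] at hk
    rcases Finset.mem_insert.1 hj with rfl | hj
    · rcases hmax k hk.2 with h | ⟨h, h'⟩
      · exact Or.inl h
      · exact Or.inr ⟨h, lt_of_le_of_ne h' (Ne.symm hk.1)⟩
    · exact hst j hj k hk.2

/-- Vectors with coefficients bounded by `m` are controlled by sums with coefficients of
modulus one. -/
lemma sum_smul_le_of_signedSum_le (hr : IsPNorm q p r) (E : Finset ℕ) (b : ℕ → 𝕜) {m M : ℝ}
    (hm : 0 ≤ m) (hb : ∀ n ∈ E, ‖b n‖ ≤ m)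
    (hM : ∀ A ⊆ E, r (B.signedSum (fun n => sgn (b n)) A) ≤ M) :
    r (∑ n ∈ E, b n • B.vec n) ≤ m ^ p * (M / (2 ^ p - 1)) := by
  have h2p : (1 : ℝ) < 2 ^ p := Real.one_lt_rpow (by norm_num) hr.p_pos
  rcases hm.eq_or_lt with rfl | hm0
  · have : ∑ n ∈ E, b n • B.vec n = 0 :=
      Finset.sum_eq_zero fun n hn => by
        rw [norm_le_zero_iff.1 (hb n hn), zero_smul]
    rw [this, hr.map_zero, Real.zero_rpow hr.p_pos.ne', zero_mul]
  · have heq : ∑ n ∈ E, b n • B.vec n =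
        ((m : ℝ) : 𝕜) • ∑ n ∈ E, ((‖b n‖ / m : ℝ) : 𝕜) • (sgn (b n) • B.vec n) := by
      rw [Finset.smul_sum]
      refine Finset.sum_congr rfl fun n _ => ?_
      rw [smul_smul, smul_smul, ← RCLike.ofReal_mul, mul_div_cancel₀ _ hm0.ne', norm_mul_sgn]
    rw [heq, hr.smul_real hm]
    gcongr
    refine hr.sum_smul_le_of_subset_sums E _ hM _ fun n hn => ⟨by positivity, ?_⟩
    rw [div_le_one hm0]
    exact hb n hn

lemma truncation_of_nonempty {f : X} {A : Finset ℕ} (h : A.Nonempty) :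
    B.truncation f A = ((A.inf' h (fun n => ‖B.coord n f‖) : ℝ) : 𝕜) •
      B.signedSum (fun n => sgn (B.coord n f)) A := by
  rw [truncation, dif_pos h]; rfl

/-- With all coefficients on `A` of modulus one, ties make every subset greedy. Quasi-greediness
therefore bounds all subset sums of a signed sum. -/
lemma isGreedySet_signedSum {ε : ℕ → 𝕜} (hε : ∀ n, ‖ε n‖ = 1) {A D : Finset ℕ} (h : D ⊆ A) :
    B.IsGreedySet (B.signedSum ε A) D := by
  intro n hn k _
  rw [coord_signedSum, coord_signedSum, if_pos (h hn), hε]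
  split_ifs
  · exact (hε k).le
  · simp

lemma IsQuasiGreedy.exists_proj_le {B : MarkushevichBasis q} (hr : IsPNorm q p r)
    (h : B.IsQuasiGreedy) :
    ∃ C : ℝ, 0 ≤ C ∧ ∀ f A, B.IsGreedySet f A → r (B.proj A f) ≤ C * r f := by
  obtain ⟨C, hC⟩ := h
  obtain ⟨C', hC0, hC'⟩ := hr.exists_le_of_le C
  exact ⟨C', hC0, fun f A hA => hC' _ _ (hC f A hA)⟩

/-- The truncation operators of a quasi-greedy basis are bounded. -/
theorem IsQuasiGreedy.exists_truncation_le {B : MarkushevichBasis q} (hr : IsPNorm q p r)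
    (h : B.IsQuasiGreedy) :
    ∃ C : ℝ, 0 ≤ C ∧ ∀ f A, B.IsGreedySet f A → r (B.truncation f A) ≤ C * r f := by
  obtain ⟨C, hC0, hC⟩ := h.exists_proj_le hr
  have hp := hr.p_pos
  have h2p : (1 : ℝ) < 2 ^ p := Real.one_lt_rpow (by norm_num) hp
  have h2p' : (0 : ℝ) < 2 ^ p - 1 := by linarith
  -- The smallness of `δ` makes the error term at the end at most half of the quantity being
  -- estimated.
  set δ : ℝ := ((2 ^ p - 1) / (2 * (C + 1))) ^ (1 / p) with hδ
  have hδ0 : 0 < δ := by positivity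
  have hδp : δ ^ p * (C / (2 ^ p - 1)) ≤ 1 / 2 := by
    rw [hδ, ← Real.rpow_mul (by positivity), one_div_mul_cancel hp.ne', Real.rpow_one]
    rw [div_mul_div_comm, div_le_div_iff₀ (by positivity) (by positivity)]
    nlinarith
  -- The greedy set is cut into layers where `|x_n^*(f)| / m` lies in `[l^j, l^{j+1})`. The ratio is
  -- close to one, so rescaled layers are nearly flat, and exceeds one, so the scalings `l^{-jp} =
  -- ρ^j` are summable.
  set l : ℝ := 1 + δ with hl
  have hl1 : 1 < l := by linarith
  have hl0 : 0 < l := by linarith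
  set ρ : ℝ := (l ^ p)⁻¹ with hρ
  have hρ0 : 0 ≤ ρ := by positivity
  have hρ1 : ρ < 1 := inv_lt_one_of_one_lt₀ (Real.one_lt_rpow hl1 hp)
  refine ⟨2 * ((1 - ρ)⁻¹ * (2 * C)), ?_, fun f A hA => ?_⟩
  · have : 0 < 1 - ρ := by linarith
    positivity
  have hrf := hr.nonneg f
  have hRHS : 0 ≤ 2 * ((1 - ρ)⁻¹ * (2 * C)) * r f := by
    have : 0 < 1 - ρ := by linarith
    positivity
  rcases A.eq_empty_or_nonempty with rfl | hne
  · simpa [truncation, hr.map_zero] using hRHS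
  rw [truncation_of_nonempty B hne]
  set m := A.inf' hne (fun n => ‖B.coord n f‖) with hm
  set ε : ℕ → 𝕜 := fun n => sgn (B.coord n f) with hε
  have hε1 : ∀ n, ‖ε n‖ = 1 := fun n => norm_sgn _
  have hm0 : 0 ≤ m := Finset.le_inf' _ _ fun n _ => norm_nonneg _
  rw [hr.smul_real hm0]
  rcases hm0.eq_or_lt with h0 | hmpos
  · rw [← h0, Real.zero_rpow hp.ne', zero_mul]; exact hRHS
  have hmle : ∀ n ∈ A, m ≤ ‖B.coord n f‖ := fun n hn => Finset.inf'_le _ hn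
  set N := r (B.signedSum ε A) with hN
  have hsub : ∀ D ⊆ A, r (B.signedSum ε D) ≤ C * N := by
    intro D hD
    have h1 := hC _ _ (B.isGreedySet_signedSum hε1 hD)
    rwa [signedSum, proj_sum_smul, Finset.inter_eq_left.2 hD] at h1
  have hk : ∀ n, ∃ k : ℕ, n ∈ A → l ^ k ≤ ‖B.coord n f‖ / m ∧ ‖B.coord n f‖ / m < l ^ (k + 1) := by
    intro n
    by_cases hn : n ∈ A
    · obtain ⟨k, hk⟩ := exists_nat_pow_near (x := ‖B.coord n f‖ / m)
        (by rw [one_le_div hmpos]; exact hmle n hn) hl1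
      exact ⟨k, fun _ => hk⟩
    · exact ⟨0, fun h => absurd h hn⟩
  choose k hk using hk
  -- A layer is the difference of two nested greedy sets of `f`.
  have hlayer : ∀ j, r (B.proj (A.filter fun n => k n = j) f) ≤ 2 * C * r f := by
    intro j
    set T : ℕ → Finset ℕ := fun j => A.filter fun n => l ^ j ≤ ‖B.coord n f‖ / m with hT
    have hgr : ∀ j, B.IsGreedySet f (T j) := by
      intro j n hn i hi
      simp only [hT, Finset.mem_filter, not_and, not_le] at hn hi
      by_cases hiA : i ∈ A
      · have h1 := (hi hiA).le.trans hn.2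
        exact (div_le_div_iff_of_pos_right hmpos).1 h1
      · exact hA n hn.1 i hiA
    have heq : (A.filter fun n => k n = j) = T j \ T (j + 1) := by
      ext n
      simp only [hT, Finset.mem_filter, Finset.mem_sdiff, not_and, not_le]
      constructor
      · rintro ⟨hn, rfl⟩
        exact ⟨⟨hn, (hk n hn).1⟩, fun _ => (hk n hn).2⟩
      · rintro ⟨⟨hn, h1⟩, h2⟩
        have h3 := (pow_lt_pow_iff_right₀ hl1).1 (h1.trans_lt (hk n hn).2)
        have h4 := (pow_lt_pow_iff_right₀ hl1).1 ((hk n hn).1.trans_lt (h2 hn))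
        exact ⟨hn, by omega⟩
    have hTT : T (j + 1) ⊆ T j := by
      intro n hn
      simp only [hT, Finset.mem_filter] at hn ⊢
      exact ⟨hn.1, (pow_le_pow_right₀ hl1.le (Nat.le_succ j)).trans hn.2⟩
    rw [heq, B.proj_sdiff hTT]
    refine (hr.sub_le _ _).trans ?_
    linarith [hC f _ (hgr j), hC f _ (hgr (j + 1))]
  -- Scaling the `j`-th layer by `l^{-j}` brings all its moduli into `[m, l m)`. Thus `g` is close
  -- to the truncation, and its bound is a geometric series of layer bounds.
  set g : X := ∑ n ∈ A, ((((l ^ k n)⁻¹ : ℝ)) : 𝕜) • (B.coord n f • B.vec n) with hg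
  have hgle : r g ≤ (1 - ρ)⁻¹ * (2 * C) * r f := by
    have h1 : g = ∑ j ∈ A.image k, (((l ^ j)⁻¹ : ℝ) : 𝕜) • B.proj (A.filter fun n => k n = j) f := by
      rw [hg, ← Finset.sum_fiberwise_of_maps_to (g := k) (t := A.image k)
        (fun n hn => Finset.mem_image_of_mem k hn)]
      refine Finset.sum_congr rfl fun j _ => ?_
      rw [proj, Finset.smul_sum]
      refine Finset.sum_congr rfl fun n hn => ?_
      rw [(Finset.mem_filter.1 hn).2]
    rw [h1]
    calc _ ≤ ∑ j ∈ A.image k, ρ ^ j * (2 * C * r f) := by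
          refine (hr.sum_le _ _).trans (Finset.sum_le_sum fun j _ => ?_)
          rw [hr.smul_real (by positivity)]
          have h2 : ((l ^ j)⁻¹ : ℝ) ^ p = ρ ^ j := by
            rw [Real.inv_rpow (by positivity), hρ, inv_pow, ← Real.rpow_natCast, ← Real.rpow_natCast,
              ← Real.rpow_mul hl0.le, ← Real.rpow_mul hl0.le, mul_comm]
          rw [h2]
          gcongr
          exact hlayer j
      _ = (∑ j ∈ A.image k, ρ ^ j) * (2 * C * r f) := by rw [Finset.sum_mul]
      _ ≤ (1 - ρ)⁻¹ * (2 * C * r f) := by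
          gcongr
          rw [← tsum_geometric_of_lt_one hρ0 hρ1]
          exact (summable_geometric_of_lt_one hρ0 hρ1).sum_le_tsum _ fun j _ => by positivity
      _ = _ := by ring
  -- The modulus of the `n`-th coefficient of `g` is `m (1 + δ θ n)` with `θ n` in `[0, 1]`. The
  -- excess over the truncation is hence `m δ` times a sum controlled by the subset sums of the
  -- signed sum.
  set θ : ℕ → ℝ := fun n => (‖B.coord n f‖ / m * (l ^ k n)⁻¹ - 1) / δ with hθ
  have hθ01 : ∀ n ∈ A, 0 ≤ θ n ∧ θ n ≤ 1 := by
    intro n hn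
    obtain ⟨h1, h2⟩ := hk n hn
    have hlk : 0 < l ^ k n := by positivity
    have h3 : 1 ≤ ‖B.coord n f‖ / m * (l ^ k n)⁻¹ := by
      rw [← div_eq_mul_inv, one_le_div hlk]; exact h1
    have h4 : ‖B.coord n f‖ / m * (l ^ k n)⁻¹ ≤ l := by
      rw [← div_eq_mul_inv, div_le_iff₀ hlk, ← pow_succ']; exact h2.le
    simp only [hθ]
    exact ⟨div_nonneg (by linarith) hδ0.le, by rw [div_le_one hδ0]; linarith⟩
  have hdecomp : ((m : ℝ) : 𝕜) • B.signedSum ε A =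
      g - ((m * δ : ℝ) : 𝕜) • ∑ n ∈ A, ((θ n : ℝ) : 𝕜) • (ε n • B.vec n) := by
    rw [signedSum, hg, Finset.smul_sum, Finset.smul_sum, ← Finset.sum_sub_distrib]
    refine Finset.sum_congr rfl fun n _ => ?_
    rw [← norm_mul_sgn (B.coord n f)]
    simp only [smul_smul]
    rw [← sub_smul]
    congr 1
    have h1 : (l ^ k n)⁻¹ * ‖B.coord n f‖ - m * δ * θ n = m := by
      simp only [hθ]
      field_simp
      ring
    change ((m : ℝ) : 𝕜) * ε n = _ * (_ * ε n) - _ * (_ * ε n)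
    rw [← mul_assoc, ← mul_assoc, ← sub_mul]
    congr 1
    rw [← RCLike.ofReal_mul, ← RCLike.ofReal_mul, ← RCLike.ofReal_sub, h1]
  have hmain : m ^ p * N ≤ r g + (m * δ) ^ p * (C * N / (2 ^ p - 1)) := by
    rw [hN, ← hr.smul_real hm0, hdecomp]
    refine (hr.sub_le _ _).trans ?_
    rw [hr.smul_real (by positivity)]
    gcongr
    exact hr.sum_smul_le_of_subset_sums A (fun n => ε n • B.vec n) hsub θ hθ01
  have hN0 : 0 ≤ m ^ p * N := mul_nonneg (by positivity) (hr.nonneg _)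
  have h5 : (m * δ) ^ p * (C * N / (2 ^ p - 1)) = (δ ^ p * (C / (2 ^ p - 1))) * (m ^ p * N) := by
    rw [Real.mul_rpow hm0 hδ0.le]; ring
  -- Both sides now contain `m ^ p * N`, on the right with a factor at most one half, so that term
  -- is absorbed.
  rw [h5] at hmain
  have h6 := mul_le_mul_of_nonneg_right hδp hN0
  linarith

lemma IsSuperDemocratic.exists_signedSum_le {B : MarkushevichBasis q} (hr : IsPNorm q p r)
    (h : B.IsSuperDemocratic) :
    ∃ C : ℝ, 0 ≤ C ∧ ∀ (A D : Finset ℕ) (ε δ : ℕ → 𝕜), A.card ≤ D.card →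
      (∀ n, ‖ε n‖ = 1) → (∀ n, ‖δ n‖ = 1) → r (B.signedSum ε A) ≤ C * r (B.signedSum δ D) := by
  obtain ⟨C, -, hC⟩ := h
  obtain ⟨C', hC0, hC'⟩ := hr.exists_le_of_le C
  exact ⟨C', hC0, fun A D ε δ hAD hε hδ => hC' _ _ (hC A D ε δ hAD hε hδ)⟩

lemma IsAlmostGreedy.isQuasiGreedy {B : MarkushevichBasis q} (h : B.IsAlmostGreedy) :
    B.IsQuasiGreedy := by
  obtain ⟨C, hC1, hC⟩ := h
  obtain ⟨κ, hκ, hadd⟩ := q.add_le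
  refine ⟨κ * (1 + C), fun f A hA => ?_⟩
  have h1 := hC f A ∅ hA (by simp)
  have h2 := hadd f (-(f - B.proj A f))
  rw [q.map_neg, neg_sub, add_sub_cancel] at h2
  simp only [proj, Finset.sum_empty, sub_zero] at h1 h2 ⊢
  calc _ ≤ _ := h2
    _ ≤ κ * (q f + C * q f) := by gcongr
    _ = _ := by ring

lemma IsGreedy.isAlmostGreedy {B : MarkushevichBasis q} (h : B.IsGreedy) :
    B.IsAlmostGreedy := by
  obtain ⟨C, hC1, hC⟩ := h
  refine ⟨C, hC1, fun f A D hA hDA => hC f (B.proj D f) A hA ?_⟩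
  have hsub : B.support (B.proj D f) ⊆ D := by
    intro n hn
    by_contra hnD
    exact hn (by rw [coord_proj, if_neg (by simpa using hnD)])
  refine (Set.encard_le_encard hsub).trans ?_
  rw [Set.encard_coe_eq_coe_finsetCard]
  exact_mod_cast hDA

/-- For disjoint `A` and `D`, take `f = 1_{ε,A} + 1_{δ,D}`: the set `D` is greedy, removing it
leaves the first summand, and removing `A` leaves the second. In general compare through a third set
disjoint from both, at the cost of squaring the constant. -/
theorem IsAlmostGreedy.isSuperDemocratic {B : MarkushevichBasis q} (h : B.IsAlmostGreedy) :
    B.IsSuperDemocratic := by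
  obtain ⟨C, hC1, hC⟩ := h
  have hdisj : ∀ (A D : Finset ℕ) (ε δ : ℕ → 𝕜), Disjoint A D → A.card ≤ D.card →
      (∀ n, ‖ε n‖ = 1) → (∀ n, ‖δ n‖ = 1) → q (B.signedSum ε A) ≤ C * q (B.signedSum δ D) := by
    intro A D ε δ hAD hcard hε hδ
    have hgr : B.IsGreedySet (B.signedSum ε A + B.signedSum δ D) D := by
      intro n hn k hk
      have hnA : n ∉ A := Finset.disjoint_right.1 hAD hn
      simp only [map_add, coord_signedSum, hn, hnA, hk, if_true, if_false, zero_add, add_zero, hδ]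
      split_ifs
      · exact (hε k).le
      · simp
    have h1 := hC _ D A hgr hcard
    have h2 : B.proj D (B.signedSum ε A + B.signedSum δ D) = B.signedSum δ D := by
      rw [proj_add, signedSum, signedSum, proj_sum_smul, proj_sum_smul,
        Finset.disjoint_iff_inter_eq_empty.1 hAD.symm, Finset.inter_self]
      simp
    have h3 : B.proj A (B.signedSum ε A + B.signedSum δ D) = B.signedSum ε A := by
      rw [proj_add, signedSum, signedSum, proj_sum_smul, proj_sum_smul,
        Finset.disjoint_iff_inter_eq_empty.1 hAD, Finset.inter_self]
      simp
    rwa [h2, h3, add_sub_cancel_right, add_sub_cancel_left] at h1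
  refine ⟨C * C, by nlinarith, fun A D ε δ hcard hε hδ => ?_⟩
  obtain ⟨E, hE, hEcard⟩ := ((A ∪ D).finite_toSet.infinite_compl).exists_subset_card_eq A.card
  have hEA : Disjoint A E := Finset.disjoint_right.2 fun n hn hnA =>
    hE hn (by simp [hnA])
  have hED : Disjoint E D := Finset.disjoint_left.2 fun n hn hnD =>
    hE hn (by simp [hnD])
  have h1 := hdisj A E ε (fun _ => 1) hEA hEcard.ge hε (by simp)
  have h2 := hdisj E D (fun _ => 1) δ hED (hEcard.le.trans hcard) (by simp) hδ
  calc _ ≤ C * q (B.signedSum (fun _ => 1) E) := h1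
    _ ≤ C * (C * q (B.signedSum δ D)) := by gcongr
    _ = _ := by ring

/-- With `g = f - S_D(f)`, the error is `g - S_{A \ D}(g) + S_{D \ A}(f)`, and `A \ D` is greedy for
`g`. Quasi-greediness bounds the first part. In the last term the coefficients are at most the
minimum of those of `g` on `A \ D`, a set at least as large as `D \ A`, so super-democracy compares
the term with a truncation of `g`. -/
theorem IsQuasiGreedy.isAlmostGreedy {B : MarkushevichBasis q} (h : B.IsQuasiGreedy)
    (hsd : B.IsSuperDemocratic) : B.IsAlmostGreedy := by
  obtain ⟨p, r, hr⟩ := q.exists_isPNorm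
  have h2p : (1 : ℝ) < 2 ^ p := Real.one_lt_rpow (by norm_num) hr.p_pos
  have h2p' : (0 : ℝ) < 2 ^ p - 1 := by linarith
  obtain ⟨C₁, hC₁0, hC₁⟩ := h.exists_proj_le hr
  obtain ⟨C₂, hC₂0, hC₂⟩ := h.exists_truncation_le hr
  obtain ⟨C₃, hC₃0, hC₃⟩ := hsd.exists_signedSum_le hr
  obtain ⟨C, hC1, hC⟩ := hr.exists_le_of_le' (1 + C₁ + C₃ / (2 ^ p - 1) * C₂)
  refine ⟨C, hC1, fun f A D hA hDA => hC _ _ ?_⟩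
  set g := f - B.proj D f with hg
  have hgc : ∀ n, B.coord n g = if n ∈ D then 0 else B.coord n f := by
    intro n
    rw [hg, map_sub, coord_proj]
    split_ifs <;> simp
  have hgr : B.IsGreedySet g (A \ D) := by
    intro n hn k hk
    rw [Finset.mem_sdiff] at hn hk
    rw [hgc, hgc, if_neg hn.2]
    split_ifs with hkD
    · simp
    · exact hA n hn.1 k fun hkA => hk ⟨hkA, hkD⟩
  have hdecomp : f - B.proj A f = g - B.proj (A \ D) g + B.proj (D \ A) f := by
    have h1 : B.proj (A \ D) g = B.proj (A \ D) f :=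
      B.proj_congr fun n hn => by rw [hgc, if_neg (Finset.mem_sdiff.1 hn).2]
    rw [h1, hg, ← B.proj_inter_add_sdiff A D f, ← B.proj_inter_add_sdiff D A f, Finset.inter_comm D A]
    abel
  have hcard : (D \ A).card ≤ (A \ D).card := by
    have h1 := Finset.card_sdiff_add_card_inter D A
    have h2 := Finset.card_sdiff_add_card_inter A D
    rw [Finset.inter_comm] at h1
    omega
  have hlast : r (B.proj (D \ A) f) ≤ C₃ / (2 ^ p - 1) * C₂ * r g := by
    rcases (A \ D).eq_empty_or_nonempty with he | hne
    · have : D \ A = ∅ := Finset.card_eq_zero.1 (by rw [he] at hcard; simpa using hcard)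
      rw [this, proj, Finset.sum_empty, hr.map_zero]
      have := hr.nonneg g
      positivity
    · have h1 := hC₂ g _ hgr
      rw [truncation_of_nonempty B hne] at h1
      set m := (A \ D).inf' hne (fun n => ‖B.coord n g‖) with hm
      have hm0 : 0 ≤ m := Finset.le_inf' _ _ fun n _ => norm_nonneg _
      rw [hr.smul_real hm0] at h1
      set N := r (B.signedSum (fun n => sgn (B.coord n g)) (A \ D)) with hN
      have h2 := B.sum_smul_le_of_signedSum_le hr (D \ A) (fun n => B.coord n f) (M := C₃ * N) hm0
        (fun n hn => Finset.le_inf' _ _ fun k hk => by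
          rw [Finset.mem_sdiff] at hn hk
          rw [hgc, if_neg hk.2]
          exact hA k hk.1 n hn.2)
        (fun E hE => hC₃ _ _ _ _ ((Finset.card_le_card hE).trans hcard) (fun n => norm_sgn _)
          (fun n => norm_sgn _))
      calc _ ≤ _ := h2
        _ = C₃ / (2 ^ p - 1) * (m ^ p * N) := by ring
        _ ≤ C₃ / (2 ^ p - 1) * (C₂ * r g) := by gcongr
        _ = _ := by ring
  rw [hdecomp]
  have h1 := hr.add_le (g - B.proj (A \ D) g) (B.proj (D \ A) f)
  have h2 := hr.sub_le g (B.proj (A \ D) g)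
  have h3 := hC₁ g _ hgr
  linarith

end MarkushevichBasis

end Bases

/-! ### Unconditional bases and their relation to greedy bases -/

section Unconditional

/-- A chain of finite sets exhausting `ℕ` consists of the images of initial segments under some
permutation. -/
lemma exists_perm_image_range_eq (F : ℕ → Finset ℕ) (h0 : F 0 = ∅) (hmono : ∀ j, F j ⊆ F (j + 1))
    (hmem : ∀ j, j ∈ F (j + 1)) :
    ∃ π : Equiv.Perm ℕ, ∀ j, (Finset.range (F j).card).image π = F j := by
  classical
  -- Each list appends the new elements and is a prefix of the next, so the entry at a given
  -- position never changes once it exists.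
  let L : ℕ → List ℕ := fun j =>
    Nat.rec [] (fun i l => l ++ (F (i + 1) \ F i).toList) j
  have hLsucc : ∀ j, L (j + 1) = L j ++ (F (j + 1) \ F j).toList := fun j => rfl
  have hmemL : ∀ j x, x ∈ L j ↔ x ∈ F j := by
    intro j
    induction j with
    | zero => intro x; simp [h0, L]
    | succ j ih =>
      intro x
      rw [hLsucc, List.mem_append, ih, Finset.mem_toList, Finset.mem_sdiff]
      constructor
      · rintro (h | h)
        · exact hmono j h
        · exact h.1
      · intro h
        by_cases hx : x ∈ F j
        · exact Or.inl hx
        · exact Or.inr ⟨h, hx⟩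
  have hnodup : ∀ j, (L j).Nodup := by
    intro j
    induction j with
    | zero => simp [L]
    | succ j ih =>
      rw [hLsucc]
      refine ih.append (Finset.nodup_toList _) fun x hx hx' => ?_
      rw [Finset.mem_toList, Finset.mem_sdiff] at hx'
      exact hx'.2 ((hmemL j x).1 hx)
  have hFL : ∀ j, F j = (L j).toFinset := fun j => by
    ext x; rw [List.mem_toFinset, hmemL]
  have hlen : ∀ j, (F j).card = (L j).length := fun j => by
    rw [hFL, List.toFinset_card_of_nodup (hnodup j)]
  have hFmono : Monotone F := monotone_nat_of_le_succ hmono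
  have hcard : ∀ j, j ≤ (L j).length := fun j => by
    rw [← hlen]
    calc j = (Finset.range j).card := (Finset.card_range j).symm
      _ ≤ _ := Finset.card_le_card fun i hi => hFmono (Finset.mem_range.1 hi) (hmem i)
  have hprefix : ∀ i j, i ≤ j → L i <+: L j := by
    intro i j hij
    induction hij with
    | refl => exact List.prefix_refl _
    | step _ ih => exact ih.trans ⟨_, (hLsucc _).symm⟩
  -- The default value is never used: `hmem` makes `L (i + 1)` at least `i + 1` long.
  set π : ℕ → ℕ := fun i => (L (i + 1)).getD i 0 with hπ
  have hπL : ∀ i j (h : i < (L j).length), π i = (L j)[i] := by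
    intro i j h
    have hi : i < (L (i + 1)).length := hcard (i + 1)
    have h1 : π i = (L (i + 1))[i] := by simp [hπ, List.getD, List.getElem?_eq_getElem hi]
    rw [h1]
    rcases le_total (i + 1) j with h' | h'
    · exact (hprefix _ _ h').getElem hi
    · exact ((hprefix _ _ h').getElem h).symm
  have himg : ∀ j, (Finset.range (F j).card).image π = F j := by
    intro j
    ext x
    rw [Finset.mem_image, ← hmemL, List.mem_iff_getElem]
    constructor
    · rintro ⟨i, hi, rfl⟩
      rw [Finset.mem_range, hlen] at hi
      exact ⟨i, hi, (hπL i j hi).symm⟩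
    · rintro ⟨i, hi, rfl⟩
      exact ⟨i, by rwa [Finset.mem_range, hlen], hπL i j hi⟩
  have hinj : Function.Injective π := by
    intro i i' h
    have h1 : i < (L (max i i' + 1)).length :=
      lt_of_lt_of_le (by omega) (hcard (max i i' + 1))
    have h2 : i' < (L (max i i' + 1)).length :=
      lt_of_lt_of_le (by omega) (hcard (max i i' + 1))
    rw [hπL i (max i i' + 1) h1, hπL i' (max i i' + 1) h2] at h
    exact ((hnodup (max i i' + 1)).getElem_inj_iff).1 h
  have hsurj : Function.Surjective π := by
    intro x
    have h1 := hmem x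
    rw [← himg, Finset.mem_image] at h1
    obtain ⟨i, -, hi⟩ := h1
    exact ⟨i, hi⟩
  exact ⟨Equiv.ofBijective π ⟨hinj, hsurj⟩, himg⟩

variable {𝕜 X : Type*} [RCLike 𝕜] [AddCommGroup X] [Module 𝕜 X]

namespace IsPNorm

variable {q : QuasiNorm 𝕜 X} {p : ℝ} {r : X → ℝ} (hr : IsPNorm q p r)

include hr

lemma eq_zero_of_map_eq_zero {f : X} (h : r f = 0) : f = 0 := by
  obtain ⟨K, -, hK⟩ := hr.rpow_le
  by_contra hf
  have h1 : 0 < q f ^ p := Real.rpow_pos_of_pos (q.pos f hf) p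
  have h2 := hK f
  rw [h, mul_zero] at h2
  exact h2.not_gt h1

lemma convergesTo_unique {u : ℕ → X} {f g : X} (hf : q.ConvergesTo u f) (hg : q.ConvergesTo u g) :
    f = g := by
  rw [hr.convergesTo_iff] at hf hg
  have h1 : r (f - g) ≤ 0 := by
    have h2 := hf.add hg
    rw [add_zero] at h2
    refine ge_of_tendsto' h2 fun k => ?_
    have := hr.sub_le (u k - g) (u k - f)
    rw [sub_sub_sub_cancel_left] at this
    linarith
  exact sub_eq_zero.1 (hr.eq_zero_of_map_eq_zero (le_antisymm h1 (hr.nonneg _)))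

/-- A uniform boundedness principle for a pointwise bounded family of bounded linear operators. -/
theorem exists_uniform_bound (hq : q.IsComplete) {ι : Type*} (T : ι → X →ₗ[𝕜] X)
    (hT : ∀ i, ∃ C : ℝ, ∀ f, r (T i f) ≤ C * r f) (hpt : ∀ f, ∃ M : ℝ, ∀ i, r (T i f) ≤ M) :
    ∃ C : ℝ, ∀ i f, r (T i f) ≤ C * r f := by
  -- `r` is not homogeneous of degree one, but it is a norm on the additive group. The category
  -- argument needs no more; scalars enter only in the final rescaling.
  let G : AddGroupNorm X :=
    { toFun := r
      map_zero' := hr.map_zero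
      add_le' := hr.add_le
      neg' := hr.map_neg
      eq_zero_of_map_eq_zero' := fun _ h => hr.eq_zero_of_map_eq_zero h }
  let _ : NormedAddCommGroup X := G.toNormedAddCommGroup
  have hnorm : ∀ f : X, ‖f‖ = r f := fun f => rfl
  have hcomplete : CompleteSpace X := by
    refine Metric.complete_of_cauchySeq_tendsto fun u hu => ?_
    obtain ⟨f, hf⟩ := hr.exists_convergesTo hq (u := u) fun ε hε => by
      obtain ⟨N, hN⟩ := Metric.cauchySeq_iff.1 hu ε hε
      exact ⟨N, fun i hi j hj => by simpa [dist_eq_norm, hnorm] using hN i hi j hj⟩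
    refine ⟨f, tendsto_iff_norm_sub_tendsto_zero.2 ?_⟩
    exact hr.convergesTo_iff.1 hf
  set F : ℕ → Set X := fun N => {f | ∀ i, r (T i f) ≤ N} with hF
  have hcont : ∀ i, Continuous fun f => r (T i f) := by
    intro i
    obtain ⟨C, hC⟩ := hT i
    have : Continuous (T i) := AddMonoidHomClass.continuous_of_bound (T i) C hC
    exact continuous_norm.comp this
  have hclosed : ∀ N, IsClosed (F N) := by
    intro N
    have : F N = ⋂ i, {f | r (T i f) ≤ N} := by ext f; simp [hF]
    rw [this]
    exact isClosed_iInter fun i => isClosed_le (hcont i) continuous_const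
  have hunion : ⋃ N, F N = Set.univ := by
    refine Set.eq_univ_of_forall fun f => Set.mem_iUnion.2 ?_
    obtain ⟨M, hM⟩ := hpt f
    obtain ⟨N, hN⟩ := exists_nat_ge M
    exact ⟨N, fun i => (hM i).trans hN⟩
  obtain ⟨N, f₀, hf₀⟩ := nonempty_interior_of_iUnion_of_closed hclosed hunion
  obtain ⟨s, hs, hball⟩ := Metric.isOpen_iff.1 isOpen_interior f₀ hf₀
  have hsmall : ∀ g, r g < s → ∀ i, r (T i g) ≤ 2 * N := by
    intro g hg i
    have h1 : f₀ + g ∈ F N := interior_subset (hball (by simpa [dist_eq_norm, hnorm] using hg))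
    have h2 : f₀ ∈ F N := interior_subset hf₀
    have h3 := hr.sub_le (T i (f₀ + g)) (T i f₀)
    rw [← map_sub, add_sub_cancel_left] at h3
    linarith [h1 i, h2 i]
  have hp := hr.p_pos
  refine ⟨2 * N * (2 / s), fun i f => ?_⟩
  rcases (hr.nonneg f).eq_or_lt with h0 | hpos
  · rw [hr.eq_zero_of_map_eq_zero h0.symm, _root_.map_zero, hr.map_zero, mul_zero]
  -- This scaling gives `r (t f) = s / 2`, inside the ball where the operators are bounded by `2 N`.
  · set t : ℝ := (s / (2 * r f)) ^ (1 / p) with ht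
    have ht0 : 0 < t := by positivity
    have htp : t ^ p = s / (2 * r f) := by
      rw [ht, ← Real.rpow_mul (by positivity), one_div_mul_cancel hp.ne', Real.rpow_one]
    have h1 := hsmall ((t : 𝕜) • f) (by
      rw [hr.smul_real ht0.le, htp]
      field_simp
      norm_num) i
    rw [map_smul, hr.smul_real ht0.le, htp, div_mul_eq_mul_div, div_le_iff₀ (by positivity)] at h1
    rw [show 2 * (N : ℝ) * (2 / s) * r f = 2 * N * (2 * r f) / s by ring, le_div_iff₀ hs]
    linarith

end IsPNorm

namespace MarkushevichBasis

variable {q : QuasiNorm 𝕜 X} (B : MarkushevichBasis q) {p : ℝ} {r : X → ℝ}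

/-- The coordinate projections as linear maps. -/
noncomputable def projLinear (A : Finset ℕ) : X →ₗ[𝕜] X where
  toFun := B.proj A
  map_add' := B.proj_add A
  map_smul' := B.proj_smul A

lemma exists_proj_le_of_isPNorm (hr : IsPNorm q p r) (A : Finset ℕ) :
    ∃ C : ℝ, ∀ f, r (B.proj A f) ≤ C * r f := by
  have h1 : ∀ n, ∃ C : ℝ, ∀ f, r (B.coord n f • B.vec n) ≤ C * r f := by
    intro n
    obtain ⟨C, hC⟩ := B.coord_bounded n
    obtain ⟨C', -, hC'⟩ := hr.exists_le_of_le (C * q (B.vec n))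
    refine ⟨C', fun f => hC' _ _ ?_⟩
    rw [q.smul]
    calc _ ≤ C * q f * q (B.vec n) := mul_le_mul_of_nonneg_right (hC f) (q.nonneg _)
      _ = _ := by ring
  choose C hC using h1
  refine ⟨∑ n ∈ A, C n, fun f => ?_⟩
  rw [Finset.sum_mul]
  exact (hr.sum_le _ _).trans (Finset.sum_le_sum fun n _ => hC n f)

lemma tendsto_coord {u : ℕ → X} {f : X} (h : q.ConvergesTo u f) (n : ℕ) :
    Tendsto (fun k => B.coord n (u k)) atTop (𝓝 (B.coord n f)) := by
  obtain ⟨C, hC⟩ := B.coord_bounded n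
  rw [tendsto_iff_norm_sub_tendsto_zero]
  have h1 : Tendsto (fun k => C * q (u k - f)) atTop (𝓝 0) := by
    simpa using Tendsto.const_mul C (show Tendsto (fun k => q (u k - f)) atTop (𝓝 0) from h)
  refine squeeze_zero (fun _ => norm_nonneg _) (fun k => ?_) h1
  rw [← map_sub]
  exact hC _

lemma sum_range_perm (a : ℕ → 𝕜) (π : Equiv.Perm ℕ) (N : ℕ) :
    ∑ n ∈ Finset.range N, a (π n) • B.vec (π n) =
      ∑ n ∈ (Finset.range N).image π, a n • B.vec n :=
  (Finset.sum_image (f := fun n => a n • B.vec n) π.injective.injOn).symm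

lemma eventually_subset_image_range (A : Finset ℕ) (π : Equiv.Perm ℕ) :
    ∀ᶠ N in atTop, A ⊆ (Finset.range N).image π := by
  obtain ⟨N, hN⟩ := (A.image π.symm).exists_nat_subset_range
  filter_upwards [eventually_ge_atTop N] with M hM n hn
  refine Finset.mem_image.2 ⟨π.symm n, ?_, by simp⟩
  have h1 := Finset.mem_range.1 (hN (Finset.mem_image_of_mem π.symm hn))
  exact Finset.mem_range.2 (h1.trans_le hM)

lemma eq_coord_of_convergesTo {a : ℕ → 𝕜} {f : X} (π : Equiv.Perm ℕ)
    (h : q.ConvergesTo (fun N => ∑ n ∈ Finset.range N, a (π n) • B.vec (π n)) f) (n : ℕ) :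
    a n = B.coord n f := by
  refine tendsto_nhds_unique ?_ (B.tendsto_coord h n)
  refine tendsto_const_nhds.congr' ?_
  filter_upwards [eventually_subset_image_range {n} π] with N hN
  rw [sum_range_perm, coord_sum_smul, if_pos (hN (Finset.mem_singleton_self n))]

lemma IsUnconditional.convergesTo {B : MarkushevichBasis q} (h : B.IsUnconditional) (f : X)
    (π : Equiv.Perm ℕ) :
    q.ConvergesTo (fun N => B.proj ((Finset.range N).image π) f) f := by
  obtain ⟨a, ha, -⟩ := h f
  have h1 : a = fun n => B.coord n f := funext fun n => B.eq_coord_of_convergesTo 1 (ha 1) n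
  have h2 := ha π
  simp only [sum_range_perm] at h2
  rw [h1] at h2
  exact h2

/-- The coordinate projections of an unconditional basis are pointwise bounded. -/
lemma IsUnconditional.exists_proj_apply_le {B : MarkushevichBasis q} (h : B.IsUnconditional)
    (hr : IsPNorm q p r) (f : X) : ∃ M : ℝ, ∀ A, r (B.proj A f) ≤ M := by
  by_contra! hcon
  set c : Finset ℕ → ℝ := fun F => ∑ n ∈ F, r (B.coord n f • B.vec n) with hc
  have hproj_le : ∀ F : Finset ℕ, r (B.proj F f) ≤ c F := fun F => hr.sum_le _ _
  have hc_mono : ∀ {F G : Finset ℕ}, F ⊆ G → c F ≤ c G := fun hFG =>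
    Finset.sum_le_sum_of_subset_of_nonneg hFG fun _ _ _ => hr.nonneg _
  -- Projections onto subsets of a fixed finite set are bounded by `c`, so a sufficiently large
  -- projection elsewhere forces a jump of more than one when it is adjoined to `F`.
  have hnext : ∀ (F : Finset ℕ) (j : ℕ), ∃ G, F ⊆ G ∧ j ∈ G ∧ 1 < r (B.proj G f - B.proj F f) := by
    intro F j
    set F' := insert j F with hF'
    obtain ⟨A, hA⟩ := hcon (1 + 2 * c F')
    refine ⟨A ∪ F', (Finset.subset_insert j F).trans Finset.subset_union_right,
      Finset.mem_union_right _ (Finset.mem_insert_self j F), ?_⟩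
    have h1 : B.proj A f = B.proj (A ∪ F') f - B.proj F f - (B.proj (F' \ A) f - B.proj F f) := by
      have : B.proj (F' \ A) f = B.proj (A ∪ F') f - B.proj A f := by
        rw [← B.proj_sdiff Finset.subset_union_left, Finset.union_sdiff_left]
      rw [this]; abel
    have h2 := hr.sub_le (B.proj (A ∪ F') f - B.proj F f) (B.proj (F' \ A) f - B.proj F f)
    rw [← h1] at h2
    have h3 := hr.sub_le (B.proj (F' \ A) f) (B.proj F f)
    have h4 := (hproj_le F).trans (hc_mono (Finset.subset_insert j F))
    have h5 := (hproj_le (F' \ A)).trans (hc_mono (Finset.sdiff_subset (s := F') (t := A)))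
    linarith
  choose G hFG hjG hG using hnext
  let F : ℕ → Finset ℕ := fun j => Nat.rec ∅ (fun i H => G H i) j
  have hFsucc : ∀ j, F (j + 1) = G (F j) j := fun j => rfl
  -- Along this permutation the projections onto the sets `F j` are partial sums of one rearranged
  -- series; their jumps contradict its convergence.
  obtain ⟨π, hπ⟩ := exists_perm_image_range_eq F rfl (fun j => by rw [hFsucc]; exact hFG _ _)
    (fun j => by rw [hFsucc]; exact hjG _ _)
  have hconv := hr.convergesTo_iff.1 (h.convergesTo f π)
  obtain ⟨N, hN⟩ := eventually_atTop.1
    (hconv.eventually_lt_const (show (0 : ℝ) < 1 / 2 by norm_num))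
  have hFmono : Monotone F := monotone_nat_of_le_succ fun j => by rw [hFsucc]; exact hFG _ _
  have hcard : ∀ j, j ≤ (F j).card := fun j => by
    calc j = (Finset.range j).card := (Finset.card_range j).symm
      _ ≤ _ := Finset.card_le_card fun i hi => hFmono (Finset.mem_range.1 hi) (by
        rw [hFsucc]; exact hjG _ _)
  have h1 := hN _ (hcard N)
  have h2 := hN _ ((Nat.le_succ N).trans (hcard (N + 1)))
  rw [hπ N] at h1
  rw [hπ (N + 1)] at h2
  have h3 := hr.sub_le (B.proj (F (N + 1)) f - f) (B.proj (F N) f - f)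
  rw [sub_sub_sub_cancel_right] at h3
  have h4 := hG (F N) N
  rw [← hFsucc] at h4
  linarith

/-- Unconditional bases are suppression unconditional. -/
theorem IsUnconditional.exists_proj_le {B : MarkushevichBasis q} (h : B.IsUnconditional)
    (hq : q.IsComplete) (hr : IsPNorm q p r) : ∃ C : ℝ, ∀ A f, r (B.proj A f) ≤ C * r f :=
  hr.exists_uniform_bound hq B.projLinear (B.exists_proj_le_of_isPNorm hr)
    (h.exists_proj_apply_le hr)

theorem IsUnconditional.isQuasiGreedy {B : MarkushevichBasis q} (h : B.IsUnconditional)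
    (hq : q.IsComplete) : B.IsQuasiGreedy := by
  obtain ⟨p, r, hr⟩ := q.exists_isPNorm
  obtain ⟨C, hC⟩ := h.exists_proj_le hq hr
  obtain ⟨C', -, hC'⟩ := hr.exists_le_of_le' C
  exact ⟨C', fun f A _ => hC' _ _ (hC A f)⟩

/-- The definition of a basis does not include totality of the functionals, so convergence of the
expansion must recover a vector from its coordinates. -/
lemma IsUnconditional.proj_eq_of_support_subset {B : MarkushevichBasis q} (h : B.IsUnconditional)
    {f : X} {A : Finset ℕ} (hA : B.support f ⊆ A) : B.proj A f = f := by
  obtain ⟨p, r, hr⟩ := q.exists_isPNorm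
  refine hr.convergesTo_unique (u := fun N => B.proj ((Finset.range N).image (1 : Equiv.Perm ℕ)) f)
    ?_ (h.convergesTo f 1)
  rw [hr.convergesTo_iff]
  refine tendsto_const_nhds.congr' ?_
  filter_upwards [eventually_subset_image_range A 1] with N hN
  have h1 : B.proj ((Finset.range N).image (1 : Equiv.Perm ℕ)) f = B.proj A f := by
    refine (Finset.sum_subset hN fun n _ hn => ?_).symm
    have : B.coord n f = 0 := by
      by_contra hne
      exact hn (hA hne)
    rw [this, zero_smul]
  rw [h1, sub_self, hr.map_zero]

/-- Almost greediness compares with `S_D`, where `D` is the support of the competitor `z`; and `f -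
S_D(f) = (f - z) - S_D(f - z)` is controlled by suppression unconditionality. -/
theorem IsUnconditional.isGreedy {B : MarkushevichBasis q} (h : B.IsUnconditional)
    (hq : q.IsComplete) (hsd : B.IsSuperDemocratic) : B.IsGreedy := by
  obtain ⟨p, r, hr⟩ := q.exists_isPNorm
  obtain ⟨C₁, hC₁1, hC₁⟩ := (h.isQuasiGreedy hq).isAlmostGreedy hsd
  obtain ⟨C₂, hC₂⟩ := h.exists_proj_le hq hr
  obtain ⟨C₃, hC₃1, hC₃⟩ := hr.exists_le_of_le' (1 + C₂)
  refine ⟨C₁ * C₃, by nlinarith, fun f z A hA hz => ?_⟩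
  have hfin : (B.support z).Finite := Set.finite_of_encard_le_coe hz
  set D := hfin.toFinset with hD
  have hDA : D.card ≤ A.card := by
    rw [hfin.encard_eq_coe_toFinset_card] at hz
    exact_mod_cast hz
  have hzD : B.proj D z = z := h.proj_eq_of_support_subset (by simp [hD])
  have h1 : f - B.proj D f = (f - z) - B.proj D (f - z) := by
    rw [proj_sub, hzD]; abel
  have h2 : q (f - B.proj D f) ≤ C₃ * q (f - z) := by
    refine hC₃ _ _ ?_
    rw [h1]
    linarith [hr.sub_le (f - z) (B.proj D (f - z)), hC₂ D (f - z)]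
  calc _ ≤ C₁ * q (f - B.proj D f) := hC₁ f A D hA hDA
    _ ≤ C₁ * (C₃ * q (f - z)) := by gcongr
    _ = _ := by ring

/-- Change `f` on `A` so that all coefficients there equal a constant dominating every coordinate of
`f`. Then `A` is greedy for the new vector, its greedy error is `f - S_A(f)`, and the change is an
admissible competitor with error `f`. The resulting uniform bound and density of the span give
convergence along every permutation. -/
theorem IsGreedy.isUnconditional {B : MarkushevichBasis q} (h : B.IsGreedy)
    (hM : B.IsMBounded) (hS : B.IsSemiNormalized) : B.IsUnconditional := by
  obtain ⟨p, r, hr⟩ := q.exists_isPNorm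
  obtain ⟨b, hb0, hb⟩ := B.exists_norm_coord_le hM hS
  obtain ⟨C, hC1, hC⟩ := h
  have hproj : ∀ (A : Finset ℕ) f, q (f - B.proj A f) ≤ C * q f := by
    intro A f
    set α : ℝ := b * q f with hα
    have hα0 : 0 ≤ α := mul_nonneg hb0.le (q.nonneg f)
    set z : X := ∑ n ∈ A, ((α : 𝕜) - B.coord n f) • B.vec n with hz
    have hzc : ∀ n, B.coord n z = if n ∈ A then (α : 𝕜) - B.coord n f else 0 := fun n =>
      B.coord_sum_smul (fun n => (α : 𝕜) - B.coord n f) A n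
    have hgr : B.IsGreedySet (f + z) A := by
      intro n hn k hk
      rw [map_add, map_add, hzc, hzc, if_pos hn, if_neg hk, add_zero, add_sub_cancel,
        RCLike.norm_ofReal, abs_of_nonneg hα0]
      exact hb k f
    have hsupp : (B.support z).encard ≤ A.card := by
      rw [← Set.encard_coe_eq_coe_finsetCard]
      refine Set.encard_le_encard fun n hn => ?_
      by_contra hnA
      exact hn (by rw [hzc, if_neg (by simpa using hnA)])
    have h1 := hC (f + z) z A hgr hsupp
    have h2 : B.proj A z = z := by
      rw [hz, proj_sum_smul, Finset.inter_self]
    rwa [proj_add, h2, add_sub_add_right_eq_sub, add_sub_cancel_right] at h1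
  obtain ⟨C', -, hC'⟩ := hr.exists_le_of_le C
  have hprojr : ∀ (A : Finset ℕ) f, r (f - B.proj A f) ≤ C' * r f := fun A f =>
    hC' _ _ (hproj A f)
  intro f
  refine ⟨fun n => B.coord n f, fun π => ?_, fun a ha => funext fun n =>
    B.eq_coord_of_convergesTo 1 (ha 1) n⟩
  simp only [B.sum_range_perm (fun n => B.coord n f)]
  rw [hr.convergesTo_iff, Metric.tendsto_atTop]
  intro ε hε
  obtain ⟨δ, hδ, hδr⟩ := hr.exists_lt_of_lt (show 0 < ε / (|C'| + 1) by positivity)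
  obtain ⟨g, hg, hfg⟩ := B.dense_span f δ hδ
  obtain ⟨A₀, hA₀⟩ := B.exists_proj_eq_of_mem_span hg
  obtain ⟨N, hN⟩ := eventually_atTop.1 (eventually_subset_image_range A₀ π)
  refine ⟨N, fun M hM => ?_⟩
  set A := (Finset.range M).image π with hA
  change dist (r (B.proj A f - f)) 0 < ε
  rw [Real.dist_eq, sub_zero, abs_of_nonneg (hr.nonneg _), ← hr.map_neg, neg_sub]
  have h1 : f - B.proj A f = (f - g) - B.proj A (f - g) := by
    rw [proj_sub, hA₀ A (hN M hM)]; abel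
  rw [h1]
  have h2 := hδr _ hfg
  rw [lt_div_iff₀ (by positivity)] at h2
  have h3 := hr.nonneg (f - g)
  calc _ ≤ C' * r (f - g) := hprojr A _
    _ ≤ r (f - g) * (|C'| + 1) := by nlinarith [le_abs_self C']
    _ < ε := h2

end MarkushevichBasis

end Unconditional

/-! ### Embeddings between `X` and symmetric spaces -/

section Embeddings

variable {𝕜 X : Type*} [RCLike 𝕜] [AddCommGroup X] [Module 𝕜 X]

namespace MarkushevichBasis

variable {q : QuasiNorm 𝕜 X} (B : MarkushevichBasis q) {p : ℝ} {r : X → ℝ}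

lemma LowerEmbeds.lowerEmbedsZero {B : MarkushevichBasis q} {S : (ℕ → 𝕜) → ℝ≥0∞}
    (h : B.LowerEmbeds S) : B.LowerEmbedsZero S := by
  obtain ⟨C, hC⟩ := h
  exact ⟨C, fun f hf => hC f hf.1⟩

lemma IsSandwichedBetween.isSandwichedBetweenZero {B : MarkushevichBasis q}
    {S₁ S₂ : (ℕ → 𝕜) → ℝ≥0∞} (h : B.IsSandwichedBetween S₁ S₂) : B.IsSandwichedBetweenZero S₁ S₂ :=
  ⟨h.1, h.2.1, h.2.2.1, h.2.2.2.1.lowerEmbedsZero, h.2.2.2.2⟩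

lemma LowerEmbedsZero.exists_signedSum_le {B : MarkushevichBasis q} {S : (ℕ → 𝕜) → ℝ≥0∞}
    (hS : IsSymmetricGauge S) (h : B.LowerEmbedsZero S) :
    ∃ C : ℝ≥0, ∀ (ε : ℕ → 𝕜) (A : Finset ℕ), (∀ n, ‖ε n‖ = 1) →
      ENNReal.ofReal (q (B.signedSum ε A)) ≤ C * fundamentalFunction S A.card := by
  classical
  obtain ⟨C, hC⟩ := h
  obtain ⟨p, r, hr⟩ := q.exists_isPNorm
  refine ⟨C.toNNReal, fun ε A hε => ?_⟩
  set f : ℕ → 𝕜 := fun n => if n ∈ A then ε n else 0 with hf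
  have hfS : S f = fundamentalFunction S A.card := by
    rw [← hS.indicator_eq_fundamentalFunction]
    refine hS.congr_norm fun n => ?_
    by_cases hn : n ∈ A <;> simp [hf, hn, hε]
  have hmem : f ∈ gaugeSpaceZero S := hS.mem_gaugeSpaceZero_of_finite_support
    (A.finite_toSet.subset fun n hn => by
      by_contra h
      exact hn (if_neg (by simpa using h)))
  obtain ⟨y, hy, hqy⟩ := hC f hmem
  have hy' : y = B.signedSum ε A := by
    refine hr.convergesTo_unique hy ?_
    rw [hr.convergesTo_iff]
    refine tendsto_const_nhds.congr' ?_
    obtain ⟨N, hN⟩ := A.exists_nat_subset_range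
    filter_upwards [eventually_ge_atTop N] with M hM
    have : ∑ n ∈ Finset.range M, f n • B.vec n = B.signedSum ε A := by
      simp only [hf, ite_smul, zero_smul, Finset.sum_ite_mem, signedSum]
      rw [Finset.inter_eq_right.2 (hN.trans (Finset.range_subset_range.2 hM))]
    rw [this, sub_self, hr.map_zero]
  rw [hy', hfS] at hqy
  calc _ ≤ ENNReal.ofReal (C * (fundamentalFunction S A.card).toReal) :=
        ENNReal.ofReal_le_ofReal hqy
    _ = _ := by
        rw [ENNReal.ofReal_mul' ENNReal.toReal_nonneg, ENNReal.ofNNReal_toNNReal,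
          ENNReal.ofReal_toReal (show fundamentalFunction S A.card ≠ ∞ from (hS.finite _).ne)]

lemma UpperEmbeds.exists_le_signedSum {B : MarkushevichBasis q} {S : (ℕ → 𝕜) → ℝ≥0∞}
    (hS : IsSymmetricGauge S) (h : B.UpperEmbeds S) :
    ∃ C : ℝ≥0, ∀ (ε : ℕ → 𝕜) (A : Finset ℕ), (∀ n, ‖ε n‖ = 1) →
      fundamentalFunction S A.card ≤ C * ENNReal.ofReal (q (B.signedSum ε A)) := by
  obtain ⟨C, hC⟩ := h
  refine ⟨C, fun ε A hε => ?_⟩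
  rw [← hS.indicator_eq_fundamentalFunction]
  refine (hS.congr_norm fun n => ?_).le.trans (hC (B.signedSum ε A))
  rw [coord_signedSum]
  by_cases hn : n ∈ A <;> simp [hn, hε]

/-- Signed sums have finite support, so the weak lower embedding suffices. The chain passes from `A`
to `D` through the monotone fundamental function of the larger space; empty `A` is separate because
equivalence of sequences starts at index one. -/
theorem IsSandwichedZero.isSuperDemocratic {B : MarkushevichBasis q} (h : B.IsSandwichedZero) :
    B.IsSuperDemocratic := by
  obtain ⟨S₁, S₂, hS₁, hS₂, ⟨C, hC⟩, hl, hu⟩ := h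
  obtain ⟨C₁, hC₁⟩ := hl.exists_signedSum_le hS₁
  obtain ⟨C₂, hC₂⟩ := hu.exists_le_signedSum hS₂
  refine ⟨max 1 (C₁ * C * C₂), le_max_left _ _, fun A D ε δ hAD hε hδ => ?_⟩
  have hle : q (B.signedSum ε A) ≤ (C₁ * C * C₂ : ℝ≥0) * q (B.signedSum δ D) := by
    rcases Nat.eq_zero_or_pos A.card with h0 | hpos
    · rw [Finset.card_eq_zero.1 h0, signedSum, Finset.sum_empty, q.map_zero]
      exact mul_nonneg (NNReal.coe_nonneg _) (q.nonneg _)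
    · refine (ENNReal.ofReal_le_ofReal_iff (mul_nonneg (NNReal.coe_nonneg _) (q.nonneg _))).1 ?_
      calc _ ≤ C₁ * fundamentalFunction S₁ A.card := hC₁ ε A hε
        _ ≤ C₁ * (C * fundamentalFunction S₂ A.card) := by gcongr; exact (hC _ hpos).1
        _ ≤ C₁ * (C * fundamentalFunction S₂ D.card) := by
            gcongr; exact hS₂.fundamentalFunction_mono hAD
        _ ≤ C₁ * (C * (C₂ * ENNReal.ofReal (q (B.signedSum δ D)))) := by
            gcongr; exact hC₂ δ D hδ
        _ = _ := by
            rw [ENNReal.ofReal_mul (NNReal.coe_nonneg _), ENNReal.ofReal_coe_nnreal]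
            push_cast
            ring
  refine hle.trans (mul_le_mul_of_nonneg_right ?_ (q.nonneg _))
  push_cast
  exact le_max_right _ _

lemma le_upperFundamental {ε : ℕ → 𝕜} {A : Finset ℕ} {m : ℕ} (hA : A.card ≤ m)
    (hε : ∀ n, ‖ε n‖ = 1) : ENNReal.ofReal (q (B.signedSum ε A)) ≤ B.upperFundamental m :=
  le_iSup₂_of_le A hA (le_iSup₂_of_le ε hε le_rfl)

lemma upperFundamental_le {K : ℝ≥0∞} {m : ℕ}
    (h : ∀ (A : Finset ℕ) (ε : ℕ → 𝕜), A.card ≤ m → (∀ n, ‖ε n‖ = 1) →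
      ENNReal.ofReal (q (B.signedSum ε A)) ≤ K) : B.upperFundamental m ≤ K :=
  iSup₂_le fun A hA => iSup₂_le fun ε hε => h A ε hA hε

lemma upperFundamental_mono : Monotone B.upperFundamental := fun _ _ hmn =>
  B.upperFundamental_le fun _ _ hA hε => B.le_upperFundamental (hA.trans hmn) hε

lemma upperFundamental_zero : B.upperFundamental 0 = 0 := by
  refine le_antisymm (B.upperFundamental_le fun A ε hA _ => ?_) zero_le
  rw [Finset.card_eq_zero.1 (Nat.le_zero.1 hA), signedSum, Finset.sum_empty, q.map_zero]
  simp

lemma lowerFundamental_le_upperFundamental (m : ℕ) :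
    B.lowerFundamental m ≤ B.upperFundamental m := by
  refine le_trans ?_ (B.le_upperFundamental (Finset.card_range m).le
    (ε := fun _ => (1 : 𝕜)) (by simp))
  exact iInf₂_le_of_le (Finset.range m) (Finset.card_range m).ge
    (iInf₂_le_of_le (fun _ => (1 : 𝕜)) (by simp) le_rfl)

/-- An enclosure between Lorentz spaces determines the fundamental functions. -/
theorem seqEquiv_fundamental_of_embeds (hp : 0 < p) {w : ℕ → ℝ} (hw : ∀ n, 0 < w n)
    (hl : B.LowerEmbedsZero (lorentz w p)) (hu : B.UpperEmbeds (weakLorentz w)) :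
    SeqEquiv B.lowerFundamental (fun m => ENNReal.ofReal (primitive w m)) ∧
      SeqEquiv (fun m => ENNReal.ofReal (primitive w m)) B.upperFundamental := by
  obtain ⟨C₁, hC₁⟩ := hl.exists_signedSum_le (isSymmetricGauge_lorentz hw hp)
  obtain ⟨C₂, hC₂⟩ := hu.exists_le_signedSum (isSymmetricGauge_weakLorentz hw)
  obtain ⟨C₃, hC₃⟩ := exists_fundamentalFunction_lorentz_le (𝕜 := 𝕜) hw hp
  have hupper : ∀ m, B.upperFundamental m ≤
      ((C₁ * C₃ : ℝ≥0) : ℝ≥0∞) * ENNReal.ofReal (primitive w m) := fun m =>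
    B.upperFundamental_le fun A ε hA hε => by
      calc _ ≤ C₁ * (C₃ * ENNReal.ofReal (primitive w A.card)) :=
            (hC₁ ε A hε).trans (by gcongr; exact hC₃ _)
        _ ≤ C₁ * (C₃ * ENNReal.ofReal (primitive w m)) := by
            gcongr
            exact primitive_mono hw hA
        _ = _ := by push_cast; ring
  have hlower : ∀ m, ENNReal.ofReal (primitive w m) ≤ C₂ * B.lowerFundamental m := by
    intro m
    rcases eq_or_ne C₂ 0 with h0 | h0
    · have := hC₂ (fun _ => 1) (Finset.range m) (by simp)
      rw [fundamentalFunction_weakLorentz hw, Finset.card_range, h0] at this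
      simpa [h0] using this
    · rw [mul_comm, ← ENNReal.div_le_iff_le_mul (Or.inl (by simpa using h0)) (Or.inl ENNReal.coe_ne_top)]
      refine le_iInf₂ fun A hA => le_iInf₂ fun ε hε => ?_
      rw [ENNReal.div_le_iff_le_mul (Or.inl (by simpa using h0)) (Or.inl ENNReal.coe_ne_top)]
      rw [mul_comm]
      refine le_trans ?_ (hC₂ ε A hε)
      rw [fundamentalFunction_weakLorentz hw]
      exact ENNReal.ofReal_le_ofReal (primitive_mono hw hA)
  have hC : ∀ {x y : ℝ≥0∞} {c : ℝ≥0}, (c = C₁ * C₃ ∨ c = C₂) → x ≤ c * y →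
      x ≤ ((max (C₁ * C₃) C₂ : ℝ≥0) : ℝ≥0∞) * y := by
    rintro x y c hc h
    refine h.trans ?_
    gcongr
    rcases hc with rfl | rfl
    · exact le_max_left _ _
    · exact le_max_right _ _
  have hlu := B.lowerFundamental_le_upperFundamental
  refine ⟨⟨max (C₁ * C₃) C₂, fun m _ => ⟨?_, ?_⟩⟩, ⟨max (C₁ * C₃) C₂, fun m _ => ⟨?_, ?_⟩⟩⟩
  · exact hC (Or.inl rfl) ((hlu m).trans (hupper m))
  · exact hC (Or.inr rfl) (hlower m)
  · exact hC (Or.inr rfl) ((hlower m).trans (by gcongr; exact hlu m))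
  · exact hC (Or.inl rfl) (hupper m)

/-- The working form of the equivalence with the fundamental function: super-democracy bounds the
supremum by each single signed sum over a set of the given size. -/
lemma IsSuperDemocratic.exists_primitive_equiv {B : MarkushevichBasis q}
    (hsd : B.IsSuperDemocratic) {w : ℕ → ℝ} (hw : ∀ n, 0 < w n)
    (hequiv : SeqEquiv (fun m => ENNReal.ofReal (primitive w m)) B.upperFundamental) :
    ∃ C : ℝ, 0 < C ∧ ∀ (ε : ℕ → 𝕜) (A : Finset ℕ), (∀ n, ‖ε n‖ = 1) →
      primitive w A.card ≤ C * q (B.signedSum ε A) ∧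
        q (B.signedSum ε A) ≤ C * primitive w A.card := by
  obtain ⟨C₀, hC₀⟩ := hequiv
  obtain ⟨C₁, hC₁1, hC₁⟩ := hsd
  have hC₀0 : (0 : ℝ) ≤ C₀ := C₀.2
  refine ⟨(C₀ + 1) * C₁, by positivity, fun ε A hε => ?_⟩
  rcases Nat.eq_zero_or_pos A.card with h0 | hpos
  · rw [Finset.card_eq_zero.1 h0, signedSum, Finset.sum_empty, q.map_zero, Finset.card_empty,
      primitive_zero]
    simp
  · have hq0 := q.nonneg (B.signedSum ε A)
    have hs0 := primitive_nonneg hw A.card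
    obtain ⟨h1, h2⟩ := hC₀ _ hpos
    have h3 : B.upperFundamental A.card ≤ ENNReal.ofReal (C₁ * q (B.signedSum ε A)) :=
      B.upperFundamental_le fun A' ε' hA' hε' =>
        ENNReal.ofReal_le_ofReal (hC₁ A' A ε' ε hA' hε' hε)
    have h4 : primitive w A.card ≤ C₀ * (C₁ * q (B.signedSum ε A)) := by
      refine (ENNReal.ofReal_le_ofReal_iff (by positivity)).1 ?_
      rw [ENNReal.ofReal_mul hC₀0, ENNReal.ofReal_coe_nnreal]
      exact h1.trans (by gcongr)
    have h5 : q (B.signedSum ε A) ≤ C₀ * primitive w A.card := by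
      refine (ENNReal.ofReal_le_ofReal_iff (by positivity)).1 ?_
      rw [ENNReal.ofReal_mul hC₀0, ENNReal.ofReal_coe_nnreal]
      exact (B.le_upperFundamental le_rfl hε).trans h2
    constructor
    · nlinarith [mul_nonneg (by linarith : (0 : ℝ) ≤ C₁) hq0]
    · nlinarith [mul_nonneg hC₀0 hs0, mul_nonneg (mul_nonneg hC₀0 hs0) (by linarith : 0 ≤ C₁ - 1),
        mul_nonneg hs0 (by linarith : (0 : ℝ) ≤ C₁)]

/-- An interval of length `2n` splits into two blocks of length `n`, and the quasi-triangle law of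
`X` gives the doubling needed for the quasi-triangle laws of the Lorentz gauges. -/
lemma exists_primitive_double_le {w : ℕ → ℝ} (h : ∃ C : ℝ, 0 < C ∧
      ∀ (ε : ℕ → 𝕜) (A : Finset ℕ), (∀ n, ‖ε n‖ = 1) →
        primitive w A.card ≤ C * q (B.signedSum ε A) ∧
          q (B.signedSum ε A) ≤ C * primitive w A.card) :
    ∃ D : ℝ, ∀ n, primitive w (2 * n) ≤ D * primitive w n := by
  obtain ⟨C, hC0, hC⟩ := h
  obtain ⟨κ, hκ, hadd⟩ := q.add_le
  refine ⟨C * (κ * (2 * C)), fun n => ?_⟩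
  have h1 : ∀ A : Finset ℕ, A.card = n → q (B.signedSum (fun _ => 1) A) ≤ C * primitive w n :=
    fun A hA => by
      have := (hC (fun _ => 1) A (by simp)).2
      rwa [hA] at this
  have h2 : B.signedSum (fun _ => (1 : 𝕜)) (Finset.range (2 * n)) =
      B.signedSum (fun _ => 1) (Finset.range n) + B.signedSum (fun _ => 1) (Finset.Ico n (2 * n)) :=
    (Finset.sum_range_add_sum_Ico _ (by omega)).symm
  have h3 := (hC (fun _ => 1) (Finset.range (2 * n)) (by simp)).1
  rw [Finset.card_range, h2] at h3
  calc _ ≤ _ := h3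
    _ ≤ C * (κ * (C * primitive w n + C * primitive w n)) := by
        gcongr
        refine (hadd _ _).trans ?_
        gcongr
        · exact h1 _ (Finset.card_range n)
        · exact h1 _ (by rw [Nat.card_Ico]; omega)
    _ = _ := by ring

/-- Bounded restricted truncation operators give an embedding into a weak Lorentz space. -/
theorem RestrictedTruncationBounded.upperEmbeds {B : MarkushevichBasis q}
    (h : B.RestrictedTruncationBounded)
    (hb : ∃ C : ℝ, 0 < C ∧ ∀ n f, ‖B.coord n f‖ ≤ C * q f) {w : ℕ → ℝ} (hequiv : ∃ C : ℝ, 0 < C ∧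
      ∀ (ε : ℕ → 𝕜) (A : Finset ℕ), (∀ n, ‖ε n‖ = 1) →
        primitive w A.card ≤ C * q (B.signedSum ε A) ∧
          q (B.signedSum ε A) ≤ C * primitive w A.card) :
    B.UpperEmbeds (weakLorentz w) := by
  obtain ⟨C₁, hC₁⟩ := h
  obtain ⟨C, hC0, hC⟩ := hequiv
  refine ⟨(C * C₁).toNNReal, fun f => iSup_le fun n => ?_⟩
  obtain ⟨A, hAcard, hA⟩ := B.exists_isStandardGreedySet hb f (n + 1)
  have hne : A.Nonempty := Finset.card_pos.1 (by omega)
  have h1 := hC₁ f A hA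
  rw [truncation_of_nonempty B hne, q.smul] at h1
  set m := A.inf' hne (fun n => ‖B.coord n f‖) with hm
  have hm0 : 0 ≤ m := Finset.le_inf' _ _ fun n _ => norm_nonneg _
  rw [RCLike.norm_ofReal, abs_of_nonneg hm0] at h1
  -- Coordinates strictly above the minimum lie in `A` without a minimiser, hence at most `n` of
  -- them; this matches the zero-based index of the rearrangement.
  obtain ⟨j, hj, hjm⟩ := Finset.exists_mem_eq_inf' hne (fun n => ‖B.coord n f‖)
  have h2 : rearrangement (fun n => B.coord n f) n ≤ ENNReal.ofReal m := by
    refine rearrangement_le_of_encard_le ?_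
    have hsub : {k | ENNReal.ofReal m < ENNReal.ofReal ‖B.coord k f‖} ⊆
        ((A.erase j : Finset ℕ) : Set ℕ) := by
      intro k hk
      have hk' : m < ‖B.coord k f‖ := by
        by_contra hcon
        exact (ENNReal.ofReal_le_ofReal (not_lt.1 hcon)).not_gt hk
      rw [hm, hjm] at hk'
      refine Finset.mem_erase.2 ⟨fun hkj => ?_, ?_⟩
      · rw [hkj] at hk'; exact lt_irrefl _ hk'
      · by_contra hkA
        exact (hA.isGreedySet j hj k hkA).not_gt hk'
    refine (Set.encard_le_encard hsub).trans ?_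
    rw [Set.encard_coe_eq_coe_finsetCard, Finset.card_erase_of_mem hj, hAcard]
    simp
  have h3 := (hC (fun n => sgn (B.coord n f)) A (fun n => norm_sgn _)).1
  rw [hAcard] at h3
  calc _ ≤ ENNReal.ofReal m * ENNReal.ofReal (primitive w (n + 1)) := by gcongr
    _ = ENNReal.ofReal (m * primitive w (n + 1)) := (ENNReal.ofReal_mul hm0).symm
    _ ≤ ENNReal.ofReal (C * C₁ * q f) := by
        refine ENNReal.ofReal_le_ofReal ?_
        calc _ ≤ m * (C * q (B.signedSum (fun n => sgn (B.coord n f)) A)) := by gcongr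
          _ = C * (m * q (B.signedSum (fun n => sgn (B.coord n f)) A)) := by ring
          _ ≤ C * (C₁ * q f) := by gcongr
          _ = _ := by ring
    _ = _ := by rw [ENNReal.ofReal_mul' (q.nonneg _), ENNReal.ofNNReal_toNNReal]

end MarkushevichBasis

lemma le_rearrangement {𝕜 : Type*} [RCLike 𝕜] {f : ℕ → 𝕜} {n : ℕ} {t : ℝ≥0∞} {A : Finset ℕ}
    (hA : n < A.card) (h : ∀ k ∈ A, t ≤ ENNReal.ofReal ‖f k‖) : t ≤ rearrangement f n := by
  refine le_of_forall_lt fun s hs => ?_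
  obtain ⟨A', hA', hcard⟩ := Finset.exists_subset_card_eq (show n + 1 ≤ A.card from hA)
  exact lt_rearrangement_iff.2 ⟨A', hcard, fun k hk => hs.trans_le (h k (hA' hk))⟩

/-- Sums of distinct dyadic powers are controlled by the largest one. -/
lemma exists_sum_two_zpow_rpow_le {p : ℝ} (hp : 0 < p) :
    ∃ C : ℝ, 0 < C ∧ ∀ (J : Finset ℤ) (x : ℝ≥0∞),
      (∀ j ∈ J, ENNReal.ofReal ((2 : ℝ) ^ j) ≤ x) →
        ENNReal.ofReal (∑ j ∈ J, ((2 : ℝ) ^ j) ^ p) ≤ ENNReal.ofReal C * x ^ p := by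
  have h2p : (1 : ℝ) < 2 ^ p := Real.one_lt_rpow (by norm_num) hp
  set ρ : ℝ := ((2 : ℝ) ^ p)⁻¹ with hρ
  have hρ0 : 0 ≤ ρ := by positivity
  have hρ1 : ρ < 1 := inv_lt_one_of_one_lt₀ h2p
  have hC : 0 < (1 - ρ)⁻¹ := inv_pos.2 (by linarith)
  refine ⟨(1 - ρ)⁻¹, hC, fun J x hx => ?_⟩
  rcases J.eq_empty_or_nonempty with rfl | hne
  · simp
  set j₀ := J.max' hne with hj₀
  have h1 : ∀ j ∈ J, ((2 : ℝ) ^ j) ^ p = ((2 : ℝ) ^ j₀) ^ p * ρ ^ (j₀ - j).toNat := by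
    intro j hj
    have hle : j ≤ j₀ := Finset.le_max' J j hj
    have h3 : (2 : ℝ) ^ j₀ = 2 ^ j * 2 ^ (j₀ - j).toNat := by
      rw [← zpow_natCast, ← zpow_add₀ (by norm_num), Int.toNat_of_nonneg (by omega)]
      congr 1; ring
    rw [h3, Real.mul_rpow (by positivity) (by positivity), hρ, inv_pow, ← Real.rpow_natCast 2,
      ← Real.rpow_natCast (2 ^ p), ← Real.rpow_mul (by norm_num), ← Real.rpow_mul (by norm_num),
      mul_comm p, mul_assoc, mul_inv_cancel₀ (by positivity), mul_one]
  have h2 : ∑ j ∈ J, ((2 : ℝ) ^ j) ^ p ≤ (1 - ρ)⁻¹ * ((2 : ℝ) ^ j₀) ^ p := by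
    rw [Finset.sum_congr rfl h1, ← Finset.mul_sum, mul_comm]
    gcongr
    have hinj : Set.InjOn (fun j : ℤ => (j₀ - j).toNat) J := by
      intro a ha b hb hab
      have h4 := Finset.le_max' J a ha
      have h5 := Finset.le_max' J b hb
      simp only at hab
      omega
    rw [← Finset.sum_image (f := fun k : ℕ => ρ ^ k) hinj, ← tsum_geometric_of_lt_one hρ0 hρ1]
    exact (summable_geometric_of_lt_one hρ0 hρ1).sum_le_tsum _ fun j _ => by positivity
  calc _ ≤ ENNReal.ofReal ((1 - ρ)⁻¹ * ((2 : ℝ) ^ j₀) ^ p) := ENNReal.ofReal_le_ofReal h2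
    _ = ENNReal.ofReal (1 - ρ)⁻¹ * ENNReal.ofReal ((2 : ℝ) ^ j₀) ^ p := by
        rw [ENNReal.ofReal_mul hC.le, ENNReal.ofReal_rpow_of_pos (by positivity)]
    _ ≤ _ := by
        gcongr
        exact hx j₀ (Finset.max'_mem J hne)

namespace MarkushevichBasis

variable {q : QuasiNorm 𝕜 X} (B : MarkushevichBasis q) {p : ℝ} {r : X → ℝ}

/-- A dyadic block at height `2^j` with `k` entries costs at most a constant times `2^{jp} s_k^p`,
which is spread over the first `k` Lorentz weights. After interchanging sums, only heights whose
block has more than `i` entries meet the `i`-th weight. Such heights are at most the `i`-th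
rearranged entry of `a`, and their `p`-th powers sum geometrically. -/
lemma exists_sum_smul_le_lorentzSum (hr : IsPNorm q p r) (hp1 : p ≤ 1) {w : ℕ → ℝ}
    (hw : ∀ n, 0 < w n) (hequiv : ∃ C : ℝ, 0 < C ∧
      ∀ (ε : ℕ → 𝕜) (A : Finset ℕ), (∀ n, ‖ε n‖ = 1) →
        primitive w A.card ≤ C * q (B.signedSum ε A) ∧
          q (B.signedSum ε A) ≤ C * primitive w A.card) :
    ∃ C : ℝ, 0 < C ∧ ∀ (E : Finset ℕ) (a : ℕ → 𝕜),
      ENNReal.ofReal (r (∑ n ∈ E, a n • B.vec n)) ≤ ENNReal.ofReal C * lorentzSum w p a := by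
  classical
  obtain ⟨C, hC0, hC⟩ := hequiv
  have hp := hr.p_pos
  obtain ⟨D, hD0, hD⟩ := exists_sum_two_zpow_rpow_le hp
  have h2p : (1 : ℝ) < 2 ^ p := Real.one_lt_rpow (by norm_num) hp
  have h2p' : (0 : ℝ) < 2 ^ p - 1 := by linarith
  set K : ℝ := 2 ^ p * (C ^ p / (2 ^ p - 1)) with hK
  have hK0 : 0 < K := by positivity
  refine ⟨K * D, by positivity, fun E a => ?_⟩
  set E' := E.filter (fun n => a n ≠ 0) with hE'
  have hEE' : ∑ n ∈ E, a n • B.vec n = ∑ n ∈ E', a n • B.vec n := by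
    rw [hE', Finset.sum_filter]
    refine Finset.sum_congr rfl fun n _ => ?_
    by_cases h : a n = 0 <;> simp [h]
  set lev : ℕ → ℤ := fun n => Int.log 2 ‖a n‖ with hlev
  set J := E'.image lev with hJ
  set blk : ℤ → Finset ℕ := fun j => E'.filter fun n => lev n = j with hblk
  have hlow : ∀ j, ∀ n ∈ blk j, (2 : ℝ) ^ j ≤ ‖a n‖ := by
    intro j n hn
    obtain ⟨hn1, rfl⟩ := Finset.mem_filter.1 hn
    have hpos : 0 < ‖a n‖ := norm_pos_iff.2 (Finset.mem_filter.1 hn1).2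
    simpa using Int.zpow_log_le_self (b := 2) (by norm_num) hpos
  have hupp : ∀ j, ∀ n ∈ blk j, ‖a n‖ ≤ 2 * (2 : ℝ) ^ j := by
    intro j n hn
    obtain ⟨hn1, rfl⟩ := Finset.mem_filter.1 hn
    have h1 := Int.lt_zpow_succ_log_self (b := 2) (by norm_num) ‖a n‖
    rw [zpow_add_one₀ (by norm_num), mul_comm] at h1
    simpa using h1.le
  set u : ℕ → ℝ := lorentzWeight w p with hu
  have hu0 : ∀ i, 0 ≤ u i := fun i => (lorentzWeight_pos hw p i).le
  have hblock : ∀ j, r (∑ n ∈ blk j, a n • B.vec n) ≤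
      K * (((2 : ℝ) ^ j) ^ p * ∑ i ∈ Finset.range (blk j).card, u i) := by
    intro j
    have h1 := B.sum_smul_le_of_signedSum_le hr (blk j) a (m := 2 * (2 : ℝ) ^ j)
      (M := C ^ p * ∑ i ∈ Finset.range (blk j).card, u i) (by positivity) (hupp j)
      fun A hA => by
        have hs := primitive_nonneg hw (blk j).card
        calc _ ≤ q (B.signedSum (fun n => sgn (a n)) A) ^ p := hr.le_rpow _
          _ ≤ (C * primitive w (blk j).card) ^ p := by
              refine Real.rpow_le_rpow (q.nonneg _) ((hC _ A fun n => norm_sgn _).2.trans ?_) hp.le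
              gcongr
              exact primitive_mono hw (Finset.card_le_card hA)
          _ = C ^ p * primitive w (blk j).card ^ p := Real.mul_rpow hC0.le hs
          _ ≤ _ := by
              gcongr
              exact rpow_primitive_le_sum_lorentzWeight hw hp hp1 _
    refine h1.trans (le_of_eq ?_)
    rw [Real.mul_rpow (by norm_num) (by positivity), hK]
    ring
  have hreal : r (∑ n ∈ E, a n • B.vec n) ≤ ∑ i ∈ Finset.range E'.card,
      K * ((∑ j ∈ J.filter (fun j => i < (blk j).card), ((2 : ℝ) ^ j) ^ p) * u i) := by
    rw [hEE', ← Finset.sum_fiberwise_of_maps_to (g := lev) (t := J)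
      (fun n hn => Finset.mem_image_of_mem lev hn)]
    refine (hr.sum_le _ _).trans ((Finset.sum_le_sum fun j _ => hblock j).trans (le_of_eq ?_))
    have h1 : ∀ j ∈ J, ∑ i ∈ Finset.range (blk j).card, u i =
        ∑ i ∈ Finset.range E'.card, if i < (blk j).card then u i else 0 := by
      intro j _
      have hle : (blk j).card ≤ E'.card := Finset.card_le_card (Finset.filter_subset _ _)
      rw [← Finset.sum_filter]
      congr 1
      ext i
      simp only [Finset.mem_range, Finset.mem_filter]
      omega
    rw [← Finset.mul_sum, ← Finset.mul_sum]
    congr 1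
    calc _ = ∑ j ∈ J, ∑ i ∈ Finset.range E'.card,
          (if i < (blk j).card then ((2 : ℝ) ^ j) ^ p else 0) * u i := by
          refine Finset.sum_congr rfl fun j hj => ?_
          rw [h1 j hj, Finset.mul_sum]
          refine Finset.sum_congr rfl fun i _ => ?_
          split_ifs <;> simp
      _ = _ := by
          rw [Finset.sum_comm]
          refine Finset.sum_congr rfl fun i _ => ?_
          rw [← Finset.sum_mul, Finset.sum_filter]
  calc _ ≤ ENNReal.ofReal (∑ i ∈ Finset.range E'.card,
        K * ((∑ j ∈ J.filter (fun j => i < (blk j).card), ((2 : ℝ) ^ j) ^ p) * u i)) :=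
        ENNReal.ofReal_le_ofReal hreal
    _ = ∑ i ∈ Finset.range E'.card, ENNReal.ofReal
        (K * ((∑ j ∈ J.filter (fun j => i < (blk j).card), ((2 : ℝ) ^ j) ^ p) * u i)) := by
        refine ENNReal.ofReal_sum_of_nonneg fun i _ => ?_
        have : 0 ≤ ∑ j ∈ J.filter (fun j => i < (blk j).card), ((2 : ℝ) ^ j) ^ p :=
          Finset.sum_nonneg fun j _ => by positivity
        have := hu0 i
        positivity
    _ ≤ ∑ i ∈ Finset.range E'.card,
        ENNReal.ofReal (K * D) * (rearrangement a i ^ p * ENNReal.ofReal (u i)) := by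
        refine Finset.sum_le_sum fun i _ => ?_
        have h1 := hD (J.filter (fun j => i < (blk j).card)) (rearrangement a i) fun j hj =>
          le_rearrangement (Finset.mem_filter.1 hj).2 fun k hk =>
            ENNReal.ofReal_le_ofReal (hlow j k hk)
        rw [ENNReal.ofReal_mul hK0.le, ENNReal.ofReal_mul' (hu0 i), ENNReal.ofReal_mul hK0.le]
        calc _ ≤ ENNReal.ofReal K *
              (ENNReal.ofReal D * rearrangement a i ^ p * ENNReal.ofReal (u i)) := by gcongr
          _ = _ := by ring
    _ ≤ _ := by
        rw [← Finset.mul_sum]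
        gcongr
        exact ENNReal.sum_le_tsum _

/-- A basis whose fundamental function is controlled by the primitive weight allows an embedding
of the separable part of `d_{1,p}(w)`. -/
theorem lowerEmbedsZero_lorentz (hq : q.IsComplete) (hr : IsPNorm q p r) (hp1 : p ≤ 1) {w : ℕ → ℝ}
    (hw : ∀ n, 0 < w n) (hequiv : ∃ C : ℝ, 0 < C ∧
      ∀ (ε : ℕ → 𝕜) (A : Finset ℕ), (∀ n, ‖ε n‖ = 1) →
        primitive w A.card ≤ C * q (B.signedSum ε A) ∧
          q (B.signedSum ε A) ≤ C * primitive w A.card) :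
    B.LowerEmbedsZero (lorentz w p) := by
  obtain ⟨C, hC0, hC⟩ := B.exists_sum_smul_le_lorentzSum hr hp1 hw hequiv
  obtain ⟨K, hK0, hK⟩ := hr.rpow_le
  have hp := hr.p_pos
  refine ⟨(K * C) ^ (1 / p), fun f hf => ?_⟩
  obtain ⟨hftop, happ⟩ := hf
  have hsum : lorentzSum w p f ≠ ∞ := by
    rw [← lorentz_rpow w hp]
    exact (ENNReal.rpow_lt_top_of_nonneg hp.le hftop.ne).ne
  obtain ⟨y, hy⟩ := hr.exists_convergesTo hq
    (u := fun N => ∑ n ∈ Finset.range N, f n • B.vec n) fun ε hε => by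
      -- Beyond the support of `g`, block sums of `f` coincide with those of `f - g`, which is small
      -- in the gauge; this makes the partial sums Cauchy.
      obtain ⟨g, hg, hfg⟩ := happ (ENNReal.ofReal ((ε / C) ^ (1 / p)))
        (by simpa using Real.rpow_pos_of_pos (div_pos hε hC0) _)
      have hlt : lorentzSum w p (f - g) < ENNReal.ofReal (ε / C) := by
        have h1 := ENNReal.rpow_lt_rpow hfg hp
        rw [lorentz_rpow w hp, ENNReal.ofReal_rpow_of_nonneg (by positivity) hp.le,
          ← Real.rpow_mul (by positivity), one_div_mul_cancel hp.ne', Real.rpow_one] at h1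
        exact h1
      obtain ⟨N, hN⟩ := hg.toFinset.exists_nat_subset_range
      have hcau : ∀ i j, N ≤ i → i ≤ j → r (∑ n ∈ Finset.range j, f n • B.vec n -
          ∑ n ∈ Finset.range i, f n • B.vec n) < ε := by
        intro i j hNi hij
        have h1 : ∑ n ∈ Finset.range j, f n • B.vec n - ∑ n ∈ Finset.range i, f n • B.vec n =
            ∑ n ∈ Finset.Ico i j, (f - g) n • B.vec n := by
          rw [← Finset.sum_Ico_eq_sub _ hij]
          refine Finset.sum_congr rfl fun n hn => ?_
          have : g n = 0 := by
            by_contra hne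
            have h2 := Finset.mem_range.1 (hN (hg.mem_toFinset.2 hne))
            have h3 := (Finset.mem_Ico.1 hn).1
            omega
          simp [this]
        rw [h1]
        refine (ENNReal.ofReal_lt_ofReal_iff hε).1 ((hC _ _).trans_lt ?_)
        calc _ < ENNReal.ofReal C * ENNReal.ofReal (ε / C) :=
              ENNReal.mul_lt_mul_right (by simpa using hC0) ENNReal.ofReal_ne_top hlt
          _ = ENNReal.ofReal ε := by
              rw [← ENNReal.ofReal_mul hC0.le, mul_div_cancel₀ _ hC0.ne']
      refine ⟨N, fun i hi j hj => ?_⟩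
      rcases le_total i j with h | h
      · rw [← hr.map_neg, neg_sub]
        exact hcau i j hi h
      · exact hcau j i hj h
  refine ⟨y, hy, ?_⟩
  have hry : r y ≤ C * (lorentzSum w p f).toReal := by
    have h1 := (hr.convergesTo_iff.1 hy).const_add (C * (lorentzSum w p f).toReal)
    rw [add_zero] at h1
    refine ge_of_tendsto' h1 fun N => ?_
    have h2 := hr.le_add_sub y (∑ n ∈ Finset.range N, f n • B.vec n)
    rw [← hr.map_neg (y - _), neg_sub] at h2
    refine h2.trans ?_
    gcongr
    have h3 := ENNReal.toReal_mono (ENNReal.mul_ne_top ENNReal.ofReal_ne_top hsum)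
      (hC (Finset.range N) f)
    rwa [ENNReal.toReal_ofReal (hr.nonneg _), ENNReal.toReal_mul, ENNReal.toReal_ofReal hC0.le]
      at h3
  calc q y = (q y ^ p) ^ (1 / p) := by
        rw [← Real.rpow_mul (q.nonneg _), mul_one_div_cancel hp.ne', Real.rpow_one]
    _ ≤ (K * C * (lorentzSum w p f).toReal) ^ (1 / p) := by
        refine Real.rpow_le_rpow (Real.rpow_nonneg (q.nonneg _) _) ((hK y).trans ?_) (by positivity)
        rw [mul_assoc]
        gcongr
    _ = _ := by
        rw [Real.mul_rpow (by positivity) ENNReal.toReal_nonneg, lorentz_eq, ENNReal.toReal_rpow]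

/-- The enclosure of a space between Lorentz spaces. -/
theorem isSandwichedBetween_lorentz (hq : q.IsComplete) (hM : B.IsMBounded)
    (hS : B.IsSemiNormalized) (hp : 0 < p) (hp1 : p ≤ 1) (hconv : q.IsPConvex p)
    (hsd : B.IsSuperDemocratic) (hrt : B.RestrictedTruncationBounded) {w : ℕ → ℝ}
    (hw : ∀ n, 0 < w n)
    (hwu : SeqEquiv (fun m => ENNReal.ofReal (primitive w m)) B.upperFundamental) :
    IsQuasiBanachGauge (lorentz w p : (ℕ → 𝕜) → ℝ≥0∞) ∧
      IsQuasiBanachGauge (weakLorentz w : (ℕ → 𝕜) → ℝ≥0∞) ∧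
      B.IsSandwichedBetweenZero (lorentz w p) (weakLorentz w) ∧
      (B.HasUnboundedFundamental → B.IsSandwichedBetween (lorentz w p) (weakLorentz w)) := by
  obtain ⟨r, hr⟩ := hconv.exists_isPNorm hp
  have hequiv := hsd.exists_primitive_equiv hw hwu
  have hdbl := B.exists_primitive_double_le hequiv
  have hl := B.lowerEmbedsZero_lorentz hq hr hp1 hw hequiv
  have hu := hrt.upperEmbeds (B.exists_norm_coord_le hM hS) hequiv
  have hg₁ : IsSymmetricGauge (lorentz w p : (ℕ → 𝕜) → ℝ≥0∞) := isSymmetricGauge_lorentz hw hp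
  have hg₂ : IsSymmetricGauge (weakLorentz w : (ℕ → 𝕜) → ℝ≥0∞) := isSymmetricGauge_weakLorentz hw
  have hf := seqEquiv_fundamentalFunction_lorentz (𝕜 := 𝕜) hw hp hp1
  refine ⟨isQuasiBanachGauge_lorentz hw hp hp1 hdbl, isQuasiBanachGauge_weakLorentz hw hdbl,
    ⟨hg₁, hg₂, hf, hl, hu⟩, fun hunb => ⟨hg₁, hg₂, hf, ?_, hu⟩⟩
  obtain ⟨C, hC⟩ := hl
  refine ⟨C, fun f hmem => hC f (gaugeSpace_lorentz_subset_gaugeSpaceZero hw hp hp1 ?_ hmem)⟩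
  -- A bounded primitive weight would bound the fundamental function through the equivalence `hwu`.
  -- Passing from `m` to `m + 1` avoids index zero, which the equivalence does not cover.
  by_contra! hcon
  obtain ⟨M, hMn⟩ := hcon
  obtain ⟨C₀, hC₀⟩ := hwu
  have hle : ⨆ m, B.upperFundamental m ≤ C₀ * ENNReal.ofReal M := by
    refine iSup_le fun m => (B.upperFundamental_mono (Nat.le_succ m)).trans ?_
    refine (hC₀ (m + 1) (by omega)).2.trans ?_
    gcongr
    exact ENNReal.ofReal_le_ofReal (hMn _).le
  rw [show ⨆ m, B.upperFundamental m = ∞ from hunb] at hle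
  exact (ENNReal.mul_lt_top ENNReal.coe_lt_top ENNReal.ofReal_lt_top).not_ge hle

lemma vec_ne_zero (n : ℕ) : B.vec n ≠ 0 := fun h => by
  have := B.biorthogonal n n
  simp [h] at this

lemma IsSuperDemocratic.isSemiNormalized {B : MarkushevichBasis q} (h : B.IsSuperDemocratic) :
    B.IsSemiNormalized := by
  obtain ⟨C, hC1, hC⟩ := h
  have h0 := q.pos _ (B.vec_ne_zero 0)
  have h1 : ∀ n k, q (B.vec n) ≤ C * q (B.vec k) := fun n k => by
    simpa [signedSum] using hC {n} {k} (fun _ => 1) (fun _ => 1) (by simp) (by simp) (by simp)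
  refine ⟨q (B.vec 0) / C, C * q (B.vec 0), by positivity, fun n => ⟨?_, h1 n 0⟩⟩
  rw [div_le_iff₀' (by linarith)]
  exact h1 0 n

/-- The fundamental function of a super-democratic basis is equivalent to a primitive weight. -/
lemma IsSuperDemocratic.exists_weight {B : MarkushevichBasis q} (h : B.IsSuperDemocratic) :
    ∃ w : ℕ → ℝ, (∀ n, 0 < w n) ∧
      SeqEquiv (fun m => ENNReal.ofReal (primitive w m)) B.upperFundamental := by
  obtain ⟨C, hC1, hC⟩ := h
  have hfin : ∀ m, B.upperFundamental m ≠ ∞ := fun m =>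
    ne_top_of_le_ne_top (b := ENNReal.ofReal (C * q (B.signedSum (fun _ => 1) (Finset.range m))))
      ENNReal.ofReal_ne_top (B.upperFundamental_le fun A ε hA hε =>
        ENNReal.ofReal_le_ofReal (hC _ _ _ _ (by simpa using hA) hε (by simp)))
  set φ : ℕ → ℝ := fun m => (B.upperFundamental m).toReal with hφ
  have hφmono : Monotone φ := fun m n hmn =>
    ENNReal.toReal_mono (hfin n) (B.upperFundamental_mono hmn)
  have hφ1 : 0 < φ 1 := by
    refine ENNReal.toReal_pos (ne_of_gt ?_) (hfin 1)
    refine lt_of_lt_of_le ?_ (B.le_upperFundamental (ε := fun _ => (1 : 𝕜)) (A := {0}) (by simp)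
      (by simp))
    simpa [signedSum] using q.pos _ (B.vec_ne_zero 0)
  -- The increments of `φ` may vanish, so a geometric correction makes the weight positive. Its
  -- total is at most `φ 1`, which keeps the primitive between `φ` and `2 φ` from index one on.
  set w : ℕ → ℝ := fun n => φ (n + 1) - φ n + (1 / 2) ^ (n + 1) * φ 1 with hw
  have hprim : ∀ m, primitive w m = φ m + (1 - (1 / 2) ^ m) * φ 1 := by
    intro m
    induction m with
    | zero => simp [primitive_zero, hφ, B.upperFundamental_zero]
    | succ m ih =>
      rw [primitive_succ, ih, hw]
      ring
  refine ⟨w, fun n => ?_, 2, fun m hm => ?_⟩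
  · have := hφmono (Nat.le_succ n)
    have h2 : 0 < (1 / 2 : ℝ) ^ (n + 1) * φ 1 := by positivity
    simp only [hw]
    linarith
  · have h3 : B.upperFundamental m = ENNReal.ofReal (φ m) := (ENNReal.ofReal_toReal (hfin m)).symm
    have h4 := hφmono hm
    have h5 : (0 : ℝ) ≤ (1 / 2) ^ m := by positivity
    have h6 : (1 / 2 : ℝ) ^ m ≤ 1 := pow_le_one₀ (by norm_num) (by norm_num)
    have h7 : ((2 : ℝ≥0) : ℝ≥0∞) = ENNReal.ofReal 2 := by simp
    simp only [hprim]
    rw [h3, h7, ← ENNReal.ofReal_mul (by norm_num), ← ENNReal.ofReal_mul (by norm_num)]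
    constructor <;> refine ENNReal.ofReal_le_ofReal ?_ <;> nlinarith

theorem exists_isSandwichedBetween (hq : q.IsComplete) (hM : B.IsMBounded)
    (hsd : B.IsSuperDemocratic) (hrt : B.RestrictedTruncationBounded) :
    ∃ S₁ S₂ : (ℕ → 𝕜) → ℝ≥0∞, IsQuasiBanachGauge S₁ ∧ IsQuasiBanachGauge S₂ ∧
      B.IsSandwichedBetweenZero S₁ S₂ ∧
      (B.HasUnboundedFundamental → B.IsSandwichedBetween S₁ S₂) := by
  obtain ⟨p, hp, hp1, hconv⟩ := q.exists_isPConvex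
  obtain ⟨w, hw, hwu⟩ := hsd.exists_weight
  exact ⟨lorentz w p, weakLorentz w, B.isSandwichedBetween_lorentz hq hM hsd.isSemiNormalized hp hp1
    hconv hsd hrt hw hwu⟩

lemma IsQuasiGreedy.restrictedTruncationBounded {B : MarkushevichBasis q} (h : B.IsQuasiGreedy) :
    B.RestrictedTruncationBounded := by
  obtain ⟨p, r, hr⟩ := q.exists_isPNorm
  obtain ⟨C, -, hC⟩ := h.exists_truncation_le hr
  obtain ⟨C', -, hC'⟩ := hr.exists_le_of_le' C
  exact ⟨C', fun f A hA => hC' _ _ (hC f A hA.isGreedySet)⟩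

end MarkushevichBasis

end Embeddings

/-! ### Characterizations of almost greedy and greedy bases -/

section Characterizations

variable {𝕜 X : Type*} [RCLike 𝕜] [AddCommGroup X] [Module 𝕜 X]

namespace MarkushevichBasis

variable {q : QuasiNorm 𝕜 X} {B : MarkushevichBasis q}

lemma IsSandwiched.isSandwichedZero (h : B.IsSandwiched) : B.IsSandwichedZero := by
  obtain ⟨S₁, S₂, h⟩ := h
  exact ⟨S₁, S₂, h.isSandwichedBetweenZero⟩

lemma IsAlmostGreedy.isSandwichedZero (h : B.IsAlmostGreedy) (hq : q.IsComplete)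
    (hM : B.IsMBounded) : B.IsSandwichedZero := by
  obtain ⟨S₁, S₂, -, -, h, -⟩ := B.exists_isSandwichedBetween hq hM h.isSuperDemocratic
    h.isQuasiGreedy.restrictedTruncationBounded
  exact ⟨S₁, S₂, h⟩

lemma IsAlmostGreedy.isSandwiched (h : B.IsAlmostGreedy) (hq : q.IsComplete)
    (hM : B.IsMBounded) (hunb : B.HasUnboundedFundamental) : B.IsSandwiched := by
  obtain ⟨S₁, S₂, -, -, -, h⟩ := B.exists_isSandwichedBetween hq hM h.isSuperDemocratic
    h.isQuasiGreedy.restrictedTruncationBounded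
  exact ⟨S₁, S₂, h hunb⟩

theorem isAlmostGreedy_iff_isSandwichedZero (hq : q.IsComplete) (hM : B.IsMBounded) :
    B.IsAlmostGreedy ↔ B.IsQuasiGreedy ∧ B.IsSandwichedZero :=
  ⟨fun h => ⟨h.isQuasiGreedy, h.isSandwichedZero hq hM⟩,
    fun h => h.1.isAlmostGreedy h.2.isSuperDemocratic⟩

theorem isAlmostGreedy_iff_isSandwiched (hq : q.IsComplete) (hM : B.IsMBounded)
    (hunb : B.HasUnboundedFundamental) :
    B.IsAlmostGreedy ↔ B.IsQuasiGreedy ∧ B.IsSandwiched :=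
  ⟨fun h => ⟨h.isQuasiGreedy, h.isSandwiched hq hM hunb⟩,
    fun h => h.1.isAlmostGreedy h.2.isSandwichedZero.isSuperDemocratic⟩

theorem isGreedy_iff_isSandwichedZero (hq : q.IsComplete) (hM : B.IsMBounded)
    (hS : B.IsSemiNormalized) :
    B.IsGreedy ↔ B.IsUnconditional ∧ B.IsSandwichedZero :=
  ⟨fun h => ⟨h.isUnconditional hM hS, h.isAlmostGreedy.isSandwichedZero hq hM⟩,
    fun h => h.1.isGreedy hq h.2.isSuperDemocratic⟩

theorem isGreedy_iff_isSandwiched (hq : q.IsComplete) (hM : B.IsMBounded)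
    (hS : B.IsSemiNormalized) (hunb : B.HasUnboundedFundamental) :
    B.IsGreedy ↔ B.IsUnconditional ∧ B.IsSandwiched :=
  ⟨fun h => ⟨h.isUnconditional hM hS, h.isAlmostGreedy.isSandwiched hq hM hunb⟩,
    fun h => h.1.isGreedy hq h.2.isSandwichedZero.isSuperDemocratic⟩

end MarkushevichBasis

end Characterizations

end GreedyBases

theorem mainTheorem7 {𝕜 : Type*} [RCLike 𝕜] {X : Type*} [AddCommGroup X] [Module 𝕜 X]
    (q : QuasiNorm 𝕜 X) (hq : q.IsComplete) (B : MarkushevichBasis q) (hM : B.IsMBounded) :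
    -- characterizations of almost greedy bases and of greedy bases
    (B.IsSemiNormalized → B.HasUnboundedFundamental →
      (B.IsAlmostGreedy ↔ B.IsQuasiGreedy ∧ B.IsSandwiched) ∧
      (B.IsGreedy ↔ B.IsUnconditional ∧ B.IsSandwiched)) ∧
    (B.IsSemiNormalized →
      (B.IsAlmostGreedy ↔ B.IsQuasiGreedy ∧ B.IsSandwichedZero) ∧
      (B.IsGreedy ↔ B.IsUnconditional ∧ B.IsSandwichedZero)) ∧
    -- super-democracy and bounded restricted truncation give quasi-Banach enclosing spaces
    (B.IsSuperDemocratic → B.RestrictedTruncationBounded →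
      ∃ S₁ S₂ : (ℕ → 𝕜) → ℝ≥0∞, IsQuasiBanachGauge S₁ ∧ IsQuasiBanachGauge S₂ ∧
        B.IsSandwichedBetweenZero S₁ S₂ ∧
        (B.HasUnboundedFundamental → B.IsSandwichedBetween S₁ S₂)) ∧
    -- the enclosing spaces can be taken to be Lorentz spaces
    (B.IsSemiNormalized → ∀ p : ℝ, 0 < p → p ≤ 1 → q.IsPConvex p →
      B.IsSuperDemocratic → B.RestrictedTruncationBounded →
      ∀ w : ℕ → ℝ, (∀ n, 0 < w n) →
        SeqEquiv (fun m => ENNReal.ofReal (primitive w m)) B.upperFundamental →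
        IsQuasiBanachGauge (lorentz w p : (ℕ → 𝕜) → ℝ≥0∞) ∧
        IsQuasiBanachGauge (weakLorentz w : (ℕ → 𝕜) → ℝ≥0∞) ∧
        B.IsSandwichedBetweenZero (lorentz w p) (weakLorentz w) ∧
        (B.HasUnboundedFundamental → B.IsSandwichedBetween (lorentz w p) (weakLorentz w))) ∧
    -- conversely, an enclosure by Lorentz spaces determines the fundamental function
    -- (the hypothesis on `lorentz w p` follows from `B.LowerEmbeds (lorentz w p)`)
    (B.IsSemiNormalized → ∀ p : ℝ, 0 < p → ∀ w : ℕ → ℝ, (∀ n, 0 < w n) →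
      B.LowerEmbedsZero (lorentz w p) → B.UpperEmbeds (weakLorentz w) →
      SeqEquiv B.lowerFundamental (fun m => ENNReal.ofReal (primitive w m)) ∧
      SeqEquiv (fun m => ENNReal.ofReal (primitive w m)) B.upperFundamental) := by
  refine ⟨fun hS hunb => ⟨MarkushevichBasis.isAlmostGreedy_iff_isSandwiched hq hM hunb,
      MarkushevichBasis.isGreedy_iff_isSandwiched hq hM hS hunb⟩,
    fun hS => ⟨MarkushevichBasis.isAlmostGreedy_iff_isSandwichedZero hq hM,
      MarkushevichBasis.isGreedy_iff_isSandwichedZero hq hM hS⟩,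
    fun hsd hrt => B.exists_isSandwichedBetween hq hM hsd hrt,
    fun hS p hp hp1 hconv hsd hrt w hw hwu =>
      B.isSandwichedBetween_lorentz hq hM hS hp hp1 hconv hsd hrt hw hwu,
    fun _ p hp w hw hl hu => B.seqEquiv_fundamental_of_embeds hp hw hl hu⟩
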